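/- Let $\mathbb H$ be the upper half-plane with the hyperbolic metric of curvature $-1$, distance $d_{\mathbb H}$ and area element $d\mu=dx\,dy/y^2$. Let $\Gamma\subset \mathrm{PSL}_2(\mathbb R)$ be a discrete subgroup acting freely on $\mathbb H$ such that the hyperbolic Riemann surface $X=\Gamma\backslash\mathbb H$ has finite volume, and let $F\subset\mathbb H$ be a Borel fundamental domain (a Borel set meeting every $\Gamma$-orbit in exactly one point). For $z,w\in\mathbb H$ let $d_X(z,w)=\inf_{\gamma\in\Gamma}d_{\mathbb H}(z,\gamma w)$ be the geodesic distance on $X$ between their images. For $k\in\mathbb N$ identify $H^0(X,\Omega_X^{\otimes k})$, via $f(z)\,dz^{\otimes k}\leftrightarrow f$, with the space of cusp forms of weight $2k$ for $\Gamma$ (all holomorphic automorphic forms of weight $2k$ if $X$ is compact), with inner product $\langle f,g\rangle=\int_F y^{2k}f(z)\overline{g(z)}\,d\mu(z)$. Let $f_1,\dots,f_{j_k}$ be an orthonormal basis, and let the pointwise hyperbolic norm of the Bergman kernel at $z=x+iy$, $w=u+iv$ be $$\|\mathcal B^k_{\Omega_X}\|_{\mathrm{hyp}}(z,w)=y^kv^k\Big|\sum_{i=1}^{j_k}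 f_i(z)\overline{f_i(w)}\Big| .$$ For $k\ge 3$, $r>0$ and $\delta\geq r$ put $$\begin{aligned}C(k,\delta,r)=\;&\frac{(2k-1)\sinh(\delta+r)}{4\pi\cosh^{2k}((\delta-r)/2)\sinh(r)}+\frac{(2k-1)\sinh(\delta)}{2\pi\cosh^{2k}(\delta/2)}\cdot\frac{\cosh(r/4)}{\sinh(r/4)}\\&+\frac{2k-1}{2\pi(2k-2)\cosh^{2k-2}(\delta/2)}\Big(2+\frac1{\sinh^2(r/4)}\Big)+\frac{2k-1}{\pi(2k-4)\cosh^{2k-4}(\delta/2)}\cdot\frac1{\sinh^2(r/4)} .\end{aligned}$$ (1) Suppose that $X$ is compact, and let $r_X=\inf\{d_{\mathbb H}(z,\gamma z): z\in\mathbb H,\ \gamma\in\Gamma\setminus\{\mathrm{Id}\}\}$. Then for all $k\ge3$, $\delta\ge r_X$ and $z,w\in\mathbb H$ with $d_X(z,w)\ge\delta$, $$\|\mathcal B^k_{\Omega_X}\|_{\mathrm{hyp}}(z,w)\le C(k,\delta,r_X).$$ (2) Suppose that $X$ is noncompact, that $\infty$ is the only cusp of $\Gamma$ up to $\Gamma$-equivalence,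 and that its stabilizer $\Gamma_\infty$ is the group of translations $z\mapsto z+n$, $n\in\mathbb Z$. Let $r_X=\inf\{d_{\mathbb H}(z,\gamma z): z\in F,\ \gamma\in\Gamma\setminus\Gamma_\infty\}$, and suppose that $F$ is chosen so that $r_X>0$. Then for all $k\ge3$, $\delta\ge r_X$ and $z=x+iy,\ w=u+iv\in F$ with $d_X(z,w)\ge\delta$, $$\|\mathcal B^k_{\Omega_X}\|_{\mathrm{hyp}}(z,w)\le C(k,\delta,r_X)+\frac{2k-1}{4\pi\cosh^{2k}(\delta/2)}+\frac{(2k-1)\sqrt{yv}}{\sqrt\pi}\cdot\frac{\Gamma(k-\frac12)}{\Gamma(k)},$$ where in the last quotient $\Gamma$ denotes the Gamma function. (3) For every $r>0$ there is a constant $K>0$, depending only on $r$, such that $C(k,\delta,r)\le K\,k\,\cosh^{-(2k-4)}((\delta-r)/2)$ for all $k\ge3$ and $\delta\ge r$. -/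

import Mathlib

open UpperHalfPlane MeasureTheory
open scoped MatrixGroups

noncomputable section

namespace BergmanOffDiagonal

/-- `Γ` is a discrete subgroup of `SL(2, ℝ)` whose image in `PSL(2, ℝ)` acts freely on the upper
half-plane, so that `Γ \ ℍ` is a hyperbolic Riemann surface with universal cover `ℍ`. (The group
`Γ` may or may not contain `-1`; only its image in `PSL(2, ℝ)` matters below.) -/
structure IsSurfaceGroup (Γ : Subgroup SL(2, ℝ)) : Prop where
  discrete : DiscreteTopology Γ
  free : ∀ γ ∈ Γ, ∀ z : ℍ, γ • z = z → γ = 1 ∨ γ = -1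

/-- The topological space underlying the Riemann surface `X = Γ \ ℍ`. -/
abbrev Surface (Γ : Subgroup SL(2, ℝ)) : Type := MulAction.orbitRel.Quotient Γ ℍ

/-- A (Borel, strict) fundamental domain: a Borel set meeting every `Γ`-orbit in exactly one
point. As a set it is identified with `X = Γ \ ℍ`. -/
structure IsStrictFundamentalDomain (Γ : Subgroup SL(2, ℝ)) (F : Set ℍ) : Prop where
  measurableSet : MeasurableSet F
  existsUnique : ∀ z : ℍ, ∃! w : ℍ, w ∈ F ∧ ∃ γ ∈ Γ, γ • z = w

/-- The distance on `X = Γ \ ℍ` between the images of `z` and `w`, for the hyperbolic metric of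
curvature `-1`. -/
def surfaceDist (Γ : Subgroup SL(2, ℝ)) (z w : ℍ) : ℝ :=
  ⨅ γ : Γ, dist z ((γ : SL(2, ℝ)) • w)

/-- The injectivity radius of a compact surface: `inf d(z, γ z)` over `γ` nontrivial in
`PSL(2, ℝ)`. -/
def injRadiusCompact (Γ : Subgroup SL(2, ℝ)) : ℝ :=
  sInf {d : ℝ | ∃ z : ℍ, ∃ γ ∈ Γ, γ ≠ 1 ∧ γ ≠ -1 ∧ d = dist z (γ • z)}

/-- The injectivity radius of a noncompact surface with cusp `∞`: `inf d(z, γ z)`, with `z` in the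
fundamental domain `F` and `γ` in `Γ` not fixing `∞` (that is, with nonzero lower left entry). -/
def injRadiusNoncompact (Γ : Subgroup SL(2, ℝ)) (F : Set ℍ) : ℝ :=
  sInf {d : ℝ | ∃ z ∈ F, ∃ γ ∈ Γ, γ 1 0 ≠ 0 ∧ d = dist z (γ • z)}

/-- The group `Γ`, regarded in `GL(2, ℝ)`. -/
abbrev toGLSubgroup (Γ : Subgroup SL(2, ℝ)) : Subgroup (GL (Fin 2) ℝ) :=
  Γ.map Matrix.SpecialLinearGroup.toGL

/-- The cusp `∞` is, up to `Γ`, the only cusp, and its stabilizer in the image of `Γ` in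
`PSL(2, ℝ)` is exactly the group of integer translations. -/
structure IsNormalizedOneCusp (Γ : Subgroup SL(2, ℝ)) : Prop where
  stabilizer : ∀ A : SL(2, ℝ), (A 1 0 = 0 ∧ (A ∈ Γ ∨ -A ∈ Γ)) ↔
    ∃ n : ℤ, (A : Matrix (Fin 2) (Fin 2) ℝ) = !![1, (n : ℝ); 0, 1] ∨
      (A : Matrix (Fin 2) (Fin 2) ℝ) = -!![1, (n : ℝ); 0, 1]
  only_cusp : ∀ c : OnePoint ℝ, IsCusp c (toGLSubgroup Γ) →
    ∃ γ ∈ Γ, Matrix.SpecialLinearGroup.toGL γ • (OnePoint.infty : OnePoint ℝ) = c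

/-- The space `H⁰(X, Ω_X^{⊗ k})`, that is, the space of cusp forms of weight `2k` for `Γ`:
the form `f` corresponds to the section `f(z) dz^{⊗ k}`. When `X` is compact there are no cusps,
and these are all the holomorphic automorphic forms of weight `2k`. -/
abbrev Sections (Γ : Subgroup SL(2, ℝ)) (k : ℕ) : Type := CuspForm (toGLSubgroup Γ) (2 * (k : ℤ))

/-- The `L²` (Petersson) inner product `∫_X y^{2k} f(z) conj(g(z)) dx dy / y²`. On `ℍ`, `volume`
is the hyperbolic measure `dx dy / y²`. -/
def innerHyp (F : Set ℍ) (k : ℕ) (f g : ℍ → ℂ) : ℂ :=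
  ∫ z in F, ((z.im : ℝ) : ℂ) ^ (2 * k) * f z * (starRingEnd ℂ) (g z)

/-- `f 0, …, f (n - 1)` is an orthonormal basis of `H⁰(X, Ω_X^{⊗ k})`. -/
structure IsOrthonormalBasis (Γ : Subgroup SL(2, ℝ)) (F : Set ℍ) (k : ℕ) {n : ℕ}
    (f : Fin n → Sections Γ k) : Prop where
  orthonormal : ∀ i j, innerHyp F k (f i) (f j) = if i = j then 1 else 0
  spans : ∀ g : Sections Γ k, ∃ c : Fin n → ℂ, ∀ z : ℍ, g z = ∑ i, c i * f i z

/-- `B` is the coefficient function of the Bergman kernel of `Ω_X^{⊗ k}`: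
`B(z, w) = ∑ f_i(z) conj(f_i(w))` for an orthonormal basis `(f_i)`. -/
def IsBergmanKernel (Γ : Subgroup SL(2, ℝ)) (F : Set ℍ) (k : ℕ) (B : ℍ → ℍ → ℂ) : Prop :=
  ∃ (n : ℕ) (f : Fin n → Sections Γ k), IsOrthonormalBasis Γ F k f ∧
    ∀ z w : ℍ, B z w = ∑ i, f i z * (starRingEnd ℂ) (f i w)

/-- The pointwise hyperbolic norm `y^k v^k |B(z, w)|`, for `z = x + iy` and `w = u + iv`. -/
def hypNorm (k : ℕ) (B : ℍ → ℍ → ℂ) (z w : ℍ) : ℝ :=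
  z.im ^ k * w.im ^ k * ‖B z w‖

/-- The constant `C_X`, as a function of `k`, `δ` and the injectivity radius `r`. -/
def boundConst (k : ℕ) (δ r : ℝ) : ℝ :=
  (2 * k - 1) * Real.sinh (δ + r) /
      (4 * Real.pi * Real.cosh ((δ - r) / 2) ^ (2 * k) * Real.sinh r)
    + (2 * k - 1) * Real.sinh δ / (2 * Real.pi * Real.cosh (δ / 2) ^ (2 * k))
        * (Real.cosh (r / 4) / Real.sinh (r / 4))
    + (2 * k - 1) / (2 * Real.pi * (2 * k - 2) * Real.cosh (δ / 2) ^ (2 * k - 2))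
        * (2 + 1 / Real.sinh (r / 4) ^ 2)
    + (2 * k - 1) / (Real.pi * (2 * k - 4) * Real.cosh (δ / 2) ^ (2 * k - 4))
        * (1 / Real.sinh (r / 4) ^ 2)

end BergmanOffDiagonal

end

/-! The Bergman kernel is an explicit Poincaré series, so its norm is dominated by a sum over an
orbit, which is then estimated by packing disjoint hyperbolic balls.

On `ℍ` the kernel `planeKernel` satisfies `y^k v^k |K(z, w)| = cosh(d(z, w)/2)^(-2k)`
(`norm_planeKernel`) and reproduces holomorphic functions up to the factor `4π/(2k-1)`
(`integral_mul_planeKernel`): in geodesic polar coordinates around `w` the integrand is a radial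
function times a holomorphic function on the disc, and the mean value property does the angular
integral. Averaging `K` over `Γ` gives a cusp form, and unfolding (`innerHyp_poincare`) shows that
it pairs with each `f_i` as evaluation at `w`. Hence it is a multiple of the Bergman kernel
(`poincare_eq`), and `hypNorm_le` bounds the norm by `(2k-1)/(4π)` times the sum of `cosh(d(z,
p)/2)^(-2k)` over the points `p` of the orbit of `w`.

If these points are `s`-separated and at distance at least `δ` from `z`, the balls of radius `s/2`
around them are disjoint, and comparison with a radial integral gives `packingBound k δ s`
(`tsum_inv_cosh_pow_le`). In the compact case `s` is the injectivity radius `r`, and this is already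
below the last three terms of `boundConst`.

With a cusp, the orbit is split into the integer translates of `w`, compared with an integral over
the line that produces the Gamma quotient (`tsum_translates_le`), and the points `γ w` with `γ` not
fixing `∞`. By symmetry `Im w ≤ Im z`. If `w` is low, the orbit is still `r`-separated. If `w` is
high, the separation drops to some `s ≤ r`, but `|c| ≥ 2 sinh(r/2)` for every nonzero lower left
entry `c` (`two_sinh_le_abs`), which pushes these points away from `z` to a larger distance `δ'`.
The gain from `δ'` outweighs the loss from `s` (`packingBound_le_of_cusp`); the first term of
`boundConst` helps to absorb the difference. -/

namespace BergmanOffDiagonal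

/-! ### Disc model and geodesic polar coordinates. -/

/-- The holomorphic parametrization of the upper half-plane by the unit disc, sending `0` to
`z`. -/
noncomputable def discParam (z : ℍ) (ζ : ℂ) : ℂ :=
  (z - (starRingEnd ℂ) (z : ℂ) * ζ) / (1 - ζ)

lemma one_sub_ne_zero_of_norm_lt {ζ : ℂ} (h : ‖ζ‖ < 1) : 1 - ζ ≠ 0 := by
  intro h0
  have : ζ = 1 := (sub_eq_zero.mp h0).symm
  simp [this] at h

lemma discParam_sub_conj (z : ℍ) {ζ : ℂ} (h : ‖ζ‖ < 1) :
    discParam z ζ - (starRingEnd ℂ) (z : ℂ) = 2 * z.im * Complex.I / (1 - ζ) := by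
  have h1 := one_sub_ne_zero_of_norm_lt h
  have h2 : (z : ℂ) - (starRingEnd ℂ) (z : ℂ) = 2 * z.im * Complex.I := by
    rw [Complex.sub_conj]; push_cast; simp
  rw [discParam, eq_div_iff h1, sub_mul, div_mul_cancel₀ _ h1, ← h2]
  ring

lemma im_discParam (z : ℍ) {ζ : ℂ} (h : ‖ζ‖ < 1) :
    (discParam z ζ).im = z.im * (1 - ‖ζ‖ ^ 2) / ‖1 - ζ‖ ^ 2 := by
  have h1 := one_sub_ne_zero_of_norm_lt h
  have h2 := discParam_sub_conj z h
  have h3 : discParam z ζ = (starRingEnd ℂ) (z : ℂ)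
      + 2 * z.im * Complex.I * (starRingEnd ℂ) (1 - ζ) / ((‖1 - ζ‖ ^ 2 : ℝ) : ℂ) := by
    rw [sub_eq_iff_eq_add'] at h2
    rw [h2, ← Complex.normSq_eq_norm_sq, ← Complex.mul_conj]
    have : (starRingEnd ℂ) (1 - ζ) ≠ 0 := (map_ne_zero _).mpr h1
    field_simp
  have h4 : ‖1 - ζ‖ ^ 2 ≠ 0 := by positivity
  rw [h3, Complex.add_im, Complex.div_ofReal_im]
  simp only [Complex.conj_im, map_sub, map_one, Complex.mul_im, Complex.mul_re, Complex.I_re,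
    Complex.I_im, Complex.ofReal_re, Complex.ofReal_im, Complex.sub_re, Complex.sub_im,
    Complex.conj_re, Complex.one_re, Complex.one_im, Complex.re_ofNat, Complex.im_ofNat,
    UpperHalfPlane.coe_im]
  field_simp
  rw [← Complex.normSq_eq_norm_sq, ← Complex.normSq_eq_norm_sq, Complex.normSq_apply,
    Complex.normSq_apply]
  simp
  ring

lemma norm_one_sub_sq_pos {ζ : ℂ} (h : ‖ζ‖ < 1) : 0 < ‖1 - ζ‖ ^ 2 := by
  have := one_sub_ne_zero_of_norm_lt h
  positivity

lemma im_discParam_pos (z : ℍ) {ζ : ℂ} (h : ‖ζ‖ < 1) : 0 < (discParam z ζ).im := by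
  rw [im_discParam z h]
  have : 0 < 1 - ‖ζ‖ ^ 2 := by nlinarith [norm_nonneg ζ]
  have := norm_one_sub_sq_pos h
  have := z.im_pos
  positivity

lemma discParam_injOn (z : ℍ) : Set.InjOn (discParam z) (Metric.ball 0 1) := by
  intro a ha b hb hab
  rw [mem_ball_zero_iff] at ha hb
  have h1 := discParam_sub_conj z ha
  rw [hab, discParam_sub_conj z hb, div_eq_div_iff (one_sub_ne_zero_of_norm_lt hb)
    (one_sub_ne_zero_of_norm_lt ha)] at h1
  have h2 : (2 * z.im * Complex.I : ℂ) ≠ 0 := by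
    simp [z.im_ne_zero]
  have := mul_left_cancel₀ h2 h1
  linear_combination -this

lemma discParam_image (z : ℍ) :
    discParam z '' Metric.ball 0 1 = Set.range UpperHalfPlane.coe := by
  ext w
  constructor
  · rintro ⟨ζ, hζ, rfl⟩
    rw [mem_ball_zero_iff] at hζ
    exact ⟨⟨discParam z ζ, im_discParam_pos z hζ⟩, rfl⟩
  · rintro ⟨w, rfl⟩
    have hne : (w : ℂ) - (starRingEnd ℂ) (z : ℂ) ≠ 0 := by
      intro h
      have := congrArg Complex.im h
      simp at this
      linarith [w.im_pos, z.im_pos]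
    have hz : (z : ℂ) - (starRingEnd ℂ) (z : ℂ) ≠ 0 := by
      intro h
      have := congrArg Complex.im h
      simp at this
      linarith [z.im_pos]
    have hn : ‖((w : ℂ) - z) / (w - (starRingEnd ℂ) (z : ℂ))‖ < 1 := by
      rw [norm_div, div_lt_one (norm_pos_iff.mpr hne), ← sq_lt_sq₀ (norm_nonneg _) (norm_nonneg _),
        ← Complex.normSq_eq_norm_sq, ← Complex.normSq_eq_norm_sq, Complex.normSq_apply,
        Complex.normSq_apply]
      simp
      nlinarith [w.im_pos, z.im_pos, mul_pos w.im_pos z.im_pos]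
    refine ⟨((w : ℂ) - z) / (w - (starRingEnd ℂ) (z : ℂ)), mem_ball_zero_iff.mpr hn, ?_⟩
    have h1 := one_sub_ne_zero_of_norm_lt hn
    rw [discParam, div_eq_iff h1]
    field_simp
    ring

lemma hasDerivAt_discParam (z : ℍ) {ζ : ℂ} (h : ‖ζ‖ < 1) :
    HasDerivAt (discParam z) (2 * z.im * Complex.I / (1 - ζ) ^ 2) ζ := by
  have h1 := one_sub_ne_zero_of_norm_lt h
  have h2 : (z : ℂ) - (starRingEnd ℂ) (z : ℂ) = 2 * z.im * Complex.I := by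
    rw [Complex.sub_conj]; push_cast; simp
  have := (((hasDerivAt_id ζ).const_mul ((starRingEnd ℂ) (z : ℂ))).const_sub (z : ℂ)).div
    ((hasDerivAt_id ζ).const_sub 1) h1
  convert! this using 1
  rw [← h2]
  simp only [id]
  congr 1
  ring

lemma lintegral_upperHalfPlane {h : ℍ → ENNReal} (hh : Measurable h) :
    ∫⁻ w, h w = ∫⁻ w in Set.range UpperHalfPlane.coe,
      ENNReal.ofReal (1 / w.im ^ 2) * Function.extend UpperHalfPlane.coe h 0 w := by
  rw [← measurableEmbedding_coe.map_comap, measurableEmbedding_coe.lintegral_map, volume_def,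
    lintegral_withDensity_eq_lintegral_mul _ _ hh]
  · refine lintegral_congr fun w => ?_
    rw [Pi.mul_apply, measurableEmbedding_coe.injective.extend_apply]
    congr 1
    rw [← ENNReal.ofReal_coe_nnreal]
    congr 1
    simp [UpperHalfPlane.coe_im]
  · have : Measurable fun z : ℍ => NNReal.mk z.im z.im_pos.le :=
      Measurable.subtype_mk (UpperHalfPlane.continuous_im.measurable)
    fun_prop

/-- The Jacobian `|dψ/dζ|²` of `ψ = discParam z`, divided by `(Im ψ)²`, is the area density of the
disc model, whatever the centre `z`. -/
lemma lintegral_disc (z : ℍ) {h : ℍ → ENNReal} (hh : Measurable h) :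
    ∫⁻ w, h w = ∫⁻ ζ in Metric.ball (0 : ℂ) 1, ENNReal.ofReal (4 / (1 - ‖ζ‖ ^ 2) ^ 2) *
      Function.extend UpperHalfPlane.coe h 0 (discParam z ζ) := by
  rw [lintegral_upperHalfPlane hh, ← discParam_image z,
    lintegral_image_eq_lintegral_abs_det_fderiv_mul volume measurableSet_ball
      (fun ζ hζ => ((hasDerivAt_discParam z
        (mem_ball_zero_iff.mp hζ)).hasFDerivAt.restrictScalars ℝ).hasFDerivWithinAt)
      (discParam_injOn z)]
  refine setLIntegral_congr_fun measurableSet_ball fun ζ hζ => ?_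
  rw [mem_ball_zero_iff] at hζ
  rw [← mul_assoc, ← ENNReal.ofReal_mul (abs_nonneg _)]
  congr 2
  have hd : ((ContinuousLinearMap.toSpanSingleton ℂ
      (2 * z.im * Complex.I / (1 - ζ) ^ 2 : ℂ)).restrictScalars ℝ).det
      = ‖(2 * z.im * Complex.I / (1 - ζ) ^ 2 : ℂ)‖ ^ 2 := by
    simp [ContinuousLinearMap.det, LinearMap.det_restrictScalars, Algebra.norm_complex_apply,
      Complex.normSq_eq_norm_sq, div_pow]
  rw [hd, im_discParam z hζ]
  have h1 : 0 < ‖1 - ζ‖ := norm_pos_iff.mpr (one_sub_ne_zero_of_norm_lt hζ)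
  have h2 : 0 < 1 - ‖ζ‖ ^ 2 := by nlinarith [norm_nonneg ζ]
  have h3 := z.im_pos
  rw [abs_of_nonneg (by positivity), norm_div, norm_pow]
  simp only [norm_mul, Complex.norm_I, Complex.norm_real, Complex.norm_ofNat, Real.norm_eq_abs,
    abs_of_pos h3]
  field_simp
  norm_num

lemma tanh_half_lt_one (t : ℝ) : |Real.tanh (t / 2)| < 1 := by
  rw [abs_lt]
  exact ⟨Real.neg_one_lt_tanh _, Real.tanh_lt_one _⟩

lemma norm_tanh_mul_exp (t θ : ℝ) :
    ‖(Real.tanh (t / 2) : ℂ) * Complex.exp (θ * Complex.I)‖ = |Real.tanh (t / 2)| := by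
  rw [norm_mul, Complex.norm_exp_ofReal_mul_I, mul_one, Complex.norm_real, Real.norm_eq_abs]

/-- The point with geodesic polar coordinates `(t, θ)` around `z`. -/
noncomputable def polarPoint (z : ℍ) (t θ : ℝ) : ℍ :=
  ⟨discParam z (Real.tanh (t / 2) * Complex.exp (θ * Complex.I)), im_discParam_pos z (by
    rw [norm_tanh_mul_exp]; exact tanh_half_lt_one t)⟩

lemma coe_polarPoint (z : ℍ) (t θ : ℝ) : (polarPoint z t θ : ℂ) =
    discParam z (Real.tanh (t / 2) * Complex.exp (θ * Complex.I)) := rfl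

lemma hasDerivAt_tanh_half (t : ℝ) :
    HasDerivAt (fun t : ℝ => Real.tanh (t / 2)) ((1 - Real.tanh (t / 2) ^ 2) / 2) t := by
  have hc := (Real.cosh_pos (t / 2)).ne'
  have h1 := (hasDerivAt_id t).div_const 2
  have h2 := ((Real.hasDerivAt_sinh _).comp t h1).div ((Real.hasDerivAt_cosh _).comp t h1) hc
  have h3 : (fun t : ℝ => Real.tanh (t / 2)) =
      (Real.sinh ∘ fun x => id x / 2) / (Real.cosh ∘ fun x => id x / 2) := by
    funext s
    simp [Real.tanh_eq_sinh_div_cosh]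
  rw [h3]
  convert! h2 using 1
  simp only [Function.comp_apply, id, Real.tanh_eq_sinh_div_cosh]
  field_simp

lemma tanh_half_image : (fun t : ℝ => Real.tanh (t / 2)) '' Set.Ioi 0 = Set.Ioo 0 1 := by
  ext x
  constructor
  · rintro ⟨t, ht, rfl⟩
    refine ⟨?_, Real.tanh_lt_one _⟩
    simp only [Real.tanh_eq_sinh_div_cosh]
    exact div_pos (Real.sinh_pos_iff.mpr (half_pos ht)) (Real.cosh_pos _)
  · rintro ⟨h0, h1⟩
    refine ⟨2 * Real.artanh x, ?_, ?_⟩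
    · exact mul_pos two_pos (Real.artanh_pos ⟨h0, h1⟩)
    · simp only [mul_div_cancel_left₀ _ (two_ne_zero (α := ℝ))]
      exact Real.tanh_artanh ⟨by linarith, h1⟩

/-- With `ρ = tanh(t/2)`, the right side is `dρ/dt` times the Euclidean polar factor `ρ` times the
disc density `4/(1-ρ²)²`; this makes `sinh t` the radial density. -/
lemma sinh_eq_tanh_half (t : ℝ) : Real.sinh t =
    (1 - Real.tanh (t / 2) ^ 2) / 2 * (Real.tanh (t / 2) * (4 / (1 - Real.tanh (t / 2) ^ 2) ^ 2)) := by
  have hc := Real.cosh_pos (t / 2)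
  have h1 : 1 - Real.tanh (t / 2) ^ 2 = 1 / Real.cosh (t / 2) ^ 2 := by
    rw [Real.tanh_eq_sinh_div_cosh]
    field_simp
    linarith [Real.cosh_sq (t / 2)]
  rw [h1, Real.tanh_eq_sinh_div_cosh]
  nth_rw 1 [show t = 2 * (t / 2) by ring]
  rw [Real.sinh_two_mul]
  field_simp
  ring

/-- Integration over the hyperbolic plane in geodesic polar coordinates. -/
theorem lintegral_geodesicPolar (z : ℍ) {h : ℍ → ENNReal} (hh : Measurable h) :
    ∫⁻ w, h w = ∫⁻ t in Set.Ioi (0 : ℝ), ENNReal.ofReal (Real.sinh t) *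
      ∫⁻ θ in Set.Ioo (-Real.pi) Real.pi, h (polarPoint z t θ) := by
  have hH : Measurable (Function.extend UpperHalfPlane.coe h 0) :=
    measurableEmbedding_coe.measurable_extend hh measurable_const
  have hψ : Measurable (discParam z) := by
    unfold discParam; fun_prop
  set H := Function.extend UpperHalfPlane.coe h 0
  have hHG : Measurable fun ζ : ℂ => (Metric.ball (0 : ℂ) 1).indicator
      (fun ζ => ENNReal.ofReal (4 / (1 - ‖ζ‖ ^ 2) ^ 2) * H (discParam z ζ)) ζ := by
    refine Measurable.indicator ?_ measurableSet_ball
    refine Measurable.mul (by fun_prop) (hH.comp hψ)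
  have hpc : Measurable fun p : ℝ × ℝ => Complex.polarCoord.symm p := by
    have : (fun p : ℝ × ℝ => Complex.polarCoord.symm p) =
        fun p => (p.1 : ℂ) * (Real.cos p.2 + Real.sin p.2 * Complex.I) :=
      funext fun p => Complex.polarCoord_symm_apply p
    rw [this]
    fun_prop
  rw [lintegral_disc z hh, ← lintegral_indicator measurableSet_ball,
    ← Complex.lintegral_comp_polarCoord_symm, polarCoord_target, Measure.volume_eq_prod,
    ← Measure.prod_restrict, lintegral_prod _ (by
      refine Measurable.aemeasurable ?_
      exact Measurable.smul measurable_fst.ennreal_ofReal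
        (hHG.comp hpc))]
  have h1 : ∀ ρ ∈ Set.Ioi (0 : ℝ), (∫⁻ θ in Set.Ioo (-Real.pi) Real.pi, ENNReal.ofReal ρ •
      (Metric.ball (0 : ℂ) 1).indicator (fun ζ => ENNReal.ofReal (4 / (1 - ‖ζ‖ ^ 2) ^ 2) *
        H (discParam z ζ)) (Complex.polarCoord.symm (ρ, θ))) =
      (Set.Ioo (0 : ℝ) 1).indicator (fun ρ => ENNReal.ofReal (ρ * (4 / (1 - ρ ^ 2) ^ 2)) *
        ∫⁻ θ in Set.Ioo (-Real.pi) Real.pi, H (discParam z (ρ * Complex.exp (θ * Complex.I)))) ρ := by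
    intro ρ hρ
    have hn : ∀ θ : ℝ, ‖Complex.polarCoord.symm (ρ, θ)‖ = ρ := fun θ => by
      rw [Complex.norm_polarCoord_symm]; exact abs_of_pos hρ
    by_cases h1 : ρ < 1
    · rw [Set.indicator_of_mem (show ρ ∈ Set.Ioo (0 : ℝ) 1 from ⟨hρ, h1⟩),
        ENNReal.ofReal_mul (le_of_lt hρ), mul_assoc, ← lintegral_const_mul' _ _ (by simp),
        ← lintegral_const_mul' _ _ (by simp)]
      refine lintegral_congr fun θ => ?_
      rw [Set.indicator_of_mem (mem_ball_zero_iff.mpr ((hn θ).trans_lt h1)), hn, smul_eq_mul,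
        Complex.polarCoord_symm_apply, Complex.exp_mul_I]
      simp
    · rw [Set.indicator_of_notMem (fun h => h1 h.2)]
      refine (lintegral_congr fun θ => ?_).trans lintegral_zero
      rw [Set.indicator_of_notMem, smul_zero]
      rw [mem_ball_zero_iff, hn]
      exact h1
  rw [setLIntegral_congr_fun measurableSet_Ioi h1, lintegral_indicator measurableSet_Ioo,
    Measure.restrict_restrict measurableSet_Ioo, Set.inter_eq_self_of_subset_left
      Set.Ioo_subset_Ioi_self, ← tanh_half_image, lintegral_image_eq_lintegral_abs_deriv_mul
      measurableSet_Ioi (fun t _ => (hasDerivAt_tanh_half t).hasDerivWithinAt)]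
  · refine setLIntegral_congr_fun measurableSet_Ioi fun t ht => ?_
    have h2 : 0 ≤ (1 - Real.tanh (t / 2) ^ 2) / 2 := by
      have := tanh_half_lt_one t
      rw [← sq_lt_one_iff_abs_lt_one] at this
      linarith
    rw [abs_of_nonneg h2, ← mul_assoc, ← ENNReal.ofReal_mul h2, ← sinh_eq_tanh_half]
    congr 1
    refine lintegral_congr fun θ => ?_
    rw [← coe_polarPoint]
    exact measurableEmbedding_coe.injective.extend_apply _ _ _
  · intro a _ b _ hab
    have := Real.tanh_injective hab
    linarith

lemma continuous_polarPoint (z : ℍ) : Continuous fun p : ℝ × ℝ => polarPoint z p.1 p.2 := by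
  rw [UpperHalfPlane.isOpenEmbedding_coe.isEmbedding.continuous_iff]
  have ht : Continuous fun t : ℝ => Real.tanh (t / 2) :=
    continuous_iff_continuousAt.mpr fun t => (hasDerivAt_tanh_half t).continuousAt
  refine Continuous.div ?_ ?_ fun p => one_sub_ne_zero_of_norm_lt ?_
  · have := Complex.continuous_ofReal.comp (ht.comp continuous_fst (X := ℝ × ℝ))
    simp only [Function.comp_def] at this
    fun_prop
  · have := Complex.continuous_ofReal.comp (ht.comp continuous_fst (X := ℝ × ℝ))
    simp only [Function.comp_def] at this
    fun_prop
  · rw [norm_tanh_mul_exp]; exact tanh_half_lt_one _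

lemma cosh_half_dist_sq (z w : ℍ) : Real.cosh (dist z w / 2) ^ 2 =
    ‖(w : ℂ) - (starRingEnd ℂ) (z : ℂ)‖ ^ 2 / (4 * (z.im * w.im)) := by
  rw [dist_comm, UpperHalfPlane.cosh_half_dist, Complex.dist_eq, div_pow, mul_pow,
    Real.sq_sqrt (mul_pos w.im_pos z.im_pos).le]
  ring

lemma one_sub_tanh_sq (x : ℝ) : 1 - Real.tanh x ^ 2 = 1 / Real.cosh x ^ 2 := by
  have hc := Real.cosh_pos x
  rw [Real.tanh_eq_sinh_div_cosh]
  field_simp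
  linarith [Real.cosh_sq x]

lemma dist_polarPoint (z : ℍ) (t θ : ℝ) : dist z (polarPoint z t θ) = |t| := by
  have hζ : ‖(Real.tanh (t / 2) : ℂ) * Complex.exp (θ * Complex.I)‖ < 1 := by
    rw [norm_tanh_mul_exp]; exact tanh_half_lt_one t
  have h1 := one_sub_ne_zero_of_norm_lt hζ
  have h2 : Real.cosh (dist z (polarPoint z t θ) / 2) ^ 2 = Real.cosh (t / 2) ^ 2 := by
    have him : (polarPoint z t θ).im = (discParam z _).im := rfl
    rw [cosh_half_dist_sq, coe_polarPoint, discParam_sub_conj z hζ, him, im_discParam z hζ,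
      norm_tanh_mul_exp, sq_abs, one_sub_tanh_sq]
    have := Real.cosh_pos (t / 2)
    have h3 := z.im_pos
    have h4 := norm_pos_iff.mpr h1
    simp only [norm_mul, norm_div, Complex.norm_I, Complex.norm_real, Complex.norm_ofNat,
      Real.norm_eq_abs, abs_of_pos h3]
    field_simp
    norm_num
  have h3 := (sq_eq_sq₀ (Real.cosh_pos _).le (Real.cosh_pos _).le).mp h2
  have h4 : |dist z (polarPoint z t θ) / 2| = |t / 2| :=
    le_antisymm (Real.cosh_le_cosh.mp h3.le) (Real.cosh_le_cosh.mp h3.ge)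
  rw [abs_div, abs_div, abs_of_nonneg dist_nonneg] at h4
  simpa using h4

/-- The radial form of integration in geodesic polar coordinates. -/
theorem lintegral_radial (z : ℍ) {g : ℝ → ENNReal} (hg : Measurable g) :
    ∫⁻ w, g (dist z w) = ENNReal.ofReal (2 * Real.pi) *
      ∫⁻ t in Set.Ioi (0 : ℝ), ENNReal.ofReal (Real.sinh t) * g t := by
  have hh : Measurable fun w : ℍ => g (dist z w) :=
    hg.comp (continuous_const.dist continuous_id).measurable
  rw [lintegral_geodesicPolar z hh, ← lintegral_const_mul' _ _ ENNReal.ofReal_ne_top]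
  refine setLIntegral_congr_fun measurableSet_Ioi fun t ht => ?_
  simp only [dist_polarPoint, abs_of_pos (Set.mem_Ioi.mp ht), setLIntegral_const, Real.volume_Ioo]
  rw [show Real.pi - -Real.pi = 2 * Real.pi by ring]
  ring

/-! ### Radial integrals and the reproducing kernel of the plane. -/

open Filter Topology in
lemma tendsto_inv_cosh_half_pow {n : ℕ} (hn : n ≠ 0) :
    Tendsto (fun t : ℝ => (Real.cosh (t / 2) ^ n)⁻¹) atTop (𝓝 0) := by
  have h0 : Tendsto Real.cosh atTop atTop := by
    refine tendsto_atTop_mono (fun x => ?_) tendsto_id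
    have h1 := Real.cosh_sq x
    have h2 : |Real.sinh x| ≤ Real.cosh x := abs_le_of_sq_le_sq (by linarith) (Real.cosh_pos x).le
    rcases le_total 0 x with hx | hx
    · exact (Real.self_le_sinh_iff.mpr hx).trans ((le_abs_self _).trans h2)
    · exact hx.trans (Real.cosh_pos x).le
  exact ((tendsto_pow_atTop hn).comp
    (h0.comp (tendsto_id.atTop_div_const two_pos))).inv_tendsto_atTop

lemma hasDerivAt_inv_cosh_half_pow {n : ℕ} (hn : n ≠ 0) (t : ℝ) :
    HasDerivAt (fun t : ℝ => -(2 / n) * (Real.cosh (t / 2) ^ n)⁻¹)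
      (Real.sinh (t / 2) / Real.cosh (t / 2) ^ (n + 1)) t := by
  have hc := (Real.cosh_pos (t / 2)).ne'
  have h0 : HasDerivAt (fun t : ℝ => Real.cosh (t / 2)) (Real.sinh (t / 2) * (1 / 2)) t :=
    ((hasDerivAt_id t).div_const 2).cosh
  have h1 := (h0.pow n).inv (pow_ne_zero n hc)
  convert! h1.const_mul (-(2 / n : ℝ)) using 1
  obtain ⟨m, rfl⟩ := Nat.exists_eq_succ_of_ne_zero hn
  have : (m.succ : ℝ) ≠ 0 := by positivity
  simp only [Nat.succ_eq_add_one, Nat.add_sub_cancel, Pi.pow_apply]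
  field_simp
  ring

lemma integral_sinh_div_cosh_pow {n : ℕ} (hn : n ≠ 0) {a : ℝ} (ha : 0 ≤ a) :
    IntegrableOn (fun t : ℝ => Real.sinh (t / 2) / Real.cosh (t / 2) ^ (n + 1)) (Set.Ioi a) ∧
    ∫ t in Set.Ioi a, Real.sinh (t / 2) / Real.cosh (t / 2) ^ (n + 1) =
      2 / n / Real.cosh (a / 2) ^ n := by
  have h1 : ∀ t ∈ Set.Ioi a, 0 ≤ Real.sinh (t / 2) / Real.cosh (t / 2) ^ (n + 1) := fun t ht => by
    have := (Real.cosh_pos (t / 2))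
    have := Real.sinh_nonneg_iff.mpr (half_pos (ha.trans_lt ht)).le
    positivity
  have h2 := (tendsto_inv_cosh_half_pow hn).const_mul (-(2 / n : ℝ))
  refine ⟨integrableOn_Ioi_deriv_of_nonneg' (fun t _ => hasDerivAt_inv_cosh_half_pow hn t) h1 h2, ?_⟩
  rw [integral_Ioi_of_hasDerivAt_of_nonneg' (fun t _ => hasDerivAt_inv_cosh_half_pow hn t) h1 h2]
  ring

/-- The radial part of the hyperbolic measure in geodesic polar coordinates. -/
noncomputable def radialMeasure : Measure ℝ :=
  (volume.restrict (Set.Ioi 0)).withDensity fun t => ENNReal.ofReal (Real.sinh t)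

instance : SFinite radialMeasure := by unfold radialMeasure; infer_instance

theorem measurePreserving_polarPoint (z : ℍ) :
    MeasurePreserving (fun p : ℝ × ℝ => polarPoint z p.1 p.2)
      (radialMeasure.prod (volume.restrict (Set.Ioo (-Real.pi) Real.pi))) volume := by
  have hm := (continuous_polarPoint z).measurable
  refine ⟨hm, Measure.ext fun s hs => ?_⟩
  have hI : Measurable (s.indicator (1 : ℍ → ENNReal)) := measurable_one.indicator hs
  have hIm : Measurable fun p : ℝ × ℝ => s.indicator (1 : ℍ → ENNReal) (polarPoint z p.1 p.2) :=
    hI.comp hm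
  rw [← lintegral_indicator_one hs, ← lintegral_indicator_one hs, lintegral_map hI hm,
    lintegral_prod _ hIm.aemeasurable, lintegral_geodesicPolar z hI, radialMeasure,
    lintegral_withDensity_eq_lintegral_mul]
  · rfl
  · exact Real.measurable_sinh.ennreal_ofReal
  · exact hIm.lintegral_prod_right'

/-- The reproducing kernel of weight `2k` on the upper half-plane, up to a constant factor. -/
noncomputable def planeKernel (k : ℕ) (z w : ℍ) : ℂ :=
  ((((z : ℂ) - (starRingEnd ℂ) (w : ℂ)) / (2 * Complex.I)) ^ (2 * k))⁻¹

lemma conj_planeKernel (k : ℕ) (z w : ℍ) :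
    (starRingEnd ℂ) (planeKernel k z w) = planeKernel k w z := by
  simp only [planeKernel, map_inv₀, map_pow, map_div₀, map_sub, map_mul, Complex.conj_conj,
    Complex.conj_I, map_ofNat]
  congr 2
  rw [mul_neg, div_neg, ← neg_div, neg_sub]

lemma norm_planeKernel (k : ℕ) (z w : ℍ) :
    z.im ^ k * w.im ^ k * ‖planeKernel k z w‖ = (Real.cosh (dist z w / 2) ^ (2 * k))⁻¹ := by
  have h : ‖((z : ℂ) - (starRingEnd ℂ) (w : ℂ)) / (2 * Complex.I)‖ ^ 2 =
      z.im * w.im * Real.cosh (dist z w / 2) ^ 2 := by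
    rw [dist_comm, cosh_half_dist_sq, norm_div, norm_mul, Complex.norm_I, Complex.norm_ofNat]
    have := z.im_ne_zero
    have := w.im_ne_zero
    field_simp
    norm_num
  rw [planeKernel, norm_inv, norm_pow, pow_mul, h, mul_pow, mul_pow, ← pow_mul]
  have := z.im_pos
  have := w.im_pos
  have := Real.cosh_pos (dist z w / 2)
  field_simp

/-- With `ζ` the disc coordinate, the weight contributes `|1-ζ|^(-4k)` and the kernel `(1-conj
ζ)^(2k)`. The antiholomorphic factors cancel, and what depends on the angle is the holomorphic
function `(1-ζ)^(-2k)`. -/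
lemma kernel_weight_polarPoint (k : ℕ) (w : ℍ) (t θ : ℝ) :
    (((polarPoint w t θ).im : ℂ)) ^ (2 * k) * planeKernel k w (polarPoint w t θ) =
      ((Real.cosh (t / 2) ^ (4 * k))⁻¹ : ℝ) *
        ((1 - Real.tanh (t / 2) * Complex.exp (θ * Complex.I)) ^ (2 * k))⁻¹ := by
  have hζ : ‖(Real.tanh (t / 2) : ℂ) * Complex.exp (θ * Complex.I)‖ < 1 := by
    rw [norm_tanh_mul_exp]; exact tanh_half_lt_one t
  have hn := norm_tanh_mul_exp t θ
  have him : (polarPoint w t θ).im = (discParam w _).im := rfl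
  rw [planeKernel, him, coe_polarPoint]
  generalize (Real.tanh (t / 2) : ℂ) * Complex.exp (θ * Complex.I) = ζ at *
  have h1 := one_sub_ne_zero_of_norm_lt hζ
  have h1' : 1 - (starRingEnd ℂ) ζ ≠ 0 := by
    rw [← map_one (starRingEnd ℂ), ← map_sub]; exact (map_ne_zero _).mpr h1
  have h2 := discParam_sub_conj w hζ
  have h3 : (w : ℂ) - (starRingEnd ℂ) (discParam w ζ) =
      2 * Complex.I * (w.im / (1 - (starRingEnd ℂ) ζ)) := by
    have := congrArg (starRingEnd ℂ) h2
    simp only [map_sub, map_div₀, map_mul, Complex.conj_conj, Complex.conj_I, Complex.conj_ofReal,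
      map_ofNat, map_one] at this
    rw [← neg_sub, this]
    ring
  have hI : (2 * Complex.I : ℂ) ≠ 0 := by simp
  have hw : (w.im : ℂ) ≠ 0 := by exact_mod_cast w.im_ne_zero
  rw [h3, mul_div_cancel_left₀ _ hI, im_discParam w hζ, hn, sq_abs, one_sub_tanh_sq,
    ← Complex.normSq_eq_norm_sq]
  have hc : (Real.cosh (t / 2) : ℂ) ≠ 0 := by exact_mod_cast (Real.cosh_pos _).ne'
  have h4 : ((Complex.normSq (1 - ζ) : ℝ) : ℂ) = (1 - ζ) * (1 - (starRingEnd ℂ) ζ) := by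
    rw [← Complex.mul_conj]; simp
  rw [show 4 * k = 2 * (2 * k) by ring, pow_mul _ 2 (2 * k)]
  push_cast [h4]
  push_cast at hc
  simp only [← inv_pow]
  rw [← mul_pow, ← mul_pow]
  congr 1
  field_simp

/-- Holomorphic functions on the upper half-plane are reproduced by the weight `2k` kernel. -/
theorem integral_mul_planeKernel {k : ℕ} (hk : 1 ≤ k) {φ : ℍ → ℂ}
    (hφ : DifferentiableOn ℂ (φ ∘ ofComplex) {z | 0 < z.im}) (w : ℍ)
    (hint : Integrable fun z : ℍ => (z.im : ℂ) ^ (2 * k) * φ z * planeKernel k w z) :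
    ∫ z : ℍ, (z.im : ℂ) ^ (2 * k) * φ z * planeKernel k w z =
      (4 * Real.pi / (2 * k - 1) : ℝ) * φ w := by
  set g : ℂ → ℂ := fun ζ => (φ ∘ ofComplex) (discParam w ζ) * ((1 - ζ) ^ (2 * k))⁻¹ with hg
  have hmp := measurePreserving_polarPoint w
  have hgd : DifferentiableOn ℂ g (Metric.ball 0 1) := by
    intro ζ hζ
    have hζ' := mem_ball_zero_iff.mp hζ
    have h1 := one_sub_ne_zero_of_norm_lt hζ'
    have hop : IsOpen {z : ℂ | 0 < z.im} := isOpen_lt continuous_const Complex.continuous_im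
    have h2 := (hφ.differentiableAt (hop.mem_nhds (im_discParam_pos w hζ'))).comp ζ
      (hasDerivAt_discParam w hζ').differentiableAt
    refine (h2.mul ?_).differentiableWithinAt
    exact DifferentiableAt.inv (by fun_prop) (pow_ne_zero _ h1)
  have hpt : ∀ t θ : ℝ, ((polarPoint w t θ).im : ℂ) ^ (2 * k) * φ (polarPoint w t θ) *
      planeKernel k w (polarPoint w t θ) = ((Real.cosh (t / 2) ^ (4 * k))⁻¹ : ℝ) *
        g (Real.tanh (t / 2) * Complex.exp (θ * Complex.I)) := by
    intro t θ
    rw [mul_right_comm, kernel_weight_polarPoint, hg]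
    simp only [Function.comp_apply]
    rw [← coe_polarPoint, ofComplex_apply]
    ring
  -- Mean value property: `g` is holomorphic on the unit disc, the circle has radius `|tanh(t/2)| <
  -- 1`, and `g 0 = φ w`.
  have hang : ∀ t : ℝ, ∫ θ in Set.Ioo (-Real.pi) Real.pi,
      g (Real.tanh (t / 2) * Complex.exp (θ * Complex.I)) = (2 * Real.pi : ℝ) * φ w := by
    intro t
    have hsub : Metric.closedBall (0 : ℂ) |Real.tanh (t / 2)| ⊆ Metric.ball 0 1 :=
      Metric.closedBall_subset_ball (tanh_half_lt_one t)
    have h1 : Real.circleAverage g 0 (Real.tanh (t / 2)) = g 0 :=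
      DiffContOnCl.circleAverage ((hgd.mono hsub).diffContOnCl_ball subset_rfl)
    have h2 : g 0 = φ w := by
      simp [hg, discParam]
    rw [Real.circleAverage_def, h2] at h1
    have hper : Function.Periodic
        (fun θ : ℝ => g (circleMap 0 (Real.tanh (t / 2)) θ)) (2 * Real.pi) := fun θ => by
      simp only [periodic_circleMap 0 (Real.tanh (t / 2)) θ]
    have h3 := hper.intervalIntegral_add_eq 0 (-Real.pi)
    rw [zero_add, show -Real.pi + 2 * Real.pi = Real.pi by ring] at h3
    rw [h3, intervalIntegral.integral_of_le (by linarith [Real.pi_pos]),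
      integral_Ioc_eq_integral_Ioo] at h1
    simp only [circleMap, zero_add] at h1
    rw [← h1, Complex.real_smul, ← mul_assoc, ← Complex.ofReal_mul,
      mul_inv_cancel₀ (by positivity), Complex.ofReal_one, one_mul]
  have hrad : ∫ t, ((Real.cosh (t / 2) ^ (4 * k))⁻¹ : ℝ) ∂radialMeasure = 2 / (2 * k - 1) := by
    rw [radialMeasure, integral_withDensity_eq_integral_toReal_smul
      Real.measurable_sinh.ennreal_ofReal (by simp)]
    have h1 := (integral_sinh_div_cosh_pow (n := 4 * k - 2) (by omega) le_rfl).2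
    have h2 : ((4 * k - 2 : ℕ) : ℝ) = 4 * k - 2 := by
      rw [Nat.cast_sub (by omega)]; push_cast; ring
    have hk' : (1 : ℝ) ≤ k := by exact_mod_cast hk
    calc _ = ∫ t in Set.Ioi (0 : ℝ),
          2 * (Real.sinh (t / 2) / Real.cosh (t / 2) ^ (4 * k - 2 + 1)) := by
          refine setIntegral_congr_fun measurableSet_Ioi fun t ht => ?_
          have hc := Real.cosh_pos (t / 2)
          rw [ENNReal.toReal_ofReal (Real.sinh_nonneg_iff.mpr (le_of_lt ht)), smul_eq_mul,
            show Real.sinh t = 2 * Real.sinh (t / 2) * Real.cosh (t / 2) by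
              rw [← Real.sinh_two_mul]; congr 1; ring,
            show Real.cosh (t / 2) ^ (4 * k) = Real.cosh (t / 2) ^ (4 * k - 2 + 1) *
              Real.cosh (t / 2) by rw [← pow_succ]; congr 1; omega]
          field_simp
      _ = _ := by
          rw [integral_const_mul, h1, h2]
          simp only [zero_div, Real.cosh_zero, one_pow, div_one]
          rw [show (4 * k - 2 : ℝ) = 2 * (2 * k - 1) by ring]
          field_simp
  have hint' := (hmp.integrable_comp hint.aestronglyMeasurable).mpr hint
  rw [← hmp.map_eq, integral_map hmp.measurable.aemeasurable
    (by rw [hmp.map_eq]; exact hint.aestronglyMeasurable), integral_prod (fun p : ℝ × ℝ => ((polarPoint w p.1 p.2).im : ℂ) ^ (2 * k) *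
      φ (polarPoint w p.1 p.2) * planeKernel k w (polarPoint w p.1 p.2)) hint']
  simp only [hpt, integral_const_mul, hang]
  rw [integral_mul_const, integral_complex_ofReal, hrad, ← mul_assoc, ← Complex.ofReal_mul]
  congr 2
  ring

/-! ### Packing bound for separated points. -/

lemma setLIntegral_sinh {a b : ℝ} (ha : 0 ≤ a) (hab : a ≤ b) :
    ∫⁻ t in Set.Ioc a b, ENNReal.ofReal (Real.sinh t) =
      ENNReal.ofReal (Real.cosh b - Real.cosh a) := by
  rw [← ofReal_integral_eq_lintegral_ofReal, ← intervalIntegral.integral_of_le hab]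
  · congr 1
    exact intervalIntegral.integral_eq_sub_of_hasDerivAt (fun t _ => Real.hasDerivAt_cosh t)
      (Real.continuous_sinh.intervalIntegrable _ _)
  · exact (Real.continuous_sinh.integrableOn_Icc).mono_set Set.Ioc_subset_Icc_self
  · filter_upwards [ae_restrict_mem measurableSet_Ioc] with t ht
    exact Real.sinh_nonneg_iff.mpr (ha.trans ht.1.le)

/-- The area of a hyperbolic ball. -/
lemma volume_ball (p : ℍ) {ρ : ℝ} (hρ : 0 ≤ ρ) : volume (Metric.ball p ρ) =
    ENNReal.ofReal (4 * Real.pi * Real.sinh (ρ / 2) ^ 2) := by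
  have h1 : volume (Metric.ball p ρ) =
      ∫⁻ w, (Set.Iio ρ).indicator (1 : ℝ → ENNReal) (dist p w) := by
    rw [← lintegral_indicator_one measurableSet_ball]
    refine lintegral_congr fun w => ?_
    simp only [Set.indicator, Metric.mem_ball, Set.mem_Iio, dist_comm, Pi.one_apply]
  rw [h1, lintegral_radial p (measurable_one.indicator measurableSet_Iio)]
  have h2 : ∀ t, ENNReal.ofReal (Real.sinh t) * (Set.Iio ρ).indicator (1 : ℝ → ENNReal) t =
      (Set.Iio ρ).indicator (fun t => ENNReal.ofReal (Real.sinh t)) t := fun t => by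
    by_cases h : t ∈ Set.Iio ρ <;> simp [h]
  simp only [h2]
  rw [lintegral_indicator measurableSet_Iio, Measure.restrict_restrict measurableSet_Iio,
    Set.Iio_inter_Ioi, restrict_Ioo_eq_restrict_Ioc, setLIntegral_sinh le_rfl hρ,
    ← ENNReal.ofReal_mul (by positivity)]
  congr 1
  nth_rw 1 [show ρ = 2 * (ρ / 2) by ring]
  rw [Real.cosh_two_mul, Real.cosh_sq, Real.cosh_zero]
  ring

lemma inv_cosh_half_pow_anti (n : ℕ) {a b : ℝ} (ha : 0 ≤ a) (hab : a ≤ b) :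
    (Real.cosh (b / 2) ^ n)⁻¹ ≤ (Real.cosh (a / 2) ^ n)⁻¹ := by
  have h1 : Real.cosh (a / 2) ≤ Real.cosh (b / 2) := by
    rw [Real.cosh_le_cosh, abs_of_nonneg (by linarith), abs_of_nonneg (by linarith)]
    linarith
  have := Real.cosh_pos (a / 2)
  gcongr

/-- Comparison of a sum over separated points with a radial integral. -/
lemma tsum_mul_volume_ball_le {A : Set ℍ} [Countable A] {z : ℍ} {s δ : ℝ} (n : ℕ)
    (hδ : 0 ≤ δ) (hsep : ∀ p ∈ A, ∀ q ∈ A, p ≠ q → s ≤ dist p q) (hA : ∀ p ∈ A, δ ≤ dist z p) :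
    ∑' p : A, ENNReal.ofReal (Real.cosh (dist z (p : ℍ) / 2) ^ n)⁻¹ *
        volume (Metric.ball (p : ℍ) (s / 2)) ≤
      ∫⁻ x, (Set.Ioi (δ - s / 2)).indicator (fun t =>
        ENNReal.ofReal (Real.cosh (max (t - s / 2) δ / 2) ^ n)⁻¹) (dist z x) := by
  set g : ℝ → ENNReal := (Set.Ioi (δ - s / 2)).indicator (fun t =>
        ENNReal.ofReal (Real.cosh (max (t - s / 2) δ / 2) ^ n)⁻¹) with hg
  calc _ ≤ ∑' p : A, ∫⁻ x in Metric.ball (p : ℍ) (s / 2), g (dist z x) := by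
        refine ENNReal.tsum_le_tsum fun p => ?_
        rw [← setLIntegral_const]
        refine setLIntegral_mono' measurableSet_ball fun x hx => ?_
        rw [Metric.mem_ball] at hx
        have h1 := hA p p.2
        have h2 := dist_triangle z x p
        have h3 := dist_triangle z p x
        rw [dist_comm (p : ℍ) x] at h3
        rw [hg, Set.indicator_of_mem (Set.mem_Ioi.mpr (by linarith))]
        -- For `x` within `s/2` of `p`, the distance from `z` to `p` is at least both `dist z x -
        -- s/2` and `δ`.
        refine ENNReal.ofReal_le_ofReal (inv_cosh_half_pow_anti n (hδ.trans (le_max_right _ _))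
          (max_le (by linarith) h1))
    _ = ∫⁻ x in ⋃ p : A, Metric.ball (p : ℍ) (s / 2), g (dist z x) := by
        rw [lintegral_iUnion (fun p => measurableSet_ball)]
        intro p q hpq
        refine Metric.ball_disjoint_ball ?_
        have := hsep p p.2 q q.2 fun h => hpq (Subtype.ext h)
        linarith
    _ ≤ _ := setLIntegral_le_lintegral _ _

/-- The bound for sums of `cosh (d / 2) ^ (-2 k)` over points at distance at least `δ` which are
separated by `s`. -/
noncomputable def packingBound (k : ℕ) (δ s : ℝ) : ℝ :=
  2 * Real.sinh δ / Real.cosh (δ / 2) ^ (2 * k) * (Real.cosh (s / 4) / Real.sinh (s / 4))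
    + 2 / (2 * k - 2) / Real.cosh (δ / 2) ^ (2 * k - 2) * (2 + 1 / Real.sinh (s / 4) ^ 2)
    + 4 / (2 * k - 3) / (Real.sinh (δ / 2) * Real.cosh (δ / 2) ^ (2 * k - 3)) *
      (Real.cosh (s / 4) / Real.sinh (s / 4))

/-- After expanding `sinh(ρ + s/2)`, the term with `cosh ρ` has no elementary primitive of the
required form. Multiplying it by `sinh(ρ/2)/sinh(δ/2) ≥ 1` turns both terms into multiples of
`sinh(ρ/2)/cosh(ρ/2)^(n+1)`, which integrate exactly. -/
lemma sinh_add_div_cosh_pow_le {k : ℕ} (hk : 2 ≤ k) {δ s ρ : ℝ} (hδ : 0 < δ) (hs : 0 < s)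
    (hρ : δ ≤ ρ) : Real.sinh (ρ + s / 2) * (Real.cosh (ρ / 2) ^ (2 * k))⁻¹ ≤
      2 * Real.cosh (s / 2) * (Real.sinh (ρ / 2) / Real.cosh (ρ / 2) ^ (2 * k - 2 + 1)) +
      2 * (Real.sinh (s / 2) / Real.sinh (δ / 2)) *
        (Real.sinh (ρ / 2) / Real.cosh (ρ / 2) ^ (2 * k - 3 + 1)) := by
  have hc := Real.cosh_pos (ρ / 2)
  have hS : 0 < Real.sinh (δ / 2) := Real.sinh_pos_iff.mpr (half_pos hδ)
  have hs' : 0 < Real.sinh (s / 2) := Real.sinh_pos_iff.mpr (half_pos hs)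
  have h1 : Real.sinh (δ / 2) ≤ Real.sinh (ρ / 2) := Real.sinh_le_sinh.mpr (by linarith)
  have e1 : Real.cosh (ρ / 2) ^ (2 * k) = Real.cosh (ρ / 2) ^ (2 * k - 3 + 1) *
      Real.cosh (ρ / 2) ^ 2 := by rw [← pow_add]; congr 1; omega
  have e2 : Real.cosh (ρ / 2) ^ (2 * k - 2 + 1) = Real.cosh (ρ / 2) ^ (2 * k - 3 + 1) *
      Real.cosh (ρ / 2) := by rw [← pow_succ]; congr 1; omega
  have e3 : Real.sinh ρ = 2 * Real.sinh (ρ / 2) * Real.cosh (ρ / 2) := by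
    rw [← Real.sinh_two_mul]; congr 1; ring
  have e4 : Real.cosh ρ ≤ 2 * Real.cosh (ρ / 2) ^ 2 := by
    have := Real.cosh_two_mul (ρ / 2)
    rw [show 2 * (ρ / 2) = ρ by ring] at this
    linarith [Real.cosh_sq (ρ / 2)]
  have hP := pow_pos hc (2 * k - 3 + 1)
  rw [e1, e2, Real.sinh_add, e3]
  set P := Real.cosh (ρ / 2) ^ (2 * k - 3 + 1)
  have h2 : Real.cosh ρ ≤ 2 * Real.cosh (ρ / 2) ^ 2 * (Real.sinh (ρ / 2) / Real.sinh (δ / 2)) :=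
    e4.trans (le_mul_of_one_le_right (by positivity) ((one_le_div hS).mpr h1))
  have h3 : Real.cosh ρ * Real.sinh (s / 2) ≤
      2 * Real.cosh (ρ / 2) ^ 2 * (Real.sinh (ρ / 2) / Real.sinh (δ / 2)) * Real.sinh (s / 2) := by
    gcongr
  calc _ ≤ (2 * Real.sinh (ρ / 2) * Real.cosh (ρ / 2) * Real.cosh (s / 2) +
        2 * Real.cosh (ρ / 2) ^ 2 * (Real.sinh (ρ / 2) / Real.sinh (δ / 2)) * Real.sinh (s / 2)) *
        (P * Real.cosh (ρ / 2) ^ 2)⁻¹ := by gcongr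
    _ = _ := by field_simp

theorem tsum_inv_cosh_pow_le {A : Set ℍ} [Countable A] {z : ℍ} {s δ : ℝ} {k : ℕ} (hk : 2 ≤ k)
    (hs : 0 < s) (hδ : s / 2 ≤ δ) (hsep : ∀ p ∈ A, ∀ q ∈ A, p ≠ q → s ≤ dist p q)
    (hA : ∀ p ∈ A, δ ≤ dist z p) :
    ∑' p : A, ENNReal.ofReal (Real.cosh (dist z (p : ℍ) / 2) ^ (2 * k))⁻¹ ≤
      ENNReal.ofReal (packingBound k δ s) := by
  have hδ0 : 0 < δ := by linarith
  have hs4 : 0 < Real.sinh (s / 4) := Real.sinh_pos_iff.mpr (by linarith)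
  have hc := Real.cosh_pos (δ / 2)
  have hS : 0 < Real.sinh (δ / 2) := Real.sinh_pos_iff.mpr (half_pos hδ0)
  have hV : 0 < 4 * Real.pi * Real.sinh (s / 4) ^ 2 := by positivity
  have h0 := tsum_mul_volume_ball_le (2 * k) hδ0.le hsep hA
  have hvol : ∀ p : A, volume (Metric.ball (p : ℍ) (s / 2)) =
      ENNReal.ofReal (4 * Real.pi * Real.sinh (s / 4) ^ 2) := fun p => by
    rw [volume_ball _ (by linarith), show s / 2 / 2 = s / 4 by ring]
  simp only [hvol] at h0
  rw [ENNReal.tsum_mul_right] at h0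
  set g : ℝ → ENNReal := (Set.Ioi (δ - s / 2)).indicator (fun t =>
        ENNReal.ofReal (Real.cosh (max (t - s / 2) δ / 2) ^ (2 * k))⁻¹) with hg
  have hgm : Measurable g := by
    refine Measurable.indicator ?_ measurableSet_Ioi
    have : Measurable fun t : ℝ => Real.cosh (max (t - s / 2) δ / 2) :=
      Real.measurable_cosh.comp (by fun_prop)
    fun_prop
  rw [lintegral_radial z hgm] at h0
  -- `E1` bounds the annulus `δ - s/2 < t ≤ δ + s/2`, where the comparison function is constant;
  -- `E2` bounds the region beyond, after the shift `ρ = t - s/2`.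
  set E1 : ℝ := (Real.cosh (δ / 2) ^ (2 * k))⁻¹ *
    (Real.cosh (δ + s / 2) - Real.cosh (δ - s / 2)) with hE1
  set E2 : ℝ := 2 * Real.cosh (s / 2) * (2 / (2 * k - 2) / Real.cosh (δ / 2) ^ (2 * k - 2)) +
    2 * (Real.sinh (s / 2) / Real.sinh (δ / 2)) *
      (2 / (2 * k - 3) / Real.cosh (δ / 2) ^ (2 * k - 3)) with hE2
  have hk2 : (2 : ℝ) ≤ k := by exact_mod_cast hk
  have hcs : Real.cosh (δ - s / 2) ≤ Real.cosh (δ + s / 2) := by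
    rw [Real.cosh_le_cosh, abs_of_nonneg (by linarith), abs_of_nonneg (by linarith)]
    linarith
  have hI1 : ∫⁻ t in Set.Ioc (δ - s / 2) (δ + s / 2), ENNReal.ofReal (Real.sinh t) * g t ≤
      ENNReal.ofReal E1 := by
    rw [hE1, ENNReal.ofReal_mul (by positivity), ← setLIntegral_sinh (by linarith) (by linarith),
      ← lintegral_const_mul' _ _ ENNReal.ofReal_ne_top]
    refine setLIntegral_mono' measurableSet_Ioc fun t ht => ?_
    rw [hg, Set.indicator_of_mem (show t ∈ Set.Ioi (δ - s / 2) from ht.1), mul_comm]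
    exact mul_le_mul_left (ENNReal.ofReal_le_ofReal
      (inv_cosh_half_pow_anti _ hδ0.le (le_max_right _ _))) _
  have hI2 : ∫⁻ t in Set.Ioi (δ + s / 2), ENNReal.ofReal (Real.sinh t) * g t ≤
      ENNReal.ofReal E2 := by
    obtain ⟨i1, e1⟩ := integral_sinh_div_cosh_pow (n := 2 * k - 2) (by omega) hδ0.le
    obtain ⟨i2, e2⟩ := integral_sinh_div_cosh_pow (n := 2 * k - 3) (by omega) hδ0.le
    have c1 : ((2 * k - 2 : ℕ) : ℝ) = 2 * k - 2 := by rw [Nat.cast_sub (by omega)]; push_cast; ring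
    have c2 : ((2 * k - 3 : ℕ) : ℝ) = 2 * k - 3 := by rw [Nat.cast_sub (by omega)]; push_cast; ring
    rw [c1] at e1
    rw [c2] at e2
    set G : ℝ → ℝ := fun ρ =>
      2 * Real.cosh (s / 2) * (Real.sinh (ρ / 2) / Real.cosh (ρ / 2) ^ (2 * k - 2 + 1)) +
      2 * (Real.sinh (s / 2) / Real.sinh (δ / 2)) *
        (Real.sinh (ρ / 2) / Real.cosh (ρ / 2) ^ (2 * k - 3 + 1)) with hG
    have i3 : IntegrableOn G (Set.Ioi δ) := (i1.const_mul (2 * Real.cosh (s / 2))).add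
      (i2.const_mul (2 * (Real.sinh (s / 2) / Real.sinh (δ / 2))))
    have e3 : ∫ ρ in Set.Ioi δ, G ρ = _ := integral_add (i1.const_mul (2 * Real.cosh (s / 2)))
      (i2.const_mul (2 * (Real.sinh (s / 2) / Real.sinh (δ / 2))))
    rw [integral_const_mul, integral_const_mul, e1, e2] at e3
    have hpos : ∀ ρ ∈ Set.Ioi δ, 0 ≤ Real.sinh (ρ + s / 2) * (Real.cosh (ρ / 2) ^ (2 * k))⁻¹ :=
      fun ρ hρ => by
        have := Real.cosh_pos (ρ / 2)
        have : 0 ≤ Real.sinh (ρ + s / 2) :=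
          Real.sinh_nonneg_iff.mpr (by linarith [Set.mem_Ioi.mp hρ])
        positivity
    rw [hE2, ← e3, ofReal_integral_eq_lintegral_ofReal (f := G) i3]
    · have hpre : Set.Ioi (δ + s / 2) = (fun t => t - s / 2) ⁻¹' Set.Ioi δ := by
        ext t; simp
      have hms : MeasurableSet ((fun t : ℝ => t - s / 2) ⁻¹' Set.Ioi δ) := hpre ▸ measurableSet_Ioi
      have key := (measurePreserving_sub_right volume (s / 2)).setLIntegral_comp_preimage_emb
        (measurableEmbedding_subRight (s / 2)) (fun ρ => ENNReal.ofReal (G ρ)) (Set.Ioi δ)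
      rw [hpre, ← key]
      refine setLIntegral_mono' hms fun t ht => ?_
      have ht' : δ < t - s / 2 := ht
      rw [hg, Set.indicator_of_mem (Set.mem_Ioi.mpr (by linarith)), max_eq_left ht'.le,
        ← ENNReal.ofReal_mul (Real.sinh_nonneg_iff.mpr (by linarith))]
      refine ENNReal.ofReal_le_ofReal ?_
      have := sinh_add_div_cosh_pow_le hk hδ0 hs ht'.le
      rwa [sub_add_cancel] at this
    · filter_upwards [ae_restrict_mem measurableSet_Ioi] with ρ hρ
      exact (hpos ρ hρ).trans (sinh_add_div_cosh_pow_le hk hδ0 hs (le_of_lt hρ))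
  have hI : ∫⁻ t in Set.Ioi (0 : ℝ), ENNReal.ofReal (Real.sinh t) * g t ≤
      ENNReal.ofReal E1 + ENNReal.ofReal E2 := by
    calc _ ≤ ∫⁻ t in Set.Ioi (δ - s / 2), ENNReal.ofReal (Real.sinh t) * g t := by
          rw [← lintegral_indicator measurableSet_Ioi, ← lintegral_indicator measurableSet_Ioi]
          refine lintegral_mono fun t => ?_
          by_cases h : t ∈ Set.Ioi (δ - s / 2)
          · rw [Set.indicator_of_mem h]
            exact Set.indicator_le_self _ _ _
          · simp [hg, h, Set.indicator]
      _ = ∫⁻ t in Set.Ioc (δ - s / 2) (δ + s / 2) ∪ Set.Ioi (δ + s / 2),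
            ENNReal.ofReal (Real.sinh t) * g t := by
          rw [Set.Ioc_union_Ioi_eq_Ioi (by linarith)]
      _ ≤ _ := (lintegral_union_le _ _ _).trans (add_le_add hI1 hI2)
  have hE1' : 0 ≤ E1 := mul_nonneg (by positivity) (by linarith)
  have hE2' : 0 ≤ E2 := by
    have : 0 ≤ Real.sinh (s / 2) := Real.sinh_nonneg_iff.mpr (by linarith)
    have := Real.cosh_pos (s / 2)
    have h1 : (0 : ℝ) ≤ 2 * k - 2 := by linarith
    have h2 : (0 : ℝ) ≤ 2 * k - 3 := by linarith
    positivity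
  -- `packingBound` is `2π(E1 + E2)` divided by the area `4π sinh²(s/4)` of a ball of radius `s/2`.
  have hfin : (packingBound k δ s) * (4 * Real.pi * Real.sinh (s / 4) ^ 2) =
      2 * Real.pi * (E1 + E2) := by
    have a1 : Real.cosh (δ + s / 2) - Real.cosh (δ - s / 2) =
        2 * Real.sinh δ * (2 * Real.sinh (s / 4) * Real.cosh (s / 4)) := by
      rw [Real.cosh_add, Real.cosh_sub, ← Real.sinh_two_mul]
      ring_nf
    have a2 : Real.sinh (s / 2) = 2 * Real.sinh (s / 4) * Real.cosh (s / 4) := by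
      rw [← Real.sinh_two_mul]; ring_nf
    have a3 : Real.cosh (s / 2) = 2 * Real.sinh (s / 4) ^ 2 + 1 := by
      rw [show s / 2 = 2 * (s / 4) by ring, Real.cosh_two_mul, Real.cosh_sq]; ring
    have b1 : (2 * k - 2 : ℝ) ≠ 0 := by linarith
    have b2 : (2 * k - 3 : ℝ) ≠ 0 := by linarith
    rw [hE1, hE2, a1, a2, a3, packingBound]
    have q1 := pow_pos hc (2 * k)
    have q2 := pow_pos hc (2 * k - 2)
    have q3 := pow_pos hc (2 * k - 3)
    generalize Real.cosh (δ / 2) ^ (2 * k) = Q1 at *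
    generalize Real.cosh (δ / 2) ^ (2 * k - 2) = Q2 at *
    generalize Real.cosh (δ / 2) ^ (2 * k - 3) = Q3 at *
    generalize (2 * k - 2 : ℝ) = K2 at *
    generalize (2 * k - 3 : ℝ) = K3 at *
    field_simp
    ring
  have hpb : 0 ≤ packingBound k δ s := by
    have : 0 ≤ packingBound k δ s * (4 * Real.pi * Real.sinh (s / 4) ^ 2) := by
      rw [hfin]; positivity
    exact nonneg_of_mul_nonneg_left this hV
  have hmul : (∑' p : A, ENNReal.ofReal (Real.cosh (dist z (p : ℍ) / 2) ^ (2 * k))⁻¹) *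
      ENNReal.ofReal (4 * Real.pi * Real.sinh (s / 4) ^ 2) ≤ ENNReal.ofReal (packingBound k δ s) *
      ENNReal.ofReal (4 * Real.pi * Real.sinh (s / 4) ^ 2) := by
    rw [← ENNReal.ofReal_mul hpb, hfin, ENNReal.ofReal_mul (p := 2 * Real.pi) (by positivity),
      ENNReal.ofReal_add hE1' hE2']
    refine h0.trans ?_
    gcongr
  exact (ENNReal.mul_le_mul_iff_left (by simpa using hV) ENNReal.ofReal_ne_top).mp hmul

/-! ### Orbits, separation and unfolding of measures. -/

lemma neg_one_smul_upperHalfPlane (z : ℍ) : (-1 : SL(2, ℝ)) • z = z := by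
  have h : (-1 : SL(2, ℝ)) • z = (-1 : GL (Fin 2) ℝ) • z := by
    change Matrix.SpecialLinearGroup.toGL (-1 : SL(2, ℝ)) • z = _
    congr 1
    ext i j
    simp [Matrix.SpecialLinearGroup.toGL]
  rw [h, UpperHalfPlane.neg_smul, one_smul]

lemma dist_smul_smul_eq (γ γ' : SL(2, ℝ)) (z w : ℍ) :
    dist (γ • z) (γ' • w) = dist z ((γ⁻¹ * γ') • w) := by
  rw [← dist_smul γ z, smul_smul, mul_inv_cancel_left]

instance (Γ : Subgroup SL(2, ℝ)) : SMulInvariantMeasure Γ ℍ volume :=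
  ⟨fun γ _ hs => measure_preimage_smul_of_nullMeasurableSet
    (μ := (volume : Measure ℍ)) (hs.nullMeasurableSet) (Matrix.SpecialLinearGroup.toGL (γ : SL(2, ℝ)))⟩

lemma le_dist_orbit {Γ : Subgroup SL(2, ℝ)} {w : ℍ} {s : ℝ}
    (hs : ∀ γ ∈ Γ, γ ≠ 1 → γ ≠ -1 → s ≤ dist w (γ • w)) :
    ∀ p ∈ MulAction.orbit Γ w, ∀ q ∈ MulAction.orbit Γ w, p ≠ q → s ≤ dist p q := by
  rintro _ ⟨γ, rfl⟩ _ ⟨γ', rfl⟩ hne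
  change γ • w ≠ γ' • w at hne
  change s ≤ dist ((γ : SL(2, ℝ)) • w) ((γ' : SL(2, ℝ)) • w)
  rw [dist_smul_smul_eq]
  have h : ∀ σ : SL(2, ℝ), σ • w = w → (γ : SL(2, ℝ))⁻¹ * γ' ≠ σ := fun σ h1 h2 => hne <| by
    rw [← h2, mul_smul, inv_smul_eq_iff] at h1
    exact h1.symm
  exact hs _ (Γ.mul_mem (Γ.inv_mem γ.2) γ'.2) (h 1 (one_smul _ _))
    (h (-1) (neg_one_smul_upperHalfPlane w))

namespace IsSurfaceGroup

variable {Γ : Subgroup SL(2, ℝ)}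

lemma countable (hΓ : IsSurfaceGroup Γ) : Countable Γ := by
  have := hΓ.discrete
  have : SecondCountableTopology (Matrix (Fin 2) (Fin 2) ℝ) :=
    inferInstanceAs (SecondCountableTopology (Fin 2 → Fin 2 → ℝ))
  have : SecondCountableTopology SL(2, ℝ) :=
    TopologicalSpace.Subtype.secondCountableTopology {A : Matrix (Fin 2) (Fin 2) ℝ | A.det = 1}
  exact countable_of_Lindelof_of_discrete

/-- Nontrivial elements move the points near a given one by a definite amount. -/
lemma exists_le_dist_smul (hΓ : IsSurfaceGroup Γ) (w : ℍ) : ∃ ε > 0, ∀ p, dist p w < ε →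
    ∀ γ ∈ Γ, γ ≠ 1 → γ ≠ -1 → ε ≤ dist p (γ • p) := by
  have := hΓ.discrete
  have hfin := ProperlyDiscontinuousSMul.finite_disjoint_inter_image (Γ := Γ)
    (isCompact_closedBall w 1) (isCompact_closedBall w 1)
  have hfin' : {γ : Γ | dist w (γ • w) ≤ 1}.Finite := hfin.subset fun γ hγ => by
    refine ⟨γ • w, ⟨w, by simp, rfl⟩, ?_⟩
    rwa [Metric.mem_closedBall, dist_comm]
  set S : Set Γ := {γ : Γ | γ • w ≠ w}
  obtain ⟨e, he, hmin⟩ : ∃ e > 0, ∀ γ ∈ S, e ≤ dist w (γ • w) := by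
    have hT := hfin'.inter_of_left S
    by_cases hne : (hT.toFinset).Nonempty
    · obtain ⟨γ₀, h₀, hγ₀⟩ := hT.toFinset.exists_min_image (fun γ => dist w (γ • w)) hne
      have h₀' := (hT.mem_toFinset.mp h₀).2
      refine ⟨min 1 (dist w (γ₀ • w)), lt_min one_pos (dist_pos.mpr (Ne.symm h₀')), fun γ hγ => ?_⟩
      by_cases hd : dist w (γ • w) ≤ 1
      · refine (min_le_right _ _).trans (hγ₀ γ (hT.mem_toFinset.mpr ⟨hd, hγ⟩))
      · exact (min_le_left _ _).trans (not_le.mp hd).le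
    · refine ⟨1, one_pos, fun γ hγ => ?_⟩
      by_contra! hd
      exact hne ⟨γ, hT.mem_toFinset.mpr ⟨hd.le, hγ⟩⟩
  -- Moving the base point from `w` to `p` changes the displacement by at most `2 * dist p w`, so a
  -- displacement of at least `e` at `w` leaves at least `e/3` at `p`.
  refine ⟨e / 3, by positivity, fun p hp γ hγ h1 h2 => ?_⟩
  have hmove : (⟨γ, hγ⟩ : Γ) ∈ S := fun h => by
    rcases hΓ.free γ hγ w h with h | h <;> contradiction
  have h3 := hmin _ hmove
  have h4 : dist (γ • p) (γ • w) = dist p w := dist_smul γ p w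
  have h5 := dist_triangle4 w p (γ • p) (γ • w)
  rw [dist_comm w p, h4] at h5
  change e ≤ dist w (γ • w) at h3
  linarith

lemma stabilizer_eq (hΓ : IsSurfaceGroup Γ) (w : ℍ) (γ : Γ) : γ ∈ MulAction.stabilizer Γ w ↔
    (γ : SL(2, ℝ)) = 1 ∨ (γ : SL(2, ℝ)) = -1 := by
  rw [MulAction.mem_stabilizer_iff]
  constructor
  · exact fun h => hΓ.free γ γ.2 w h
  · intro h
    change (γ : SL(2, ℝ)) • w = w
    rcases h with h | h <;> rw [h]
    · rw [one_smul]
    · exact neg_one_smul_upperHalfPlane w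

end IsSurfaceGroup

/-- The number of elements of `Γ` that act trivially on `ℍ`. -/
noncomputable def trivialCount (Γ : Subgroup SL(2, ℝ)) : ℕ :=
  Nat.card {γ : Γ // (γ : SL(2, ℝ)) = 1 ∨ (γ : SL(2, ℝ)) = -1}

lemma finite_trivial (Γ : Subgroup SL(2, ℝ)) :
    Finite {γ : Γ // (γ : SL(2, ℝ)) = 1 ∨ (γ : SL(2, ℝ)) = -1} := by
  refine Set.Finite.to_subtype (s := {γ : Γ | (γ : SL(2, ℝ)) = 1 ∨ (γ : SL(2, ℝ)) = -1}) ?_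
  exact (Set.toFinite ({1, -1} : Set SL(2, ℝ))).preimage Subtype.val_injective.injOn

lemma trivialCount_pos (Γ : Subgroup SL(2, ℝ)) : 0 < trivialCount Γ := by
  have := finite_trivial Γ
  have : Nonempty {γ : Γ // (γ : SL(2, ℝ)) = 1 ∨ (γ : SL(2, ℝ)) = -1} := ⟨⟨1, Or.inl rfl⟩⟩
  exact Nat.card_pos

namespace IsSurfaceGroup

variable {Γ : Subgroup SL(2, ℝ)}

/-- Each point of the orbit is hit by a coset of the stabilizer, which by freeness consists of the
elements of `Γ` among `1` and `-1`. The factor `trivialCount Γ` cancels in the final bound, so it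
does not matter whether `-1` lies in `Γ`. -/
lemma tsum_smul_eq (hΓ : IsSurfaceGroup Γ) (w : ℍ) (g : ℍ → ENNReal) :
    ∑' γ : Γ, g (γ • w) = trivialCount Γ * ∑' p : MulAction.orbit Γ w, g p := by
  let π : Γ → MulAction.orbit Γ w := fun γ => ⟨γ • w, γ, rfl⟩
  rw [← (Equiv.sigmaFiberEquiv π).tsum_eq, ENNReal.tsum_sigma', ← ENNReal.tsum_mul_left]
  refine tsum_congr fun p => ?_
  obtain ⟨_, γ₀, rfl⟩ := p
  have e : {γ : Γ // π γ = ⟨γ₀ • w, γ₀, rfl⟩} ≃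
      {γ : Γ // (γ : SL(2, ℝ)) = 1 ∨ (γ : SL(2, ℝ)) = -1} :=
    (Equiv.mulLeft γ₀⁻¹).subtypeEquiv fun γ => by
      rw [← hΓ.stabilizer_eq w, MulAction.mem_stabilizer_iff, Equiv.coe_mulLeft, mul_smul,
        inv_smul_eq_iff]
      exact Subtype.ext_iff
  have := finite_trivial Γ
  have hconst : ∀ c : {γ : Γ // π γ = ⟨γ₀ • w, γ₀, rfl⟩},
      g ((Equiv.sigmaFiberEquiv π ⟨_, c⟩) • w) = g (γ₀ • w) := fun c => by
    have := congrArg Subtype.val c.2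
    exact congrArg g this
  simp_rw [hconst]
  rw [ENNReal.tsum_const, ENat.card_congr e, ENat.card_eq_coe_natCard]
  rfl

lemma tsum_indicator_smul (hΓ : IsSurfaceGroup Γ) {F : Set ℍ}
    (hF : IsStrictFundamentalDomain Γ F) (w : ℍ) :
    ∑' γ : Γ, F.indicator (1 : ℍ → ENNReal) (γ • w) = trivialCount Γ := by
  rw [hΓ.tsum_smul_eq]
  obtain ⟨p, ⟨hpF, γ, hγ, hp⟩, huniq⟩ := hF.existsUnique w
  rw [tsum_eq_single (⟨p, ⟨γ, hγ⟩, hp⟩ : MulAction.orbit Γ w)]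
  · simp [hpF]
  · rintro ⟨q, γ', rfl⟩ hq
    refine Set.indicator_of_notMem (fun hqF => hq ?_) _
    exact Subtype.ext (huniq _ ⟨hqF, γ', γ'.2, rfl⟩)

/-- The measure form of unfolding: the translates of `F` cover each point exactly `trivialCount Γ`
times, and `Γ` preserves the hyperbolic measure. -/
lemma sum_map_smul_restrict (hΓ : IsSurfaceGroup Γ) {F : Set ℍ}
    (hF : IsStrictFundamentalDomain Γ F) :
    Measure.sum (fun γ : Γ => (volume.restrict F).map (γ • · : ℍ → ℍ)) =
      (trivialCount Γ : ENNReal) • (volume : Measure ℍ) := by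
  have := hΓ.countable
  have hmeas : ∀ γ : Γ, Measurable (γ • · : ℍ → ℍ) := fun γ => (continuous_const_smul γ).measurable
  ext s hs
  rw [Measure.sum_apply _ hs, Measure.smul_apply, smul_eq_mul]
  have h1 : ∀ γ : Γ, (volume.restrict F).map (γ • · : ℍ → ℍ) s =
      ∫⁻ z in s, F.indicator (1 : ℍ → ENNReal) (γ⁻¹ • z) := fun γ => by
    have h2 : (fun z : ℍ => F.indicator (1 : ℍ → ENNReal) (γ⁻¹ • z)) =
        ((γ⁻¹ • · : ℍ → ℍ) ⁻¹' F).indicator 1 := rfl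
    rw [h2, lintegral_indicator_one (hmeas _ hF.measurableSet), Measure.map_apply (hmeas γ) hs,
      Measure.restrict_apply (hmeas γ hs), Measure.restrict_apply (hmeas _ hF.measurableSet),
      ← measure_preimage_smul volume γ ((γ⁻¹ • · : ℍ → ℍ) ⁻¹' F ∩ s)]
    congr 1
    ext z
    simp [and_comm]
  simp_rw [h1]
  have hind : ∀ γ : Γ, Measurable fun z : ℍ => F.indicator (1 : ℍ → ENNReal) (γ⁻¹ • z) :=
    fun γ => (measurable_one.indicator hF.measurableSet).comp (hmeas γ⁻¹)
  rw [← lintegral_tsum fun γ => (hind γ).aemeasurable]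
  have h3 : ∀ z : ℍ, ∑' γ : Γ, F.indicator (1 : ℍ → ENNReal) (γ⁻¹ • z) = trivialCount Γ :=
    fun z => by
      rw [← hΓ.tsum_indicator_smul hF z]
      exact (Equiv.inv Γ).tsum_eq (fun γ : Γ => F.indicator (1 : ℍ → ENNReal) (γ • z))
  simp_rw [h3]
  rw [lintegral_const, Measure.restrict_apply MeasurableSet.univ, Set.univ_inter]

lemma countable_orbit (hΓ : IsSurfaceGroup Γ) (w : ℍ) : Countable (MulAction.orbit Γ w) := by
  have := hΓ.countable
  exact (Set.countable_range _).to_subtype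

lemma inv_cosh_pow_le_one (n : ℕ) (x : ℝ) : (Real.cosh x ^ n)⁻¹ ≤ 1 :=
  inv_le_one_of_one_le₀ (one_le_pow₀ (Real.one_le_cosh x))

/-- The sum over an orbit of a rapidly decreasing function of the distance is bounded. -/
lemma exists_tsum_orbit_le (hΓ : IsSurfaceGroup Γ) {k : ℕ} (hk : 2 ≤ k) (w : ℍ) :
    ∃ M : ℝ, ∀ z : ℍ, ∑' p : MulAction.orbit Γ w,
      ENNReal.ofReal (Real.cosh (dist z p / 2) ^ (2 * k))⁻¹ ≤ ENNReal.ofReal M := by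
  obtain ⟨s, hs, hsep⟩ := hΓ.exists_le_dist_smul w
  have hsep' := le_dist_orbit (hsep w (by simpa using hs))
  have := hΓ.countable_orbit w
  refine ⟨1 + |packingBound k (s / 2) s|, fun z => ?_⟩
  set O := MulAction.orbit Γ w
  let A : Set ℍ := {p ∈ O | s / 2 ≤ dist z p}
  let A' : Set ℍ := {p ∈ O | dist z p < s / 2}
  have hO : O = A' ∪ A := by
    ext p
    simp only [A, A', Set.mem_union, Set.mem_ofPred_eq, ← and_or_left, lt_or_ge, and_true]
  have : Countable A := (Set.Countable.mono (fun p hp => hp.1) (Set.to_countable O)).to_subtype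
  let f : ℍ → ENNReal := fun p => ENNReal.ofReal (Real.cosh (dist z p / 2) ^ (2 * k))⁻¹
  have h1 : ∑' p : O, f p ≤ ∑' p : A', f p + ∑' p : A, f p := by
    conv_lhs => rw [hO]
    exact ENNReal.tsum_union_le f A' A
  have h2 : ∑' p : A, f p ≤ ENNReal.ofReal (packingBound k (s / 2) s) :=
    tsum_inv_cosh_pow_le hk hs le_rfl (fun p hp q hq => hsep' p hp.1 q hq.1) fun p hp => hp.2
  have h3 : ∑' p : A', f p ≤ 1 := by
    -- Two orbit points within `s/2` of `z` would be closer than `s` to each other, so the near part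
    -- contributes at most `1`.
    have hsub : A'.Subsingleton := fun p hp q hq => by
      by_contra hne
      have := hsep' p hp.1 q hq.1 hne
      have := dist_triangle_left p q z
      linarith [hp.2, hq.2]
    rcases hsub.eq_empty_or_singleton with h | ⟨p, h⟩ <;> rw [h]
    · simp
    · rw [tsum_singleton p f]
      exact ENNReal.ofReal_le_one.mpr (inv_cosh_pow_le_one _ _)
  rw [ENNReal.ofReal_add zero_le_one (abs_nonneg _), ENNReal.ofReal_one]
  exact h1.trans (add_le_add h3 (h2.trans (ENNReal.ofReal_le_ofReal (le_abs_self _))))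

end IsSurfaceGroup

/-! ### The Poincaré series as a cusp form. -/

open Matrix.SpecialLinearGroup (toGL)
open scoped ModularForm

lemma det_toGL (γ : SL(2, ℝ)) : (toGL γ).det.val = 1 := by
  simp

/-- The hyperbolic pointwise norm is compatible with the slash action. -/
lemma im_pow_mul_norm_slash (k : ℕ) (f : ℍ → ℂ) (g : GL (Fin 2) ℝ) (z : ℍ) :
    z.im ^ k * ‖(f ∣[2 * (k : ℤ)] g) z‖ =
      |g.det.val| ^ ((k : ℤ) - 1) * ((g • z).im ^ k * ‖f (g • z)‖) := by
  have hd : |g.det.val| ≠ 0 := abs_ne_zero.mpr g.det_ne_zero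
  have hn : ‖denom g z‖ ≠ 0 := norm_ne_zero_iff.mpr (denom_ne_zero g z)
  rw [ModularForm.slash_apply, norm_mul, norm_mul, norm_σ, norm_zpow, norm_zpow,
    Complex.norm_real, Real.norm_eq_abs, abs_abs, im_smul_eq_div_normSq, div_pow, mul_pow,
    Complex.normSq_eq_norm_sq, ← pow_mul, zpow_neg, show 2 * (k : ℤ) = ((2 * k : ℕ) : ℤ) by simp,
    zpow_natCast, show ((2 * k : ℕ) : ℤ) - 1 = ((k : ℤ) - 1) + k by push_cast; ring,
    zpow_add₀ hd, zpow_natCast]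
  field_simp

lemma im_pow_mul_norm_slash_toGL (k : ℕ) (f : ℍ → ℂ) (γ : SL(2, ℝ)) (z : ℍ) :
    z.im ^ k * ‖(f ∣[2 * (k : ℤ)] toGL γ) z‖ = (γ • z).im ^ k * ‖f (γ • z)‖ := by
  rw [im_pow_mul_norm_slash, det_toGL, abs_one, one_zpow, one_mul]
  rfl

lemma slash_toGL_apply (k : ℤ) (f : ℍ → ℂ) (γ : SL(2, ℝ)) (z : ℍ) :
    (f ∣[k] toGL γ) z = f (γ • z) * denom (toGL γ) z ^ (-k) := by
  rw [ModularForm.slash_apply, det_toGL]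
  simp only [σ, det_toGL, zero_lt_one, if_true, abs_one]
  simp
  exact Or.inl rfl

/-- The terms of the Poincaré series attached to the point `w`. -/
noncomputable def poincareTerm (k : ℕ) (w : ℍ) (γ : SL(2, ℝ)) : ℍ → ℂ :=
  (fun z => planeKernel k z w) ∣[2 * (k : ℤ)] toGL γ

/-- The Poincaré series reproducing the values of cusp forms of weight `2k` at `w`. -/
noncomputable def poincare (Γ : Subgroup SL(2, ℝ)) (k : ℕ) (w : ℍ) (z : ℍ) : ℂ :=
  ∑' γ : Γ, poincareTerm k w γ z

lemma norm_poincareTerm (k : ℕ) (w : ℍ) (γ : SL(2, ℝ)) (z : ℍ) :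
    z.im ^ k * w.im ^ k * ‖poincareTerm k w γ z‖ =
      (Real.cosh (dist (γ • z) w / 2) ^ (2 * k))⁻¹ := by
  rw [← norm_planeKernel, mul_right_comm, poincareTerm, im_pow_mul_norm_slash_toGL]
  ring

lemma norm_poincareTerm_eq (k : ℕ) (w : ℍ) (γ : SL(2, ℝ)) (z : ℍ) :
    ‖poincareTerm k w γ z‖ =
      (z.im ^ k * w.im ^ k)⁻¹ * (Real.cosh (dist (γ • z) w / 2) ^ (2 * k))⁻¹ := by
  have h1 := pow_pos z.im_pos k
  have h2 := pow_pos w.im_pos k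
  rw [← norm_poincareTerm]
  field_simp

lemma mdifferentiable_planeKernel (k : ℕ) (w : ℍ) :
    DifferentiableOn ℂ ((fun z => planeKernel k z w) ∘ ofComplex) {z | 0 < z.im} := by
  have h : DifferentiableOn ℂ
      (fun z : ℂ => (((z - (starRingEnd ℂ) (w : ℂ)) / (2 * Complex.I)) ^ (2 * k))⁻¹)
      {z | 0 < z.im} := by
    refine DifferentiableOn.inv (by fun_prop) fun z hz => pow_ne_zero _ ?_
    refine div_ne_zero (fun h => ?_) (by simp)
    have h2 := congrArg Complex.im h
    have h3 := w.im_pos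
    have h4 : 0 < z.im := hz
    simp at h2
    linarith
  refine h.congr fun z hz => ?_
  simp only [Function.comp_apply, planeKernel]
  rw [ofComplex_apply_of_im_pos hz]

lemma differentiableOn_poincareTerm (k : ℕ) (w : ℍ) (γ : SL(2, ℝ)) :
    DifferentiableOn ℂ (poincareTerm k w γ ∘ ofComplex) {z | 0 < z.im} :=
  mdifferentiable_iff.mp ((mdifferentiable_iff.mpr (mdifferentiable_planeKernel k w)).slash _ _)

namespace IsSurfaceGroup

variable {Γ : Subgroup SL(2, ℝ)}

lemma tsum_dist_smul (hΓ : IsSurfaceGroup Γ) (k : ℕ) (z w : ℍ) :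
    ∑' γ : Γ, ENNReal.ofReal (Real.cosh (dist ((γ : SL(2, ℝ)) • z) w / 2) ^ (2 * k))⁻¹ =
      trivialCount Γ * ∑' p : MulAction.orbit Γ w,
        ENNReal.ofReal (Real.cosh (dist z p / 2) ^ (2 * k))⁻¹ := by
  rw [← hΓ.tsum_smul_eq w fun p => ENNReal.ofReal (Real.cosh (dist z p / 2) ^ (2 * k))⁻¹,
    ← (Equiv.inv Γ).tsum_eq]
  refine tsum_congr fun γ => ?_
  have h : dist (((γ⁻¹ : Γ) : SL(2, ℝ)) • z) w = dist z ((γ : SL(2, ℝ)) • w) := by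
    rw [← dist_smul (γ : SL(2, ℝ)) _ w, smul_smul]
    simp
  exact congrArg (fun d => ENNReal.ofReal (Real.cosh (d / 2) ^ (2 * k))⁻¹) h

lemma exists_tsum_dist_smul_le (hΓ : IsSurfaceGroup Γ) {k : ℕ} (hk : 2 ≤ k) (w : ℍ) :
    ∃ M : ℝ, 0 ≤ M ∧ ∀ z : ℍ,
      ∑' γ : Γ, ENNReal.ofReal (Real.cosh (dist ((γ : SL(2, ℝ)) • z) w / 2) ^ (2 * k))⁻¹ ≤
        ENNReal.ofReal M := by
  obtain ⟨M, hM⟩ := hΓ.exists_tsum_orbit_le hk w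
  refine ⟨trivialCount Γ * |M|, by positivity, fun z => ?_⟩
  rw [hΓ.tsum_dist_smul, ENNReal.ofReal_mul (by positivity), ENNReal.ofReal_natCast]
  gcongr
  exact (hM z).trans (ENNReal.ofReal_le_ofReal (le_abs_self M))

lemma summable_dist_smul (hΓ : IsSurfaceGroup Γ) {k : ℕ} (hk : 2 ≤ k) (z w : ℍ) :
    Summable fun γ : Γ => (Real.cosh (dist ((γ : SL(2, ℝ)) • z) w / 2) ^ (2 * k))⁻¹ := by
  obtain ⟨M, -, hM⟩ := hΓ.exists_tsum_dist_smul_le hk w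
  refine (ENNReal.summable_toReal ((hM z).trans_lt ENNReal.ofReal_lt_top).ne).congr fun γ => ?_
  rw [ENNReal.toReal_ofReal]
  have := Real.cosh_pos (dist ((γ : SL(2, ℝ)) • z) w / 2)
  positivity

lemma summable_norm_poincareTerm (hΓ : IsSurfaceGroup Γ) {k : ℕ} (hk : 2 ≤ k) (z w : ℍ) :
    Summable fun γ : Γ => ‖poincareTerm k w γ z‖ := by
  simp_rw [norm_poincareTerm_eq]
  exact (hΓ.summable_dist_smul hk z w).mul_left _

lemma ofReal_norm_poincare_le (hΓ : IsSurfaceGroup Γ) {k : ℕ} (hk : 2 ≤ k) (z w : ℍ) :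
    ENNReal.ofReal (z.im ^ k * w.im ^ k * ‖poincare Γ k w z‖) ≤
      ∑' γ : Γ, ENNReal.ofReal (Real.cosh (dist ((γ : SL(2, ℝ)) • z) w / 2) ^ (2 * k))⁻¹ := by
  have hs := hΓ.summable_dist_smul hk z w
  rw [← ENNReal.ofReal_tsum_of_nonneg (fun γ => by
    have := Real.cosh_pos (dist ((γ : SL(2, ℝ)) • z) w / 2)
    positivity) hs]
  refine ENNReal.ofReal_le_ofReal ?_
  simp_rw [← norm_poincareTerm]
  rw [tsum_mul_left]
  have h1 := pow_pos z.im_pos k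
  have h2 := pow_pos w.im_pos k
  exact mul_le_mul_of_nonneg_left (norm_tsum_le_tsum_norm (hΓ.summable_norm_poincareTerm hk z w))
    (by positivity)

lemma exists_norm_poincare_le (hΓ : IsSurfaceGroup Γ) {k : ℕ} (hk : 2 ≤ k) (w : ℍ) :
    ∃ M : ℝ, 0 ≤ M ∧ ∀ z : ℍ, z.im ^ k * ‖poincare Γ k w z‖ ≤ M := by
  obtain ⟨M, hM0, hM⟩ := hΓ.exists_tsum_dist_smul_le hk w
  have h2 := pow_pos w.im_pos k
  refine ⟨M / w.im ^ k, by positivity, fun z => ?_⟩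
  rw [le_div_iff₀ h2]
  have := (ENNReal.ofReal_le_ofReal_iff hM0).mp
    ((hΓ.ofReal_norm_poincare_le hk z w).trans (hM z))
  linarith

lemma poincare_slash (k : ℕ) (w : ℍ) {γ : SL(2, ℝ)} (hγ : γ ∈ Γ) :
    poincare Γ k w ∣[2 * (k : ℤ)] toGL γ = poincare Γ k w := by
  ext z
  rw [slash_toGL_apply, poincare, ← tsum_mul_right, poincare,
    ← (Equiv.mulRight (⟨γ, hγ⟩ : Γ)).tsum_eq (fun σ : Γ => poincareTerm k w σ z)]
  refine tsum_congr fun σ => ?_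
  rw [← slash_toGL_apply, poincareTerm, poincareTerm, ← SlashAction.slash_mul, ← map_mul]
  rfl

/-- A Harnack-type comparison: changing the distance by at most `1` changes each term by a bounded
factor. It yields the summable majorant on a unit ball needed for holomorphy of the series. -/
lemma inv_cosh_pow_le_exp_mul {n : ℕ} {a b : ℝ} (ha : 0 ≤ a) (hb : 0 ≤ b) (hab : b ≤ a + 1) :
    (Real.cosh (a / 2) ^ n)⁻¹ ≤ Real.exp n * (Real.cosh (b / 2) ^ n)⁻¹ := by
  have hc := Real.cosh_pos (a / 2)
  have hc' := Real.cosh_pos (b / 2)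
  have h : Real.cosh (b / 2) ≤ Real.exp 1 * Real.cosh (a / 2) := by
    have h1 : Real.cosh (b / 2) ≤ Real.cosh (a / 2 + 1) := by
      rw [Real.cosh_le_cosh, abs_of_nonneg (by positivity), abs_of_nonneg (by positivity)]
      linarith
    refine h1.trans ?_
    rw [Real.cosh_add]
    have h3 : Real.exp 1 = Real.cosh 1 + Real.sinh 1 := (Real.cosh_add_sinh 1).symm
    have h4 : 0 ≤ Real.sinh 1 := Real.sinh_nonneg_iff.mpr zero_le_one
    have h5 := (Real.sinh_lt_cosh (a / 2)).le
    rw [h3]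
    nlinarith
  have h2 := pow_le_pow_left₀ hc'.le h n
  rw [mul_pow, ← Real.exp_nat_mul, mul_one] at h2
  rw [← div_eq_mul_inv, le_div_iff₀ (by positivity), inv_mul_le_iff₀ (by positivity)]
  linarith

lemma differentiableOn_poincare (hΓ : IsSurfaceGroup Γ) {k : ℕ} (hk : 2 ≤ k) (w : ℍ) :
    DifferentiableOn ℂ (poincare Γ k w ∘ ofComplex) {z | 0 < z.im} := by
  intro z₀ hz₀
  let p : ℍ := ⟨z₀, hz₀⟩
  let U : Set ℂ := (fun z : ℍ => (z : ℂ)) '' Metric.ball p 1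
  have hU : IsOpen U := isOpenEmbedding_coe.isOpenMap _ Metric.isOpen_ball
  have hsub : U ⊆ {z | 0 < z.im} := by
    rintro _ ⟨q, -, rfl⟩
    exact q.im_pos
  have hp : z₀ ∈ U := ⟨p, Metric.mem_ball_self one_pos, rfl⟩
  have hd : DifferentiableOn ℂ (fun z => ∑' γ : Γ, (poincareTerm k w γ ∘ ofComplex) z) U := by
    refine Complex.differentiableOn_tsum_of_summable_norm
      (u := fun γ : Γ => ((p.im * Real.exp (-1)) ^ k * w.im ^ k)⁻¹ * (Real.exp (2 * k : ℕ) *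
        (Real.cosh (dist ((γ : SL(2, ℝ)) • p) w / 2) ^ (2 * k))⁻¹))
      (((hΓ.summable_dist_smul hk p w).mul_left _).mul_left _)
      (fun γ => (differentiableOn_poincareTerm k w γ).mono hsub) hU ?_
    rintro γ _ ⟨q, hq, rfl⟩
    have hq' : dist q p < 1 := hq
    simp only [Function.comp_apply, ofComplex_apply]
    rw [norm_poincareTerm_eq]
    have h1 := q.im_pos
    have h2 := w.im_pos
    have h3 := p.im_pos
    refine mul_le_mul (inv_anti₀ (by positivity) ?_) ?_ ?_ (by positivity)
    · gcongr
      have h4 := im_le_im_mul_exp_dist p q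
      have h5 : Real.exp (dist p q) ≤ Real.exp 1 := by
        rw [dist_comm]
        exact Real.exp_le_exp.mpr hq'.le
      have h6 : p.im ≤ q.im * Real.exp 1 := h4.trans (by gcongr)
      rw [Real.exp_neg]
      rwa [← div_eq_mul_inv, div_le_iff₀ (Real.exp_pos 1)]
    · refine inv_cosh_pow_le_exp_mul dist_nonneg dist_nonneg ?_
      have h7 := dist_triangle ((γ : SL(2, ℝ)) • p) ((γ : SL(2, ℝ)) • q) w
      rw [dist_smul, dist_comm p q] at h7
      linarith
    · have := Real.cosh_pos (dist ((γ : SL(2, ℝ)) • q) w / 2)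
      positivity
  exact ((hd z₀ hp).differentiableAt (hU.mem_nhds hp)).differentiableWithinAt

/-- The function `y^k |P|` is bounded on all of `ℍ`, a property preserved by slashing up to a
determinant factor; hence each slash of `P` is `O(y^(-k))` at `∞`. -/
lemma isZeroAt_poincare (hΓ : IsSurfaceGroup Γ) {k : ℕ} (hk : 2 ≤ k) (w : ℍ) (c : OnePoint ℝ) :
    c.IsZeroAt (poincare Γ k w) (2 * (k : ℤ)) := by
  intro g _
  obtain ⟨M, hM0, hM⟩ := hΓ.exists_norm_poincare_le hk w
  rw [isZeroAtImInfty_iff]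
  intro ε hε
  set D := |g.det.val| ^ ((k : ℤ) - 1) * M
  have hD : 0 ≤ D := by positivity
  refine ⟨max 1 (D / ε), fun z hz => ?_⟩
  have h1 : 1 ≤ z.im := (le_max_left _ _).trans hz
  have h2 : D / ε ≤ z.im := (le_max_right _ _).trans hz
  have h3 : z.im ^ k * ‖(poincare Γ k w ∣[2 * (k : ℤ)] g) z‖ ≤ D := by
    rw [im_pow_mul_norm_slash]
    exact mul_le_mul_of_nonneg_left (hM _) (by positivity)
  have h4 : z.im ≤ z.im ^ k := le_self_pow₀ h1 (by omega)
  rw [div_le_iff₀ hε] at h2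
  have h5 : z.im ^ k * ‖(poincare Γ k w ∣[2 * (k : ℤ)] g) z‖ ≤ z.im ^ k * ε := by
    refine h3.trans (h2.trans ?_)
    gcongr
  exact le_of_mul_le_mul_left h5 (by positivity)

/-- The Poincaré series as a cusp form. -/
noncomputable def poincareForm (hΓ : IsSurfaceGroup Γ) {k : ℕ} (hk : 2 ≤ k) (w : ℍ) :
    Sections Γ k where
  toFun := poincare Γ k w
  slash_action_eq' := by
    rintro _ ⟨γ, hγ, rfl⟩
    exact poincare_slash k w hγ
  holo' := mdifferentiable_iff.mpr (hΓ.differentiableOn_poincare hk w)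
  zero_at_cusps' := fun _ => hΓ.isZeroAt_poincare hk w _

lemma continuous_sections {k : ℕ} (φ : Sections Γ k) : Continuous φ :=
  φ.holo'.continuous

lemma sections_slash {k : ℕ} (φ : Sections Γ k) {γ : SL(2, ℝ)} (hγ : γ ∈ Γ) :
    (φ : ℍ → ℂ) ∣[2 * (k : ℤ)] toGL γ = φ :=
  φ.slash_action_eq' _ ⟨γ, hγ, rfl⟩

lemma continuous_planeKernel (k : ℕ) (w : ℍ) : Continuous fun z => planeKernel k z w :=
  (mdifferentiable_iff.mpr (mdifferentiable_planeKernel k w)).continuous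

/-! ### Unfolding and the formula for the Bergman kernel. -/

/-- Integration of a cusp form against a Poincaré series: the unfolding method. -/
theorem innerHyp_poincare (hΓ : IsSurfaceGroup Γ) {F : Set ℍ}
    (hF : IsStrictFundamentalDomain Γ F) {k : ℕ} (hk : 2 ≤ k) (φ : Sections Γ k)
    (hφ : ∫⁻ z in F, ENNReal.ofReal (z.im ^ k * ‖φ z‖) ≠ ⊤) (w : ℍ) :
    innerHyp F k φ (poincare Γ k w) =
      trivialCount Γ * ((4 * Real.pi / (2 * k - 1) : ℝ) * φ w) := by
  have := hΓ.countable
  set G : ℍ → ℂ := fun z => (z.im : ℂ) ^ (2 * k) * φ z * planeKernel k w z with hG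
  have hGcont : Continuous G := by
    refine Continuous.mul (Continuous.mul (by fun_prop) (continuous_sections φ)) ?_
    refine Continuous.congr ?_ fun z => conj_planeKernel k z w
    exact Complex.continuous_conj.comp (continuous_planeKernel k w)
  -- Invariance of the Petersson integrand: since `φ` is `Γ`-invariant, the term of index `γ` is the
  -- single function `G` evaluated at `γ • z`.
  have hterm : ∀ (γ : Γ) (z : ℍ), (z.im : ℂ) ^ (2 * k) * φ z *
      (starRingEnd ℂ) (poincareTerm k w γ z) = G (γ • z) := by
    intro γ z
    have h := petersson_slash (2 * (k : ℤ)) (fun z => planeKernel k z w) φ (toGL (γ : SL(2, ℝ))) z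
    rw [sections_slash φ γ.2, det_toGL, abs_one, Complex.ofReal_one, one_zpow, one_mul] at h
    have h2 : ∀ x : ℂ, σ (toGL (γ : SL(2, ℝ))) x = x := fun x => by
      simp only [σ, det_toGL, zero_lt_one, if_true]
      rfl
    rw [h2] at h
    change (starRingEnd ℂ) (poincareTerm k w γ z) * φ z * (z.im : ℂ) ^ (2 * (k : ℤ)) =
      (starRingEnd ℂ) (planeKernel k (γ • z) w) * φ (γ • z) *
        ((γ • z).im : ℂ) ^ (2 * (k : ℤ)) at h
    have h3 : ∀ x : ℂ, x ^ (2 * (k : ℤ)) = x ^ (2 * k) := fun x => by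
      rw [← zpow_natCast]
      simp
    rw [conj_planeKernel, h3, h3] at h
    simp only [hG]
    linear_combination h
  have hnorm : ∀ (γ : Γ) (z : ℍ), ‖G (γ • z)‖ₑ = ENNReal.ofReal ((w.im ^ k)⁻¹ *
      (z.im ^ k * ‖φ z‖)) *
        ENNReal.ofReal (Real.cosh (dist ((γ : SL(2, ℝ)) • z) w / 2) ^ (2 * k))⁻¹ := by
    intro γ z
    have hw := pow_pos w.im_pos k
    have hz := pow_pos z.im_pos k
    rw [← ofReal_norm, ← hterm, ← ENNReal.ofReal_mul (by positivity), norm_mul, norm_mul,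
      RCLike.norm_conj, norm_poincareTerm_eq, norm_pow, Complex.norm_real, Real.norm_eq_abs,
      abs_of_pos z.im_pos, two_mul, pow_add]
    congr 1
    field_simp
  obtain ⟨M, hM0, hM⟩ := hΓ.exists_tsum_dist_smul_le hk w
  have hmeas : ∀ γ : Γ, Continuous fun z : ℍ => G (γ • z) := fun γ =>
    hGcont.comp (continuous_const_smul γ)
  -- The sum of the kernel norms is bounded uniformly in `z` by `M`, so absolute convergence reduces
  -- to integrability of `y^k |φ|` over `F`, the hypothesis `hφ`.
  have hfin : ∑' γ : Γ, ∫⁻ z in F, ‖G (γ • z)‖ₑ ≠ ⊤ := by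
    rw [← lintegral_tsum fun γ => (hmeas γ).enorm.measurable.aemeasurable]
    have hle : ∀ z : ℍ, ∑' γ : Γ, ‖G (γ • z)‖ₑ ≤ ENNReal.ofReal ((w.im ^ k)⁻¹) *
        ENNReal.ofReal (z.im ^ k * ‖φ z‖) * ENNReal.ofReal M := fun z => by
      simp_rw [hnorm]
      rw [ENNReal.tsum_mul_left, ← ENNReal.ofReal_mul (by have := w.im_pos; positivity)]
      gcongr
      exact hM z
    refine ((lintegral_mono hle).trans_lt ?_).ne
    have hc : Continuous fun z : ℍ => z.im ^ k * ‖φ z‖ :=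
      (UpperHalfPlane.continuous_im.pow k).mul (continuous_sections φ).norm
    rw [lintegral_mul_const _ (by fun_prop), lintegral_const_mul _ (by fun_prop)]
    exact ENNReal.mul_lt_top (ENNReal.mul_lt_top ENNReal.ofReal_lt_top hφ.lt_top)
      ENNReal.ofReal_lt_top
  have hmp : ∀ γ : Γ, Measurable (γ • · : ℍ → ℍ) := fun γ => (continuous_const_smul γ).measurable
  have hint : Integrable G (Measure.sum fun γ : Γ =>
      (volume.restrict F).map (γ • · : ℍ → ℍ)) := by
    refine ⟨hGcont.aestronglyMeasurable, ?_⟩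
    rw [hasFiniteIntegral_iff_enorm, lintegral_sum_measure]
    rwa [tsum_congr fun γ : Γ => lintegral_map hGcont.enorm.measurable (hmp γ), lt_top_iff_ne_top]
  have hsum := hasSum_integral_measure hint
  rw [hΓ.sum_map_smul_restrict hF] at hint hsum
  have hm : (trivialCount Γ : ENNReal) ≠ 0 := by
    exact_mod_cast (trivialCount_pos Γ).ne'
  have hint' : Integrable G volume := by
    rwa [integrable_smul_measure hm (ENNReal.natCast_ne_top _)] at hint
  have hrep : ∫ z, G z = (4 * Real.pi / (2 * k - 1) : ℝ) * φ w :=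
    integral_mul_planeKernel (by omega : 1 ≤ k) (mdifferentiable_iff.mp φ.holo') w hint'
  calc innerHyp F k φ (poincare Γ k w) = ∫ z in F, ∑' γ : Γ, G (γ • z) := by
        refine integral_congr_ae (Filter.Eventually.of_forall fun z => ?_)
        simp only [poincare]
        rw [Complex.conj_tsum, ← tsum_mul_left]
        exact tsum_congr fun γ => hterm γ z
    _ = ∑' γ : Γ, ∫ z in F, G (γ • z) :=
        integral_tsum (fun γ => (hmeas γ).aestronglyMeasurable) hfin
    _ = ∑' γ : Γ, ∫ z, G z ∂((volume.restrict F).map (γ • · : ℍ → ℍ)) := by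
        refine tsum_congr fun γ => ?_
        rw [integral_map (hmp γ).aemeasurable hGcont.aestronglyMeasurable]
    _ = ∫ z, G z ∂((trivialCount Γ : ENNReal) • volume) := hsum.tsum_eq
    _ = trivialCount Γ * ((4 * Real.pi / (2 * k - 1) : ℝ) * φ w) := by
        rw [integral_smul_measure, hrep]
        simp

/-- The Bochner integral of a nonintegrable function is `0` by convention, so a nonzero inner
product forces square-integrability. This is how orthonormality alone supplies convergence. -/
lemma integrableOn_of_innerHyp_ne_zero {F : Set ℍ} {k : ℕ} (φ : Sections Γ k)
    (h : innerHyp F k φ φ ≠ 0) :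
    IntegrableOn (fun z : ℍ => (z.im : ℂ) ^ (2 * k) * φ z * (starRingEnd ℂ) (φ z)) F := by
  by_contra hn
  exact h (integral_undef hn)

lemma norm_im_pow_mul_mul (k : ℕ) (z : ℍ) (a b : ℂ) :
    ‖(z.im : ℂ) ^ (2 * k) * a * (starRingEnd ℂ) b‖ = (z.im ^ k * ‖a‖) * (z.im ^ k * ‖b‖) := by
  rw [norm_mul, norm_mul, RCLike.norm_conj, norm_pow, Complex.norm_real, Real.norm_eq_abs,
    abs_of_pos z.im_pos]
  ring

/-- A section of finite nonzero norm is integrable over a fundamental domain of finite area. -/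
lemma lintegral_im_pow_mul_norm_ne_top {F : Set ℍ} (hvol : volume F < ⊤) {k : ℕ}
    (φ : Sections Γ k) (h : innerHyp F k φ φ ≠ 0) :
    ∫⁻ z in F, ENNReal.ofReal (z.im ^ k * ‖φ z‖) ≠ ⊤ := by
  have hc : Continuous fun z : ℍ => z.im ^ k * ‖φ z‖ :=
    (UpperHalfPlane.continuous_im.pow k).mul (continuous_sections φ).norm
  have hint := integrableOn_of_innerHyp_ne_zero φ h
  have hlt := hint.2
  rw [hasFiniteIntegral_iff_enorm] at hlt
  have hle : ∀ z : ℍ, ENNReal.ofReal (z.im ^ k * ‖φ z‖) ≤ 1 +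
      ‖(z.im : ℂ) ^ (2 * k) * φ z * (starRingEnd ℂ) (φ z)‖ₑ := fun z => by
    have h0 : 0 ≤ z.im ^ k * ‖φ z‖ := mul_nonneg (pow_nonneg z.im_pos.le _) (norm_nonneg _)
    rw [← ofReal_norm, norm_im_pow_mul_mul, ← ENNReal.ofReal_one, ← ENNReal.ofReal_add zero_le_one
      (by positivity)]
    exact ENNReal.ofReal_le_ofReal (by nlinarith [sq_nonneg (z.im ^ k * ‖φ z‖ - 1)])
  refine ((lintegral_mono hle).trans_lt ?_).ne
  rw [lintegral_add_left measurable_const, lintegral_const, one_mul]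
  refine ENNReal.add_lt_top.mpr ⟨?_, hlt⟩
  simpa using hvol

/-- The Bergman kernel is a multiple of the Poincaré series. -/
theorem poincare_eq (hΓ : IsSurfaceGroup Γ) {F : Set ℍ} (hF : IsStrictFundamentalDomain Γ F)
    (hvol : volume F < ⊤) {k : ℕ} (hk : 2 ≤ k) {B : ℍ → ℍ → ℂ} (hB : IsBergmanKernel Γ F k B)
    (z w : ℍ) :
    poincare Γ k w z = (trivialCount Γ * (4 * Real.pi / (2 * k - 1)) : ℝ) * B z w := by
  obtain ⟨n, f, ⟨horth, hspan⟩, hBf⟩ := hB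
  obtain ⟨c, hc⟩ := hspan (hΓ.poincareForm hk w)
  have hc' : ∀ z, poincare Γ k w z = ∑ i, c i * f i z := hc
  have hint : ∀ i j, IntegrableOn
      (fun z : ℍ => (z.im : ℂ) ^ (2 * k) * f i z * (starRingEnd ℂ) (f j z)) F := by
    intro i j
    have hi := integrableOn_of_innerHyp_ne_zero (F := F) (f i) (by rw [horth]; simp)
    have hj := integrableOn_of_innerHyp_ne_zero (F := F) (f j) (by rw [horth]; simp)
    have hcont : Continuous
        (fun z : ℍ => (z.im : ℂ) ^ (2 * k) * f i z * (starRingEnd ℂ) (f j z)) :=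
      Continuous.mul (Continuous.mul (by fun_prop) (continuous_sections _))
        (Complex.continuous_conj.comp (continuous_sections _))
    refine (hi.norm.add hj.norm).mono' hcont.aestronglyMeasurable
      (Filter.Eventually.of_forall fun z => ?_)
    simp only [Pi.add_apply, norm_im_pow_mul_mul]
    nlinarith [sq_nonneg (z.im ^ k * ‖f i z‖ - z.im ^ k * ‖f j z‖),
      sq_nonneg (z.im ^ k * ‖f i z‖), sq_nonneg (z.im ^ k * ‖f j z‖)]
  -- Pairing `f j` with the expansion of the Poincaré series isolates `conj (c j)`, while unfolding
  -- evaluates the same pairing as a multiple of `f j w`.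
  have hcoef : ∀ j, (starRingEnd ℂ) (c j) =
      trivialCount Γ * ((4 * Real.pi / (2 * k - 1) : ℝ) * f j w) := by
    intro j
    rw [← hΓ.innerHyp_poincare hF hk (f j) (lintegral_im_pow_mul_norm_ne_top hvol (f j)
      (by rw [horth]; simp)) w]
    have h1 : innerHyp F k (f j) (poincare Γ k w) =
        ∑ i, (starRingEnd ℂ) (c i) * innerHyp F k (f j) (f i) := by
      simp only [innerHyp]
      simp_rw [← integral_const_mul]
      rw [← integral_finsetSum _ fun i _ => (hint j i).const_mul _]
      refine integral_congr_ae (Filter.Eventually.of_forall fun z => ?_)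
      simp only [hc', map_sum, map_mul, Finset.mul_sum]
      exact Finset.sum_congr rfl fun i _ => by ring
    rw [h1]
    simp_rw [horth]
    simp
  rw [hc', hBf, Finset.mul_sum]
  refine Finset.sum_congr rfl fun i _ => ?_
  have h2 := congrArg (starRingEnd ℂ) (hcoef i)
  rw [Complex.conj_conj] at h2
  rw [h2]
  simp only [map_mul, Complex.conj_ofReal, map_natCast]
  push_cast
  ring

/-- The norm of the Bergman kernel is bounded by a sum over an orbit. -/
theorem hypNorm_le (hΓ : IsSurfaceGroup Γ) {F : Set ℍ} (hF : IsStrictFundamentalDomain Γ F)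
    (hvol : volume F < ⊤) {k : ℕ} (hk : 2 ≤ k) {B : ℍ → ℍ → ℂ} (hB : IsBergmanKernel Γ F k B)
    (z w : ℍ) {S : ℝ} (hS0 : 0 ≤ S) (hS : ∑' p : MulAction.orbit Γ w,
      ENNReal.ofReal (Real.cosh (dist z p / 2) ^ (2 * k))⁻¹ ≤ ENNReal.ofReal S) :
    hypNorm k B z w ≤ (2 * k - 1) / (4 * Real.pi) * S := by
  have h1 := hΓ.ofReal_norm_poincare_le hk z w
  rw [hΓ.tsum_dist_smul] at h1
  have h2 : ENNReal.ofReal (z.im ^ k * w.im ^ k * ‖poincare Γ k w z‖) ≤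
      ENNReal.ofReal (trivialCount Γ * S) := by
    rw [ENNReal.ofReal_mul (p := (trivialCount Γ : ℝ)) (by positivity), ENNReal.ofReal_natCast]
    exact h1.trans (by gcongr)
  rw [ENNReal.ofReal_le_ofReal_iff (by positivity), hΓ.poincare_eq hF hvol hk hB z w, norm_mul,
    Complex.norm_real, Real.norm_eq_abs] at h2
  have hm : (0 : ℝ) < trivialCount Γ := by exact_mod_cast trivialCount_pos Γ
  have hk' : (2 : ℝ) ≤ k := by exact_mod_cast hk
  have hk1 : (0 : ℝ) < 2 * k - 1 := by linarith
  have hpi := Real.pi_pos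
  rw [abs_of_nonneg (by positivity)] at h2
  have h3 : (trivialCount Γ : ℝ) * ((4 * Real.pi / (2 * k - 1)) * hypNorm k B z w) ≤
      trivialCount Γ * S := by
    unfold hypNorm
    linarith
  have h4 := le_of_mul_le_mul_left h3 hm
  rw [div_mul_eq_mul_div, div_le_iff₀ hk1] at h4
  rw [div_mul_eq_mul_div, le_div_iff₀ (by positivity)]
  linarith

end IsSurfaceGroup

/-! ### The explicit constant and its decay. -/

/-- The main terms of `boundConst`, normalised by the factor `(2 * k - 1) / (4 * π)`. -/
noncomputable def mainTerms (k : ℕ) (δ r : ℝ) : ℝ :=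
  2 * Real.sinh δ / Real.cosh (δ / 2) ^ (2 * k) * (Real.cosh (r / 4) / Real.sinh (r / 4))
    + 2 / (2 * k - 2) / Real.cosh (δ / 2) ^ (2 * k - 2) * (2 + 1 / Real.sinh (r / 4) ^ 2)
    + 4 / (2 * k - 4) / Real.cosh (δ / 2) ^ (2 * k - 4) * (1 / Real.sinh (r / 4) ^ 2)

lemma boundConst_eq {k : ℕ} (hk : 3 ≤ k) (δ r : ℝ) :
    boundConst k δ r = (2 * k - 1) / (4 * Real.pi) *
      (Real.sinh (δ + r) / (Real.sinh r * Real.cosh ((δ - r) / 2) ^ (2 * k)) + mainTerms k δ r) := by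
  have hk' : (3 : ℝ) ≤ k := by exact_mod_cast hk
  have h2 : (2 * k - 2 : ℝ) ≠ 0 := by linarith
  have h4 : (2 * k - 4 : ℝ) ≠ 0 := by linarith
  have hpi := Real.pi_ne_zero
  have hc := (Real.cosh_pos (δ / 2)).ne'
  unfold boundConst mainTerms
  have a1 : (2 * k - 1) * Real.sinh (δ + r) /
      (4 * Real.pi * Real.cosh ((δ - r) / 2) ^ (2 * k) * Real.sinh r) = (2 * k - 1) / (4 * Real.pi) *
      (Real.sinh (δ + r) / (Real.sinh r * Real.cosh ((δ - r) / 2) ^ (2 * k))) := by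
    rw [div_mul_div_comm]
    congr 1
    ring
  have a2 : (2 * k - 1) * Real.sinh δ / (2 * Real.pi * Real.cosh (δ / 2) ^ (2 * k)) =
      (2 * k - 1) / (4 * Real.pi) * (2 * Real.sinh δ / Real.cosh (δ / 2) ^ (2 * k)) := by
    field_simp
    ring
  have a3 : (2 * k - 1) / (2 * Real.pi * (2 * k - 2) * Real.cosh (δ / 2) ^ (2 * k - 2)) =
      (2 * k - 1) / (4 * Real.pi) * (2 / (2 * k - 2) / Real.cosh (δ / 2) ^ (2 * k - 2)) := by
    field_simp
    ring
  have a4 : (2 * k - 1) / (Real.pi * (2 * k - 4) * Real.cosh (δ / 2) ^ (2 * k - 4)) =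
      (2 * k - 1) / (4 * Real.pi) * (4 / (2 * k - 4) / Real.cosh (δ / 2) ^ (2 * k - 4)) := by
    field_simp
  rw [a1, a2, a3, a4]
  generalize (2 * k - 1) / (4 * Real.pi) = x
  generalize 2 / (2 * k - 2 : ℝ) / Real.cosh (δ / 2) ^ (2 * k - 2) = y
  generalize 4 / (2 * k - 4 : ℝ) / Real.cosh (δ / 2) ^ (2 * k - 4) = y'
  ring

lemma first_term_nonneg {k : ℕ} {δ r : ℝ} (hr : 0 < r) (hδ : r ≤ δ) :
    0 ≤ Real.sinh (δ + r) / (Real.sinh r * Real.cosh ((δ - r) / 2) ^ (2 * k)) := by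
  have := Real.sinh_pos_iff.mpr hr
  have := Real.sinh_nonneg_iff.mpr (by linarith : 0 ≤ δ + r)
  have := Real.cosh_pos ((δ - r) / 2)
  positivity

/-- Only the third terms differ. Since `r/4 ≤ δ/2`, monotonicity of `sinh * cosh` gives
`coth(r/4)/(sinh(δ/2) cosh(δ/2)) ≤ 1/sinh²(r/4)`, and `2k-3` is replaced by `2k-4`. -/
lemma packingBound_le_mainTerms {k : ℕ} (hk : 3 ≤ k) {δ r : ℝ} (hr : 0 < r) (hδ : r ≤ δ) :
    packingBound k δ r ≤ mainTerms k δ r := by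
  have hk' : (3 : ℝ) ≤ k := by exact_mod_cast hk
  have hC := Real.cosh_pos (δ / 2)
  have hs := Real.sinh_pos_iff.mpr (by linarith : 0 < r / 4)
  have hc := Real.cosh_pos (r / 4)
  have hS := Real.sinh_pos_iff.mpr (by linarith : 0 < δ / 2)
  unfold packingBound mainTerms
  refine add_le_add le_rfl ?_
  have h1 : Real.sinh (r / 4) * Real.cosh (r / 4) ≤ Real.sinh (δ / 2) * Real.cosh (δ / 2) := by
    gcongr ?_ * ?_
    · exact Real.sinh_le_sinh.mpr (by linarith)
    · rw [Real.cosh_le_cosh, abs_of_pos (by linarith), abs_of_pos (by linarith)]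
      linarith
  have h2 : Real.cosh (r / 4) / Real.sinh (r / 4) / (Real.sinh (δ / 2) * Real.cosh (δ / 2)) ≤
      1 / Real.sinh (r / 4) ^ 2 := by
    rw [div_div, div_le_div_iff₀ (by positivity) (by positivity)]
    nlinarith
  have h3 : Real.cosh (δ / 2) ^ (2 * k - 3) = Real.cosh (δ / 2) ^ (2 * k - 4) * Real.cosh (δ / 2) := by
    rw [← pow_succ]
    congr 1
    omega
  rw [h3]
  calc 4 / (2 * k - 3) / (Real.sinh (δ / 2) * (Real.cosh (δ / 2) ^ (2 * k - 4) *
        Real.cosh (δ / 2))) * (Real.cosh (r / 4) / Real.sinh (r / 4))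
      = 4 / (2 * k - 3) / Real.cosh (δ / 2) ^ (2 * k - 4) *
        (Real.cosh (r / 4) / Real.sinh (r / 4) / (Real.sinh (δ / 2) * Real.cosh (δ / 2))) := by
        have : (2 * k - 3 : ℝ) ≠ 0 := by linarith
        field_simp
    _ ≤ _ := by
        have : (0 : ℝ) < 2 * k - 4 := by linarith
        gcongr
        norm_num

/-- Put `D = cosh((δ-r)/2)`. The factor `sinh(δ+r)` is at most `4 e^(2r) D²`, which costs two of the
`2k` powers of `D`; each other term loses at most four powers of `cosh(δ/2) ≥ D`. The prefactor
`(2k-1)/(4π)` is at most `k`. -/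
lemma boundConst_le {r : ℝ} (hr : 0 < r) : ∃ K : ℝ, 0 < K ∧ ∀ k : ℕ, 3 ≤ k → ∀ δ : ℝ, r ≤ δ →
    boundConst k δ r ≤ K * k / Real.cosh ((δ - r) / 2) ^ (2 * k - 4) := by
  have hs := Real.sinh_pos_iff.mpr (by linarith : 0 < r / 4)
  have hsr := Real.sinh_pos_iff.mpr hr
  have hc := Real.cosh_pos (r / 4)
  obtain ⟨K, hK⟩ : ∃ K, K = 4 * Real.exp (2 * r) / Real.sinh r +
    (4 * (Real.cosh (r / 4) / Real.sinh (r / 4)) + 1 * (2 + 1 / Real.sinh (r / 4) ^ 2) +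
      2 * (1 / Real.sinh (r / 4) ^ 2)) := ⟨_, rfl⟩
  refine ⟨K, by rw [hK]; positivity, fun k hk δ hδ => ?_⟩
  have hk' : (3 : ℝ) ≤ k := by exact_mod_cast hk
  set D := Real.cosh ((δ - r) / 2) with hD
  have hD1 : 1 ≤ D := Real.one_le_cosh _
  have hDC : D ≤ Real.cosh (δ / 2) := by
    rw [hD, Real.cosh_le_cosh, abs_of_nonneg (by linarith), abs_of_pos (by linarith)]
    linarith
  have hC : 0 < Real.cosh (δ / 2) := by linarith
  have hpi := Real.pi_gt_three
  have hDk : 0 < D ^ (2 * k - 4) := by positivity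
  have e1 : 2 * k = 2 * k - 4 + 2 + 2 := by omega
  have e2 : 2 * k - 2 = 2 * k - 4 + 2 := by omega
  have hpow : (Real.cosh (δ / 2) ^ (2 * k - 4))⁻¹ ≤ (D ^ (2 * k - 4))⁻¹ := by gcongr
  rw [boundConst_eq hk]
  refine (mul_le_mul (b := (k : ℝ)) (d := K / D ^ (2 * k - 4)) ?_ ?_ ?_ (by positivity)).trans_eq
    (by ring)
  · rw [div_le_iff₀ (by positivity)]
    nlinarith
  · rw [hK, mainTerms, add_div, div_eq_mul_inv (_ + _ + _) (D ^ _), add_mul, add_mul]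
    refine add_le_add ?_ (add_le_add (add_le_add ?_ ?_) ?_)
    · have h1 : Real.sinh (δ + r) ≤ 4 * Real.exp (2 * r) * D ^ 2 := by
        have h2 : Real.exp ((δ - r) / 2) ≤ 2 * D := by
          rw [hD, Real.cosh_eq]
          have := Real.exp_pos (-((δ - r) / 2))
          linarith
        have h3 : Real.sinh (δ + r) ≤ Real.exp (δ + r) := by
          have h4 := Real.exp_pos (-(δ + r))
          have h5 := Real.exp_pos (δ + r)
          rw [Real.sinh_eq]
          linarith
        have h6 : Real.exp (δ + r) = Real.exp (2 * r) * Real.exp ((δ - r) / 2) ^ 2 := by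
          rw [← Real.exp_nat_mul, ← Real.exp_add]
          congr 1
          push_cast
          ring
        rw [h6] at h3
        refine h3.trans ?_
        have h7 := Real.exp_pos (2 * r)
        have h8 := pow_le_pow_left₀ (Real.exp_pos _).le h2 2
        nlinarith
      rw [div_div, div_le_div_iff₀ (by positivity) (by positivity)]
      have h9 : D ^ (2 * k) = D ^ (2 * k - 4) * D ^ 2 * D ^ 2 := by
        rw [← pow_add, ← pow_add]
        congr 1
      rw [h9]
      have h10 : 1 ≤ D ^ 2 := one_le_pow₀ hD1
      calc Real.sinh (δ + r) * (Real.sinh r * D ^ (2 * k - 4))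
          ≤ 4 * Real.exp (2 * r) * D ^ 2 * (Real.sinh r * D ^ (2 * k - 4)) := by gcongr
        _ ≤ 4 * Real.exp (2 * r) * D ^ 2 * (Real.sinh r * D ^ (2 * k - 4)) * D ^ 2 :=
            le_mul_of_one_le_right (by positivity) h10
        _ = _ := by ring
    · have h1 : 2 * Real.sinh δ ≤ 4 * Real.cosh (δ / 2) ^ 2 * Real.cosh (δ / 2) ^ 2 := by
        have h2 : Real.sinh δ = 2 * Real.sinh (δ / 2) * Real.cosh (δ / 2) := by
          rw [← Real.sinh_two_mul]
          congr 1
          ring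
        have h3 := (Real.sinh_lt_cosh (δ / 2)).le
        have h4 : 1 ≤ Real.cosh (δ / 2) ^ 2 := one_le_pow₀ (Real.one_le_cosh _)
        rw [h2]
        nlinarith [mul_le_mul_of_nonneg_right h3 hC.le]
      have h5 : 2 * Real.sinh δ / Real.cosh (δ / 2) ^ (2 * k) ≤ 4 * (D ^ (2 * k - 4))⁻¹ := by
        refine le_trans ?_ (mul_le_mul_of_nonneg_left hpow (by norm_num))
        rw [div_le_iff₀ (by positivity)]
        refine h1.trans (le_of_eq ?_)
        rw [show Real.cosh (δ / 2) ^ (2 * k) = Real.cosh (δ / 2) ^ (2 * k - 4) *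
          Real.cosh (δ / 2) ^ 2 * Real.cosh (δ / 2) ^ 2 by
            rw [← pow_add, ← pow_add]
            congr 1]
        field_simp
      calc _ ≤ 4 * (D ^ (2 * k - 4))⁻¹ * (Real.cosh (r / 4) / Real.sinh (r / 4)) := by gcongr
        _ = _ := by ring
    · have h5 : 2 / (2 * k - 2) / Real.cosh (δ / 2) ^ (2 * k - 2) ≤ 1 * (D ^ (2 * k - 4))⁻¹ := by
        rw [div_eq_mul_inv (2 / (2 * k - 2 : ℝ)) _]
        refine mul_le_mul ?_ (le_trans ?_ hpow) (by positivity) zero_le_one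
        · rw [div_le_one (by linarith)]
          linarith
        · gcongr
          · exact Real.one_le_cosh _
          · omega
      calc _ ≤ 1 * (D ^ (2 * k - 4))⁻¹ * (2 + 1 / Real.sinh (r / 4) ^ 2) := by gcongr
        _ = _ := by ring
    · have h5 : 4 / (2 * k - 4) / Real.cosh (δ / 2) ^ (2 * k - 4) ≤ 2 * (D ^ (2 * k - 4))⁻¹ := by
        rw [div_eq_mul_inv (4 / (2 * k - 4 : ℝ)) _]
        refine mul_le_mul ?_ hpow (by positivity) zero_le_two
        rw [div_le_iff₀ (by linarith)]
        linarith
      calc _ ≤ 2 * (D ^ (2 * k - 4))⁻¹ * (1 / Real.sinh (r / 4) ^ 2) := by gcongr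
        _ = _ := by ring
  · have := first_term_nonneg (k := k) hr hδ
    have h4 : (0 : ℝ) < 2 * k - 4 := by linarith
    have h2 : (0 : ℝ) < 2 * k - 2 := by linarith
    have h6 := Real.sinh_nonneg_iff.mpr (by linarith : 0 ≤ δ)
    unfold mainTerms
    positivity

/-! ### The compact case. -/

lemma surfaceDist_le (Γ : Subgroup SL(2, ℝ)) (z w : ℍ) {p : ℍ} (hp : p ∈ MulAction.orbit Γ w) :
    surfaceDist Γ z w ≤ dist z p := by
  obtain ⟨γ, rfl⟩ := hp
  refine ciInf_le ⟨0, ?_⟩ γ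
  rintro _ ⟨γ, rfl⟩
  exact dist_nonneg

namespace IsSurfaceGroup

variable {Γ : Subgroup SL(2, ℝ)}

lemma injRadiusCompact_le_dist {z : ℍ} {γ : SL(2, ℝ)} (hγ : γ ∈ Γ) (h1 : γ ≠ 1) (h2 : γ ≠ -1) :
    injRadiusCompact Γ ≤ dist z (γ • z) := by
  refine csInf_le ⟨0, ?_⟩ ⟨z, γ, hγ, h1, h2, rfl⟩
  rintro _ ⟨z, γ, -, -, -, rfl⟩
  exact dist_nonneg

/-- The displacement bound is locally uniform and conjugation-invariant, so finitely many balls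
covering the quotient give a uniform one. -/
lemma injRadiusCompact_pos (hΓ : IsSurfaceGroup Γ) (hX : CompactSpace (Surface Γ)) :
    0 < injRadiusCompact Γ := by
  choose ε hε hsep using hΓ.exists_le_dist_smul
  let π : ℍ → Surface Γ := Quotient.mk''
  have hopen : IsOpenMap π := isOpenMap_quotient_mk'_mul
  obtain ⟨t, ht⟩ := isCompact_univ.elim_finite_subcover (fun w => π '' Metric.ball w (ε w))
    (fun w => hopen _ Metric.isOpen_ball) fun x _ => by
      induction x using Quotient.inductionOn' with | h w => ?_
      exact Set.mem_iUnion.mpr ⟨w, w, Metric.mem_ball_self (hε w), rfl⟩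
  have hcov : ∀ z : ℍ, ∃ w ∈ t, ∃ γ : Γ, dist (γ • z) w < ε w := fun z => by
    have := ht (Set.mem_univ (π z))
    simp only [Set.mem_iUnion] at this
    obtain ⟨w, hw, p, hp, hpz⟩ := this
    obtain ⟨γ, hγ⟩ := Quotient.exact hpz
    exact ⟨w, hw, γ, by rw [show γ • z = p from hγ]; exact hp⟩
  obtain ⟨w₀, hw₀, -⟩ := hcov UpperHalfPlane.I
  obtain ⟨w₁, hw₁, hmin⟩ := t.exists_min_image ε ⟨w₀, hw₀⟩
  refine (hε w₁).trans_le (le_csInf ?_ ?_)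
  -- The real `sInf` of the empty set is `0`, so nonemptiness has to be proved: if `Γ` acted
  -- trivially, finitely many closed balls would cover `ℍ`, which is not compact.
  · by_contra hne
    rw [Set.not_nonempty_iff_eq_empty] at hne
    have htriv : ∀ γ : Γ, ∀ z : ℍ, γ • z = z := fun γ z => by
      rw [← MulAction.mem_stabilizer_iff, hΓ.stabilizer_eq]
      by_contra! h
      exact Set.eq_empty_iff_forall_notMem.mp hne _ ⟨z, γ, γ.2, h.1, h.2, rfl⟩
    have hU : (Set.univ : Set ℍ) ⊆ ⋃ w ∈ t, Metric.closedBall w (ε w) := fun z _ => by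
      obtain ⟨w, hw, γ, hd⟩ := hcov z
      rw [htriv] at hd
      exact Set.mem_biUnion hw hd.le
    exact noncompact_univ ℍ (IsCompact.of_isClosed_subset
      (t.isCompact_biUnion fun w _ => isCompact_closedBall w (ε w)) isClosed_univ hU)
  · rintro _ ⟨z, γ, hγ, h1, h2, rfl⟩
    obtain ⟨w, hw, σ, hd⟩ := hcov z
    have h3 := hsep w _ hd ((σ : SL(2, ℝ)) * γ * (σ : SL(2, ℝ))⁻¹)
      (Γ.mul_mem (Γ.mul_mem σ.2 hγ) (Γ.inv_mem σ.2)) (fun h => h1 (by simpa using h))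
      (fun h => h2 (by
        rw [mul_inv_eq_iff_eq_mul, neg_one_mul] at h
        have := congrArg ((σ : SL(2, ℝ))⁻¹ * ·) h
        simpa using this))
    refine (hmin w hw).trans (h3.trans (le_of_eq ?_))
    change dist ((σ : SL(2, ℝ)) • z) _ = _
    change dist ((σ : SL(2, ℝ)) • z) (((σ : SL(2, ℝ)) * γ * (σ : SL(2, ℝ))⁻¹) • ((σ : SL(2, ℝ)) • z)) = _
    rw [← mul_smul, inv_mul_cancel_right, mul_smul, dist_smul]

theorem hypNorm_le_of_compact (hΓ : IsSurfaceGroup Γ) {F : Set ℍ}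
    (hF : IsStrictFundamentalDomain Γ F) (hvol : volume F < ⊤) (hX : CompactSpace (Surface Γ))
    {k : ℕ} (hk : 3 ≤ k) {B : ℍ → ℍ → ℂ} (hB : IsBergmanKernel Γ F k B) {δ : ℝ}
    (hδ : injRadiusCompact Γ ≤ δ) {z w : ℍ} (hzw : δ ≤ surfaceDist Γ z w) :
    hypNorm k B z w ≤ boundConst k δ (injRadiusCompact Γ) := by
  have hr := hΓ.injRadiusCompact_pos hX
  have := hΓ.countable_orbit w
  have hsum := tsum_inv_cosh_pow_le (A := MulAction.orbit Γ w) (z := z) (by omega : 2 ≤ k) hr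
    (by linarith : injRadiusCompact Γ / 2 ≤ δ)
    (le_dist_orbit fun γ hγ h1 h2 => injRadiusCompact_le_dist hγ h1 h2)
    (fun p hp => hzw.trans (surfaceDist_le Γ z w hp))
  have hT := first_term_nonneg (k := k) hr hδ
  have hM := packingBound_le_mainTerms hk hr hδ
  rw [boundConst_eq hk]
  refine hΓ.hypNorm_le hF hvol (by omega) hB z w ?_
    (hsum.trans (ENNReal.ofReal_le_ofReal (by linarith)))
  have hk' : (3 : ℝ) ≤ k := by exact_mod_cast hk
  have h4 : (0 : ℝ) < 2 * k - 4 := by linarith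
  have h2 : (0 : ℝ) < 2 * k - 2 := by linarith
  have h6 := Real.sinh_nonneg_iff.mpr (by linarith : 0 ≤ δ)
  have h7 := Real.sinh_pos_iff.mpr (by linarith : 0 < injRadiusCompact Γ / 4)
  unfold mainTerms
  positivity

end IsSurfaceGroup

/-! ### Elementary inequalities for the cusp: larger distance against smaller separation. -/

/-- The maximum of `u ^ m * (1 - u)` on the unit interval. -/
lemma pow_mul_one_sub_le {m : ℕ} (hm : 1 ≤ m) {u : ℝ} (hu : 0 < u) :
    u ^ m * (1 - u) ≤ 1 / (2 * (m + 1)) := by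
  have hm' : (1 : ℝ) ≤ m := by exact_mod_cast hm
  set v : ℝ := m / (m + 1) with hv
  have hv0 : 0 < v := by positivity
  -- Bernoulli's inequality at the maximizer `v = m/(m+1)`; a second use below gives `v^m ≤ 1/2`.
  have h1 : (m + 1) * (1 - u) ≤ (v / u) ^ m := by
    have hB := one_add_mul_le_pow (a := v / u - 1) (by
      have : 0 < v / u := by positivity
      linarith) m
    rw [add_sub_cancel] at hB
    refine le_trans ?_ hB
    have h2 : 1 + m * (v / u - 1) - (m + 1) * (1 - u) = ((m + 1) * u - m) ^ 2 / ((m + 1) * u) := by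
      rw [hv]
      field_simp
      ring
    have h3 : 0 ≤ ((m + 1) * u - m) ^ 2 / ((m + 1) * u) := by positivity
    linarith
  have h4 : v ^ m ≤ 1 / 2 := by
    have hB := one_add_mul_le_pow (a := (1 / m : ℝ)) (by
      have : (0 : ℝ) < 1 / m := by positivity
      linarith) m
    rw [mul_one_div_cancel (by positivity)] at hB
    have h5 : v = (1 + 1 / m : ℝ)⁻¹ := by
      rw [hv]
      field_simp
    rw [one_add_one_eq_two] at hB
    rw [h5, inv_pow, one_div 2]
    exact inv_anti₀ two_pos hB
  rw [div_pow, le_div_iff₀ (by positivity)] at h1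
  rw [le_div_iff₀ (by positivity)]
  nlinarith

/-- From `t'² ≤ t² + (1-u)` one gets `t' ≤ t + (1-u)/(2t)`; the factor `u^m` then makes the excess
`O(1/m)`. -/
lemma tanh_pow_le {m : ℕ} (hm : 1 ≤ m) {t t' u : ℝ} (ht : 0 < t) (hu : 0 < u)
    (hu1 : u ≤ 1) (h : t' ^ 2 = 1 - (1 - t ^ 2) * u) :
    t' * u ^ m ≤ t + 1 / (4 * (m + 1) * t) := by
  have h1 : t' ≤ t + (1 - u) / (2 * t) := by
    have h2 : 0 ≤ (1 - u) / (2 * t) := div_nonneg (by linarith) (by linarith)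
    refine le_of_abs_le (abs_le_of_sq_le_sq ?_ (by linarith))
    have h3 : (t + (1 - u) / (2 * t)) ^ 2 = t ^ 2 + (1 - u) + ((1 - u) / (2 * t)) ^ 2 := by
      field_simp
      ring
    rw [h3, h]
    nlinarith [sq_nonneg ((1 - u) / (2 * t)), sq_nonneg t]
  have h4 := pow_mul_one_sub_le hm hu
  have h5 : u ^ m ≤ 1 := pow_le_one₀ hu.le hu1
  have h6 : 0 < u ^ m := by positivity
  calc t' * u ^ m ≤ (t + (1 - u) / (2 * t)) * u ^ m := by gcongr
    _ = t * u ^ m + u ^ m * (1 - u) / (2 * t) := by ring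
    _ ≤ t * 1 + 1 / (2 * (m + 1)) / (2 * t) := by gcongr
    _ = t + 1 / (4 * (m + 1) * t) := by
        field_simp
        ring

/-- With `x = μ²` and `Q ≥ (x+1)²/(4x)`, the constants are rounded-up maxima of `μ/Q²`, `μ/Q³`,
`μ²/Q²`, `μ²/Q³`, `μ²/Q⁴`, attained at `x = 5/3, 7/5, 3, 2, 5/3` when equality holds. The squares
offered to `nlinarith` are centred at or near these points, with `y = x - 1`. -/
lemma ratio_bounds_of_le {μ Q : ℝ} (hμ : 1 ≤ μ) (hQ : (μ ^ 2 + 1) ^ 2 ≤ 4 * μ ^ 2 * Q) :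
    μ ≤ 1.14 * Q ^ 2 ∧ μ ≤ 1.1 * Q ^ 3 ∧ μ ^ 2 ≤ 1.7 * Q ^ 2 ∧ μ ^ 2 ≤ 1.42 * Q ^ 3 ∧
      μ ^ 2 ≤ 1.3 * Q ^ 4 := by
  obtain ⟨x, hx⟩ : ∃ x, x = μ ^ 2 := ⟨_, rfl⟩
  have hx1 : 1 ≤ x := by rw [hx]; exact one_le_pow₀ hμ
  have hx0 : 0 < x := by linarith
  have hQ' : (x + 1) ^ 2 / (4 * x) ≤ Q := by
    rw [div_le_iff₀ (by positivity), hx]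
    linarith
  have hG : 0 ≤ (x + 1) ^ 2 / (4 * x) := by positivity
  have hp : ∀ n : ℕ, ((x + 1) ^ 2 / (4 * x)) ^ n ≤ Q ^ n := fun n => pow_le_pow_left₀ hG hQ' n
  have hb : ∀ (n : ℕ) (A y : ℝ), 0 ≤ A → y * (4 * x) ^ n ≤ A * ((x + 1) ^ 2) ^ n →
      y ≤ A * Q ^ n := fun n A y hA h => by
    refine le_trans ?_ (mul_le_mul_of_nonneg_left (hp n) hA)
    rw [div_pow, ← mul_div_assoc, le_div_iff₀ (by positivity)]
    exact h
  -- Odd powers of `μ` are removed by tangent-line bounds near the maximizers: `129/100`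
  -- approximates `√(5/3)` and `59/50` approximates `√(7/5)`.
  have hm1 : μ ≤ (x + 5 / 3) * (50 / 129) := by
    nlinarith [sq_nonneg (μ - 129 / 100)]
  have hm2 : μ ≤ (x + 7 / 5) * (25 / 59) := by
    nlinarith [sq_nonneg (μ - 59 / 50)]
  obtain ⟨y, rfl⟩ : ∃ y, x = 1 + y := ⟨x - 1, by ring⟩
  have hy : 0 ≤ y := by linarith
  rw [← hx]
  refine ⟨hm1.trans (hb 2 _ _ (by norm_num) ?_), hm2.trans (hb 3 _ _ (by norm_num) ?_),
    hb 2 _ _ (by norm_num) ?_, hb 3 _ _ (by norm_num) ?_, hb 4 _ _ (by norm_num) ?_⟩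
  · have hz : ∀ (n : ℕ) (b : ℝ), 0 ≤ y ^ n * (y - b) ^ 2 := fun n b => by positivity
    nlinarith only [hz 0 (643 / 1000), hz 1 (643 / 1000), hz 2 (643 / 1000), hy, hz 1 0, hz 0 0, hz 2 0,
      hz 0 (6 / 10), hz 0 (7 / 10)]
  · have hz : ∀ (n : ℕ) (b : ℝ), 0 ≤ y ^ n * (y - b) ^ 2 := fun n b => by positivity
    nlinarith only [hz 0 (363 / 1000), hz 1 (363 / 1000), hz 2 (363 / 1000), hz 3 (363 / 1000),
      hz 4 (363 / 1000), hy, hz 1 0, hz 0 0, hz 2 0, hz 3 0, hz 4 0, hz 0 (3 / 10), hz 0 (4 / 10)]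
  · have h0 : 0 ≤ y ^ 0 * (y - 2) ^ 2 := by positivity
    have h1 : 0 ≤ y ^ 1 * (y - 2) ^ 2 := by positivity
    have h2 : 0 ≤ y ^ 2 * (y - 2) ^ 2 := by positivity
    have hz : ∀ n, 0 ≤ y ^ n := fun n => by positivity
    nlinarith only [hz 0, hz 1, hz 2, hz 3, hz 4, hz 5, hz 6, hz 7, hz 8, h0, h1, h2]
  · have h0 : 0 ≤ y ^ 0 * (y - 1) ^ 2 := by positivity
    have h1 : 0 ≤ y ^ 1 * (y - 1) ^ 2 := by positivity
    have h2 : 0 ≤ y ^ 2 * (y - 1) ^ 2 := by positivity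
    have h3 : 0 ≤ y ^ 3 * (y - 1) ^ 2 := by positivity
    have h4 : 0 ≤ y ^ 4 * (y - 1) ^ 2 := by positivity
    have hz : ∀ n, 0 ≤ y ^ n := fun n => by positivity
    nlinarith only [hz 0, hz 1, hz 2, hz 3, hz 4, hz 5, hz 6, hz 7, hz 8, h0, h1, h2, h3, h4]
  · have h0 : 0 ≤ y ^ 0 * (y - 2 / 3) ^ 2 := by positivity
    have h1 : 0 ≤ y ^ 1 * (y - 2 / 3) ^ 2 := by positivity
    have h2 : 0 ≤ y ^ 2 * (y - 2 / 3) ^ 2 := by positivity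
    have h3 : 0 ≤ y ^ 3 * (y - 2 / 3) ^ 2 := by positivity
    have h4 : 0 ≤ y ^ 4 * (y - 2 / 3) ^ 2 := by positivity
    have h5 : 0 ≤ y ^ 5 * (y - 2 / 3) ^ 2 := by positivity
    have h6 : 0 ≤ y ^ 6 * (y - 2 / 3) ^ 2 := by positivity
    have hz : ∀ n, 0 ≤ y ^ n := fun n => by positivity
    nlinarith only [hz 0, hz 1, hz 2, hz 3, hz 4, hz 5, hz 6, hz 7, hz 8, h0, h1, h2, h3, h4, h5, h6]

/-- The bounds on the ratio of the two values of `cosh (δ / 2) ^ 2` in the cuspidal region. -/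
lemma ratio_bounds {μ l a c c' : ℝ} (hμ : 1 ≤ μ) (hl : μ ≤ l) (ha0 : 0 ≤ a) (ha : a ≤ c - 1)
    (hcc : c ≤ c') (h1 : 4 * (l * μ) * c ≤ (l + μ) ^ 2 + a)
    (h2 : (l * μ + 1) ^ 2 ≤ 4 * (l * μ) * c') :
    μ ≤ 1.14 * (c' / c) ^ 2 ∧ μ ≤ 1.1 * (c' / c) ^ 3 ∧ μ ^ 2 ≤ 1.7 * (c' / c) ^ 2 ∧
      μ ^ 2 ≤ 1.42 * (c' / c) ^ 3 ∧ μ ^ 2 ≤ 1.3 * (c' / c) ^ 4 := by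
  have hc : 0 < c := by linarith
  -- For `μ² ≤ 1.1` the trivial bound `c'/c ≥ 1` suffices. Otherwise `μ² - 1` is bounded below, and
  -- the claim reduces to the extremal configuration `l = μ`, `a = 0`.
  rcases le_total (μ ^ 2) 1.1 with hμ2 | hμ2
  · have hQ : 1 ≤ c' / c := (one_le_div hc).mpr hcc
    have hμ1 : μ ≤ 1.05 := by nlinarith
    have hp : ∀ n : ℕ, 1 ≤ (c' / c) ^ n := fun n => one_le_pow₀ hQ
    refine ⟨?_, ?_, ?_, ?_, ?_⟩
    · linarith [hp 2]
    · linarith [hp 3]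
    · linarith [hp 2]
    · linarith [hp 3]
    · linarith [hp 4]
  · refine ratio_bounds_of_le hμ ?_
    rw [← mul_div_assoc, le_div_iff₀ hc]
    have hP : 1 ≤ l * μ := by nlinarith
    obtain ⟨d, rfl⟩ : ∃ d, l = μ + d := ⟨l - μ, by ring⟩
    have hd : 0 ≤ d := by linarith
    -- Since `c ≥ 1 + a`, the hypothesis `h1` makes `a` quadratically small in `d = l - μ`, whereas
    -- the gain over the case `l = μ` is linear in `d`.
    have h3 : a * (4 * ((μ + d) * μ) - 1) ≤ d ^ 2 := by nlinarith
    have h4 : (μ ^ 2 + 1) ^ 2 * a ≤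
        (μ ^ 2 - 1) * d * (3 * (μ + d) * μ ^ 2 + (μ + d) + 3 * μ + μ ^ 3) := by
      have h5 : 0 < 4 * ((μ + d) * μ) - 1 := by linarith
      refine le_of_mul_le_mul_right ?_ h5
      have h6 : (μ ^ 2 + 1) ^ 2 * d ≤ (μ ^ 2 - 1) *
          (3 * (μ + d) * μ ^ 2 + (μ + d) + 3 * μ + μ ^ 3) * (4 * ((μ + d) * μ) - 1) := by
        obtain ⟨y, hy⟩ : ∃ y, μ ^ 2 = 1.1 + y := ⟨μ ^ 2 - 1.1, by ring⟩
        have hy0 : 0 ≤ y := by linarith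
        have h7 : (μ ^ 2 - 1) * (3 * (μ + d) * μ ^ 2 + (μ + d) + 3 * μ + μ ^ 3) *
            (4 * ((μ + d) * μ) - 1) = (μ ^ 2 - 1) * (4 * (μ ^ 2 + 1) * (4 * μ ^ 2 - 1)) * μ +
              (μ ^ 2 - 1) * (28 * (μ ^ 2) ^ 2 + 17 * μ ^ 2 - 1) * d +
              (μ ^ 2 - 1) * (3 * μ ^ 2 + 1) * 4 * μ * d ^ 2 := by ring
        rw [h7, hy]
        have h8 : (1.1 + y + 1) ^ 2 ≤ (1.1 + y - 1) * (28 * (1.1 + y) ^ 2 + 17 * (1.1 + y) - 1) := by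
          have : 0 ≤ y ^ 2 := sq_nonneg y
          have : 0 ≤ y ^ 3 := by positivity
          nlinarith
        have h9 : 0 ≤ (1.1 + y - 1) * (4 * (1.1 + y + 1) * (4 * (1.1 + y) - 1)) * μ := by
          refine mul_nonneg (mul_nonneg ?_ (mul_nonneg ?_ ?_)) ?_ <;> linarith
        have h10 : 0 ≤ (1.1 + y - 1) * (3 * (1.1 + y) + 1) * 4 * μ * d ^ 2 := by
          refine mul_nonneg (mul_nonneg (mul_nonneg (mul_nonneg ?_ ?_) ?_) ?_) (sq_nonneg d) <;>
            linarith
        linarith [mul_le_mul_of_nonneg_right h8 hd]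
      have h7 : (μ ^ 2 + 1) ^ 2 * (a * (4 * ((μ + d) * μ) - 1)) ≤ (μ ^ 2 + 1) ^ 2 * d ^ 2 := by gcongr
      linarith [mul_le_mul_of_nonneg_right h6 hd]
    have h5 : 4 * μ ^ 2 * ((μ + d) * μ + 1) ^ 2 - (μ ^ 2 + 1) ^ 2 * (μ + d + μ) ^ 2 =
        (μ ^ 2 - 1) * d * (3 * (μ + d) * μ ^ 2 + (μ + d) + 3 * μ + μ ^ 3) := by ring
    have h6 : (μ ^ 2 + 1) ^ 2 * (4 * ((μ + d) * μ) * c) ≤ 4 * μ ^ 2 * (4 * ((μ + d) * μ) * c') := by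
      have h7 : (μ ^ 2 + 1) ^ 2 * (4 * ((μ + d) * μ) * c) ≤
          (μ ^ 2 + 1) ^ 2 * ((μ + d + μ) ^ 2 + a) := by gcongr
      have h8 : 4 * μ ^ 2 * ((μ + d) * μ + 1) ^ 2 ≤ 4 * μ ^ 2 * (4 * ((μ + d) * μ) * c') := by gcongr
      linarith
    have h9 : 0 < 4 * ((μ + d) * μ) := by linarith
    refine le_of_mul_le_mul_left ?_ h9
    linarith

lemma sum_fractions_le {m : ℝ} (hm : 1 ≤ m) :
    0.55 / (m + 1) + 0.3 / (m + 3) + 2.2 / (2 * m + 5) ≤ 2 / (m + 2) := by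
  obtain ⟨n, rfl⟩ : ∃ n, m = 1 + n := ⟨m - 1, by ring⟩
  have hn : 0 ≤ n := by linarith
  rw [← sub_nonneg]
  have h : 2 / (1 + n + 2) - (0.55 / (1 + n + 1) + 0.3 / (1 + n + 3) + 2.2 / (2 * (1 + n) + 5)) =
      (0.4 + 4.55 * n + 1.55 * n ^ 2 + 0.1 * n ^ 3) /
        ((1 + n + 2) * (1 + n + 1) * (1 + n + 3) * (2 * (1 + n) + 5)) := by
    field_simp
    ring
  rw [h]
  positivity

/-- Here `q = coth(r/4)`, `t = tanh(δ/2)`, `t' = tanh(δ'/2)` and `u = cosh²(δ/2)/cosh²(δ'/2)`; the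
small separation replaces `q` by at most `μ q`, and powers of `u` pay for the powers of `μ`. The
cases `k = 3` and `k = 4` leave few powers of `u` and need their own constants. -/
lemma cusp_inequality {k : ℕ} (hk : 3 ≤ k) {μ u t t' q : ℝ} (hq : 1 ≤ q) (hμ : 1 ≤ μ) (ht : 0 < t)
    (htt : t ≤ t') (ht1 : t' ≤ 1) (hu : 0 < u) (hu1 : u ≤ 1)
    (h : t' ^ 2 = 1 - (1 - t ^ 2) * u) (hqt : 2 * q ≤ (1 + q ^ 2) * t)
    (b1 : μ * u ^ 2 ≤ 1.14) (b2 : μ * u ^ 3 ≤ 1.1) (b3 : μ ^ 2 * u ^ 2 ≤ 1.7)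
    (b4 : μ ^ 2 * u ^ 3 ≤ 1.42) (b5 : μ ^ 2 * u ^ 4 ≤ 1.3) :
    4 * t' * (μ * q) * u ^ (k - 1) + (1 + (μ * q) ^ 2) / (k - 1) * u ^ (k - 1) +
        4 * (μ * q) / ((2 * k - 3) * t') * u ^ (k - 1) ≤
      t * q / 2 + 1 + 4 * t * q + (1 + q ^ 2) / (k - 1) + 2 * (1 + q ^ 2) / (k - 2) := by
  have hk' : (3 : ℝ) ≤ k := by exact_mod_cast hk
  obtain ⟨e, he⟩ : ∃ e, e = 1 + q ^ 2 := ⟨_, rfl⟩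
  have he2 : 2 * q ≤ e := by nlinarith [sq_nonneg (q - 1)]
  have he0 : 0 < e := by linarith
  have hk1 : (0 : ℝ) < k - 1 := by linarith
  have hk2 : (0 : ℝ) < k - 2 := by linarith
  have hk3 : (0 : ℝ) < 2 * k - 3 := by linarith
  have ht' : 0 < t' := by linarith
  have hU : 0 < u ^ (k - 1) := by positivity
  have c2 : (1 + (μ * q) ^ 2) / (k - 1) * u ^ (k - 1) ≤ e / (k - 1) * (μ ^ 2 * u ^ (k - 1)) := by
    have : 1 + (μ * q) ^ 2 ≤ e * μ ^ 2 := by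
      rw [he]
      nlinarith
    calc _ ≤ e * μ ^ 2 / (k - 1) * u ^ (k - 1) := by gcongr
      _ = _ := by ring
  have hqt' : 2 * q / t' ≤ e := by
    rw [div_le_iff₀ ht', he]
    nlinarith
  have hqt2 : q / t ≤ e / 2 := by
    rw [div_le_iff₀ ht, he]
    linarith
  have c3 : 4 * (μ * q) / ((2 * k - 3) * t') * u ^ (k - 1) ≤
      2 * e / (2 * k - 3) * (μ * u ^ (k - 1)) := by
    calc _ = 2 * (2 * q / t') / (2 * k - 3) * (μ * u ^ (k - 1)) := by
          field_simp
          ring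
      _ ≤ _ := by gcongr
  rw [← he]
  have htq : t * q ≤ q := by nlinarith
  refine (add_le_add (add_le_add le_rfl c2) c3).trans ?_
  rcases (by omega : k = 3 ∨ k = 4 ∨ 5 ≤ k) with rfl | rfl | hk5
  · have h1 : 4 * t' * (μ * q) * u ^ 2 ≤ 4 * 1.14 * q := by
      calc 4 * t' * (μ * q) * u ^ 2 = 4 * t' * (μ * u ^ 2) * q := by ring
        _ ≤ 4 * 1 * 1.14 * q := by gcongr
        _ = _ := by ring
    have h2 : e * (μ ^ 2 * u ^ 2) ≤ e * 1.7 := by gcongr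
    have h3 : e * (μ * u ^ 2) ≤ e * 1.14 := by gcongr
    have h4 : q ^ 2 * 2 ≤ e * (t * q) := by
      rw [he]
      nlinarith
    -- `0.89 = 5/2 - 1.7/2 - 2 * 1.14/3` is the coefficient of `e` that remains when `k = 3`.
    have h5 : 4.56 * q ≤ 0.89 * e + 4.5 * (t * q) := by
      have h6 : 4.56 * q * e ≤ (0.89 * e + 4.5 * (t * q)) * e := by
        nlinarith [sq_nonneg (0.89 * e - 3 * q), mul_pos he0 (by linarith : 0 < q), sq_nonneg q,
          sq_nonneg (e - 3 * q)]
      exact le_of_mul_le_mul_right h6 he0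
    norm_num
    linarith
  · have h0 := tanh_pow_le (m := 1) le_rfl ht hu hu1 h
    have h1 : 4 * t' * (μ * q) * u ^ 3 ≤ 4 * 1.14 * (t * q) + 0.285 * e := by
      have h2 : t' * u ^ 1 * q ≤ t * q + e / 16 := by
        calc t' * u ^ 1 * q ≤ (t + 1 / (4 * ((1 : ℕ) + 1) * t)) * q := by gcongr
          _ = t * q + q / t / 8 := by
              push_cast
              field_simp
              ring
          _ ≤ t * q + e / 2 / 8 := by gcongr
          _ = _ := by ring
      calc 4 * t' * (μ * q) * u ^ 3 = 4 * (μ * u ^ 2) * (t' * u ^ 1 * q) := by ring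
        _ ≤ 4 * 1.14 * (t * q + e / 16) := by gcongr
        _ = _ := by ring
    have h2 : e * (μ ^ 2 * u ^ 3) ≤ e * 1.42 := by gcongr
    have h3 : e * (μ * u ^ 3) ≤ e * 1.1 := by gcongr
    norm_num
    linarith
  · obtain ⟨m, hm, rfl⟩ : ∃ m, 1 ≤ m ∧ k = m + 4 := ⟨k - 4, by omega, by omega⟩
    have hm' : (1 : ℝ) ≤ m := by exact_mod_cast hm
    have h0 := tanh_pow_le hm ht hu hu1 h
    have e1 : u ^ (m + 4 - 1) = u ^ 3 * u ^ m := by rw [← pow_add]; congr 1; omega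
    have h1 : 4 * t' * (μ * q) * u ^ (m + 4 - 1) ≤ 4.4 * (t * q) + 0.55 * e / (m + 1) := by
      have h2 : t' * u ^ m * q ≤ t * q + e / (8 * (m + 1)) := by
        calc t' * u ^ m * q ≤ (t + 1 / (4 * (m + 1) * t)) * q := by gcongr
          _ = t * q + q / t / (4 * (m + 1)) := by field_simp
          _ ≤ t * q + e / 2 / (4 * (m + 1)) := by gcongr
          _ = _ := by
              field_simp
              ring
      calc 4 * t' * (μ * q) * u ^ (m + 4 - 1) = 4 * (μ * u ^ 3) * (t' * u ^ m * q) := by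
            rw [e1]
            ring
        _ ≤ 4 * 1.1 * (t * q + e / (8 * (m + 1))) := by gcongr
        _ = _ := by
            field_simp
            ring
    have h2 : μ ^ 2 * u ^ (m + 4 - 1) ≤ 1.3 := by
      refine le_trans ?_ b5
      have : u ^ (m + 4 - 1) ≤ u ^ 4 := pow_le_pow_of_le_one hu.le hu1 (by omega)
      gcongr
    have h3 : μ * u ^ (m + 4 - 1) ≤ 1.1 := by
      refine le_trans ?_ b2
      have : u ^ (m + 4 - 1) ≤ u ^ 3 := pow_le_pow_of_le_one hu.le hu1 (by omega)
      gcongr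
    have h4 : 0.55 / (m + 1) + 0.3 / (m + 3) + 2.2 / (2 * m + 5) ≤ (2 : ℝ) / (m + 2) :=
      sum_fractions_le hm'
    have h5 : e / (m + 3) * (μ ^ 2 * u ^ (m + 4 - 1)) ≤ e / (m + 3) * 1.3 := by gcongr
    have h6 : 2 * e / (2 * m + 5) * (μ * u ^ (m + 4 - 1)) ≤ 2 * e / (2 * m + 5) * 1.1 := by gcongr
    have h7 := mul_le_mul_of_nonneg_left h4 he0.le
    have g1 : (((m + 4 : ℕ) : ℝ) - 1) = m + 3 := by push_cast; ring
    have g2 : (((m + 4 : ℕ) : ℝ) - 2) = m + 2 := by push_cast; ring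
    have g3 : (2 * ((m + 4 : ℕ) : ℝ) - 3) = 2 * m + 5 := by push_cast; ring
    rw [g1, g2, g3]
    have g4 : e * (0.55 / (m + 1) + 0.3 / (m + 3) + 2.2 / (2 * m + 5)) = 0.55 * e / (m + 1) +
      0.3 * (e / (m + 3)) + 1.1 * (2 * e / (2 * m + 5)) := by ring
    have g5 : e * (2 / (m + 2)) = 2 * e / (m + 2) := by ring
    have g6 : 0 < t * q := by positivity
    linarith

lemma coth_sq_sub_one {x : ℝ} (hx : 0 < x) :
    1 / Real.sinh x ^ 2 = (Real.cosh x / Real.sinh x) ^ 2 - 1 := by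
  have h := Real.sinh_pos_iff.mpr hx
  rw [div_pow, Real.cosh_sq]
  field_simp
  ring

lemma sinh_div_cosh_le {a b : ℝ} (h : a ≤ b) :
    Real.sinh a / Real.cosh a ≤ Real.sinh b / Real.cosh b := by
  rw [div_le_div_iff₀ (Real.cosh_pos a) (Real.cosh_pos b)]
  have := Real.sinh_nonneg_iff.mpr (sub_nonneg.mpr h)
  rw [Real.sinh_sub] at this
  linarith

lemma one_le_coth {x : ℝ} (hx : 0 < x) : 1 ≤ Real.cosh x / Real.sinh x :=
  (one_le_div (Real.sinh_pos_iff.mpr hx)).mpr (Real.sinh_lt_cosh x).le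

lemma half_coth_le {x : ℝ} (hx : 0 < x) :
    Real.cosh x / Real.sinh x / 2 ≤ Real.cosh (2 * x) / Real.sinh (2 * x) := by
  have h := Real.sinh_pos_iff.mpr hx
  have h' := Real.cosh_pos x
  rw [Real.cosh_two_mul, Real.sinh_two_mul, div_div, div_le_div_iff₀ (by positivity) (by positivity)]
  nlinarith [pow_pos h 3]

/-- Rewriting in `tanh(δ/2)` and `coth(s/4)`, with one common power of `cosh(δ/2)`, puts the bound
in the form of `cusp_inequality`. -/
lemma packingBound_eq {k : ℕ} (hk : 3 ≤ k) {δ s : ℝ} (hδ : 0 < δ) (hs : 0 < s) :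
    packingBound k δ s = (4 * (Real.sinh (δ / 2) / Real.cosh (δ / 2)) *
        (Real.cosh (s / 4) / Real.sinh (s / 4)) +
      (1 + (Real.cosh (s / 4) / Real.sinh (s / 4)) ^ 2) / (k - 1) +
      4 * (Real.cosh (s / 4) / Real.sinh (s / 4)) /
        ((2 * k - 3) * (Real.sinh (δ / 2) / Real.cosh (δ / 2)))) *
      (Real.cosh (δ / 2) ^ (2 * k - 2))⁻¹ := by
  have hk' : (3 : ℝ) ≤ k := by exact_mod_cast hk
  have h1 : (k - 1 : ℝ) ≠ 0 := by linarith
  have h3 : (2 * k - 3 : ℝ) ≠ 0 := by linarith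
  have hS := Real.sinh_pos_iff.mpr (by linarith : 0 < δ / 2)
  have hC := Real.cosh_pos (δ / 2)
  have hs4 := Real.sinh_pos_iff.mpr (by linarith : 0 < s / 4)
  unfold packingBound
  rw [coth_sq_sub_one (by linarith : 0 < s / 4),
    show Real.sinh δ = 2 * Real.sinh (δ / 2) * Real.cosh (δ / 2) by
      rw [← Real.sinh_two_mul]
      congr 1
      ring,
    show Real.cosh (δ / 2) ^ (2 * k) = Real.cosh (δ / 2) ^ (2 * k - 3) * Real.cosh (δ / 2) ^ 3 by
      rw [← pow_add]
      congr 1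
      omega,
    show Real.cosh (δ / 2) ^ (2 * k - 2) = Real.cosh (δ / 2) ^ (2 * k - 3) * Real.cosh (δ / 2) by
      rw [← pow_succ]
      congr 1
      omega, show (2 * k - 2 : ℝ) = 2 * (k - 1) by ring]
  generalize Real.cosh (s / 4) / Real.sinh (s / 4) = q
  field_simp
  ring

/-- The first two terms agree exactly. For the third, `1 + coth²(r/4) = cosh(r/2)/sinh²(r/4)`, and
`cosh(r/2) ≤ cosh²(δ/2)`. -/
lemma le_mainTerms {k : ℕ} (hk : 3 ≤ k) {δ r : ℝ} (hr : 0 < r) (hδ : r ≤ δ) :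
    (4 * (Real.sinh (δ / 2) / Real.cosh (δ / 2)) * (Real.cosh (r / 4) / Real.sinh (r / 4)) +
      (1 + (Real.cosh (r / 4) / Real.sinh (r / 4)) ^ 2) / (k - 1) +
      2 * (1 + (Real.cosh (r / 4) / Real.sinh (r / 4)) ^ 2) / (k - 2)) *
        (Real.cosh (δ / 2) ^ (2 * k - 2))⁻¹ ≤ mainTerms k δ r := by
  have hk' : (3 : ℝ) ≤ k := by exact_mod_cast hk
  have h1 : (0 : ℝ) < k - 1 := by linarith
  have h2 : (0 : ℝ) < k - 2 := by linarith
  have hC := Real.cosh_pos (δ / 2)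
  have hC1 := Real.one_le_cosh (δ / 2)
  have hs4 := Real.sinh_pos_iff.mpr (by linarith : 0 < r / 4)
  have hc4 := Real.cosh_pos (r / 4)
  have hq : 1 + (Real.cosh (r / 4) / Real.sinh (r / 4)) ^ 2 ≤
      Real.cosh (δ / 2) ^ 2 * (1 / Real.sinh (r / 4) ^ 2) := by
    have h3 : Real.cosh (r / 2) ≤ Real.cosh (δ / 2) := by
      rw [Real.cosh_le_cosh, abs_of_pos (by linarith), abs_of_pos (by linarith)]
      linarith
    have h4 : Real.cosh (r / 2) = Real.sinh (r / 4) ^ 2 + Real.cosh (r / 4) ^ 2 := by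
      rw [add_comm, ← Real.cosh_two_mul]
      congr 1
      ring
    have h5 : 1 + (Real.cosh (r / 4) / Real.sinh (r / 4)) ^ 2 =
        Real.cosh (r / 2) * (1 / Real.sinh (r / 4) ^ 2) := by
      rw [h4]
      field_simp
    rw [h5]
    gcongr
    nlinarith
  unfold mainTerms
  rw [show Real.sinh δ = 2 * Real.sinh (δ / 2) * Real.cosh (δ / 2) by
      rw [← Real.sinh_two_mul]
      congr 1
      ring,
    show Real.cosh (δ / 2) ^ (2 * k) = Real.cosh (δ / 2) ^ (2 * k - 4) * Real.cosh (δ / 2) ^ 4 by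
      rw [← pow_add]
      congr 1
      omega,
    show Real.cosh (δ / 2) ^ (2 * k - 2) = Real.cosh (δ / 2) ^ (2 * k - 4) * Real.cosh (δ / 2) ^ 2 by
      rw [← pow_add]
      congr 1
      omega, show (2 * k - 2 : ℝ) = 2 * (k - 1) by ring, show (2 * k - 4 : ℝ) = 2 * (k - 2) by ring,
    add_mul, add_mul]
  refine add_le_add (le_of_eq ?_) ?_
  · rw [coth_sq_sub_one (by linarith : 0 < r / 4)]
    generalize Real.cosh (r / 4) / Real.sinh (r / 4) = q
    field_simp
    ring
  · calc _ ≤ 2 * (Real.cosh (δ / 2) ^ 2 * (1 / Real.sinh (r / 4) ^ 2)) / (k - 2) *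
          (Real.cosh (δ / 2) ^ (2 * k - 4) * Real.cosh (δ / 2) ^ 2)⁻¹ := by gcongr
      _ = _ := by
          field_simp
          ring

/-- `sinh(δ+r)/sinh r = sinh δ coth r + cosh δ`, where `coth r ≥ coth(r/4)/4` by halving twice and
`cosh δ ≥ cosh²(δ/2)`. -/
lemma le_first_term {k : ℕ} (hk : 3 ≤ k) {δ r : ℝ} (hr : 0 < r) (hδ : r ≤ δ) :
    (Real.sinh (δ / 2) / Real.cosh (δ / 2) * (Real.cosh (r / 4) / Real.sinh (r / 4)) / 2 + 1) *
      (Real.cosh (δ / 2) ^ (2 * k - 2))⁻¹ ≤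
        Real.sinh (δ + r) / (Real.sinh r * Real.cosh ((δ - r) / 2) ^ (2 * k)) := by
  have hC := Real.cosh_pos (δ / 2)
  have hC1 := Real.one_le_cosh (δ / 2)
  have hD := Real.cosh_pos ((δ - r) / 2)
  have hsr := Real.sinh_pos_iff.mpr hr
  have hS := Real.sinh_pos_iff.mpr (by linarith : 0 < δ / 2)
  have hDC : Real.cosh ((δ - r) / 2) ≤ Real.cosh (δ / 2) := by
    rw [Real.cosh_le_cosh, abs_of_nonneg (by linarith), abs_of_pos (by linarith)]
    linarith
  have hq : Real.cosh (r / 4) / Real.sinh (r / 4) / 4 ≤ Real.cosh r / Real.sinh r := by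
    have h1 := half_coth_le (by linarith : 0 < r / 4)
    have h2 := half_coth_le (by linarith : 0 < r / 2)
    rw [show 2 * (r / 4) = r / 2 by ring] at h1
    rw [show 2 * (r / 2) = r by ring] at h2
    linarith
  have h1 : Real.sinh (δ + r) / Real.sinh r = Real.sinh δ * (Real.cosh r / Real.sinh r) +
      Real.cosh δ := by
    rw [Real.sinh_add]
    field_simp
  have h2 : Real.sinh δ = 2 * Real.sinh (δ / 2) * Real.cosh (δ / 2) := by
    rw [← Real.sinh_two_mul]
    congr 1
    ring
  have h3 : Real.cosh δ = Real.cosh (δ / 2) ^ 2 + Real.sinh (δ / 2) ^ 2 := by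
    rw [← Real.cosh_two_mul]
    congr 1
    ring
  have h0 : 0 ≤ Real.sinh (δ + r) / Real.sinh r :=
    div_nonneg (Real.sinh_nonneg_iff.mpr (by linarith)) hsr.le
  calc _ = (2 * Real.sinh (δ / 2) * Real.cosh (δ / 2) *
        (Real.cosh (r / 4) / Real.sinh (r / 4) / 4) + Real.cosh (δ / 2) ^ 2) *
        (Real.cosh (δ / 2) ^ (2 * k))⁻¹ := by
        rw [show Real.cosh (δ / 2) ^ (2 * k) =
          Real.cosh (δ / 2) ^ (2 * k - 2) * Real.cosh (δ / 2) ^ 2 by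
            rw [← pow_add]
            congr 1
            omega]
        generalize Real.cosh (r / 4) / Real.sinh (r / 4) = q
        field_simp
        ring
    _ ≤ (Real.sinh (δ + r) / Real.sinh r) * (Real.cosh (δ / 2) ^ (2 * k))⁻¹ := by
        rw [h1, h2, h3]
        gcongr
        nlinarith
    _ ≤ (Real.sinh (δ + r) / Real.sinh r) * (Real.cosh ((δ - r) / 2) ^ (2 * k))⁻¹ := by
        gcongr
    _ = _ := by
        rw [div_mul_eq_div_div, div_eq_mul_inv _ (Real.cosh ((δ - r) / 2) ^ (2 * k))]

lemma packingBound_nonneg {k : ℕ} (hk : 3 ≤ k) {δ s : ℝ} (hδ : 0 < δ) (hs : 0 < s) :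
    0 ≤ packingBound k δ s := by
  have hk' : (3 : ℝ) ≤ k := by exact_mod_cast hk
  have h1 : (0 : ℝ) < k - 1 := by linarith
  have h3 : (0 : ℝ) < 2 * k - 3 := by linarith
  have hS := Real.sinh_pos_iff.mpr (by linarith : 0 < δ / 2)
  have hC := Real.cosh_pos (δ / 2)
  have hs4 := Real.sinh_pos_iff.mpr (by linarith : 0 < s / 4)
  have hc4 := Real.cosh_pos (s / 4)
  rw [packingBound_eq hk hδ hs]
  positivity

/-- The contribution of the points of an orbit in a cusp, which are close to each other there but
far away from the other points. -/
theorem packingBound_le_of_cusp {k : ℕ} (hk : 3 ≤ k) {δ δ' r s μ l : ℝ} (hr : 0 < r) (hδ : r ≤ δ)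
    (hδ' : δ ≤ δ') (hs : 0 < s) (hsr : s ≤ r) (hμ : 1 ≤ μ) (hl : μ ≤ l)
    (hμs : μ * Real.sinh (s / 2) = Real.sinh (r / 2))
    (h1 : 4 * (l * μ) * Real.cosh (δ / 2) ^ 2 ≤ (l + μ) ^ 2 + Real.sinh (r / 2) ^ 2)
    (h2 : (l * μ + 1) ^ 2 ≤ 4 * (l * μ) * Real.cosh (δ' / 2) ^ 2) :
    packingBound k δ' s ≤
      Real.sinh (δ + r) / (Real.sinh r * Real.cosh ((δ - r) / 2) ^ (2 * k)) + mainTerms k δ r := by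
  have hk' : (3 : ℝ) ≤ k := by exact_mod_cast hk
  have hk1 : (0 : ℝ) < k - 1 := by linarith
  have hk3 : (0 : ℝ) < 2 * k - 3 := by linarith
  refine le_trans ?_ (add_le_add (le_first_term hk hr hδ) (le_mainTerms hk hr hδ))
  rw [packingBound_eq hk (by linarith) hs, ← add_mul]
  have hC := Real.cosh_pos (δ / 2)
  have hC' := Real.cosh_pos (δ' / 2)
  have hS := Real.sinh_pos_iff.mpr (by linarith : 0 < δ / 2)
  have hS' := Real.sinh_pos_iff.mpr (by linarith : 0 < δ' / 2)
  have hCC : Real.cosh (δ / 2) ≤ Real.cosh (δ' / 2) := by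
    rw [Real.cosh_le_cosh, abs_of_pos (by linarith), abs_of_pos (by linarith)]
    linarith
  have hrC : Real.cosh (r / 2) ≤ Real.cosh (δ / 2) := by
    rw [Real.cosh_le_cosh, abs_of_pos (by linarith), abs_of_pos (by linarith)]
    linarith
  have hsrC : Real.cosh (s / 2) ≤ Real.cosh (r / 2) := by
    rw [Real.cosh_le_cosh, abs_of_pos (by linarith), abs_of_pos (by linarith)]
    linarith
  have hdouble : ∀ x : ℝ, 0 < x → Real.cosh (x / 4) / Real.sinh (x / 4) =
      (Real.cosh (x / 2) + 1) / Real.sinh (x / 2) := fun x hx => by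
    have h := Real.sinh_pos_iff.mpr (by linarith : 0 < x / 4)
    have h' := Real.cosh_pos (x / 4)
    rw [show x / 2 = 2 * (x / 4) by ring, Real.cosh_two_mul, Real.sinh_two_mul, Real.cosh_sq]
    field_simp
    rw [Real.cosh_sq]
    ring
  -- By `coth(x/4) = (cosh(x/2) + 1)/sinh(x/2)`, shrinking `sinh(r/2)` by the factor `μ` enlarges
  -- the hyperbolic cotangent by at most `μ`.
  have hqs : Real.cosh (s / 4) / Real.sinh (s / 4) ≤
      μ * (Real.cosh (r / 4) / Real.sinh (r / 4)) := by
    have h := Real.sinh_pos_iff.mpr (by linarith : 0 < s / 2)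
    rw [hdouble s hs, hdouble r hr, ← hμs]
    have : μ * ((Real.cosh (r / 2) + 1) / (μ * Real.sinh (s / 2))) =
        (Real.cosh (r / 2) + 1) / Real.sinh (s / 2) := by
      field_simp
    rw [this]
    gcongr
  have hqs0 : 0 < Real.cosh (s / 4) / Real.sinh (s / 4) :=
    zero_lt_one.trans_le (one_le_coth (by linarith))
  have hq1 := one_le_coth (by linarith : 0 < r / 4)
  -- With `q = coth(r/4)` one has `tanh(r/2) = 2q/(1+q²)`, and `r ≤ δ`.
  have hqt : 2 * (Real.cosh (r / 4) / Real.sinh (r / 4)) ≤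
      (1 + (Real.cosh (r / 4) / Real.sinh (r / 4)) ^ 2) *
        (Real.sinh (δ / 2) / Real.cosh (δ / 2)) := by
    have h3 : Real.sinh (r / 2) / Real.cosh (r / 2) ≤ Real.sinh (δ / 2) / Real.cosh (δ / 2) :=
      sinh_div_cosh_le (by linarith)
    have h := Real.sinh_pos_iff.mpr (by linarith : 0 < r / 4)
    have h' := Real.cosh_pos (r / 4)
    refine le_trans (le_of_eq ?_) (mul_le_mul_of_nonneg_left h3 (by positivity))
    rw [show r / 2 = 2 * (r / 4) by ring, Real.cosh_two_mul, Real.sinh_two_mul]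
    field_simp
    ring
  have htt : Real.sinh (δ / 2) / Real.cosh (δ / 2) ≤ Real.sinh (δ' / 2) / Real.cosh (δ' / 2) :=
    sinh_div_cosh_le (by linarith)
  have ht0 : 0 < Real.sinh (δ / 2) / Real.cosh (δ / 2) := by positivity
  have ht'1 : Real.sinh (δ' / 2) / Real.cosh (δ' / 2) ≤ 1 :=
    (div_le_one hC').mpr (Real.sinh_lt_cosh _).le
  obtain ⟨u, hu⟩ : ∃ u, u = Real.cosh (δ / 2) ^ 2 / Real.cosh (δ' / 2) ^ 2 := ⟨_, rfl⟩
  have hu0 : 0 < u := by rw [hu]; positivity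
  have hu1 : u ≤ 1 := by
    rw [hu, div_le_one (by positivity)]
    gcongr
  have ht' : (Real.sinh (δ' / 2) / Real.cosh (δ' / 2)) ^ 2 =
      1 - (1 - (Real.sinh (δ / 2) / Real.cosh (δ / 2)) ^ 2) * u := by
    rw [hu, div_pow, div_pow, Real.sinh_sq, Real.sinh_sq]
    field_simp
    ring
  obtain ⟨b1, b2, b3, b4, b5⟩ := ratio_bounds hμ hl (sq_nonneg (Real.sinh (r / 2)))
    (by
      rw [Real.sinh_sq]
      have := Real.cosh_pos (r / 2)
      gcongr) (by gcongr : Real.cosh (δ / 2) ^ 2 ≤ Real.cosh (δ' / 2) ^ 2) h1 h2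
  have hQ : Real.cosh (δ' / 2) ^ 2 / Real.cosh (δ / 2) ^ 2 = u⁻¹ := by rw [hu, inv_div]
  simp only [hQ, inv_pow, ← div_eq_mul_inv] at b1 b2 b3 b4 b5
  rw [le_div_iff₀ (by positivity)] at b1 b2 b3 b4 b5
  have key := cusp_inequality hk hq1 hμ ht0 htt ht'1 hu0 hu1 ht' hqt b1 b2 b3 b4 b5
  have hpow : (Real.cosh (δ' / 2) ^ (2 * k - 2))⁻¹ =
      u ^ (k - 1) * (Real.cosh (δ / 2) ^ (2 * k - 2))⁻¹ := by
    rw [hu, div_pow, ← pow_mul, ← pow_mul, show 2 * (k - 1) = 2 * k - 2 by omega]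
    field_simp
  rw [hpow, ← mul_assoc]
  refine mul_le_mul_of_nonneg_right (le_trans ?_ (key.trans (le_of_eq (by ring))))
    (by positivity)
  rw [add_mul, add_mul]
  have := ht0.trans_le htt
  gcongr

/-! ### The sum over integer translates. -/

lemma integrable_inv_one_add_sq_pow {k : ℕ} (hk : 1 ≤ k) :
    Integrable fun t : ℝ => ((1 + t ^ 2) ^ k)⁻¹ := by
  refine integrable_inv_one_add_sq.mono' (by
    refine Continuous.aestronglyMeasurable (Continuous.inv₀ (by fun_prop) fun t => ?_)
    positivity) (Filter.Eventually.of_forall fun t => ?_)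
  rw [Real.norm_of_nonneg (by positivity)]
  refine inv_anti₀ (by positivity) (le_self_pow₀ ?_ (by omega))
  nlinarith [sq_nonneg t]

lemma tendsto_mul_inv_one_add_sq_pow {k : ℕ} (hk : 1 ≤ k) :
    Filter.Tendsto (fun t : ℝ => t * ((1 + t ^ 2) ^ k)⁻¹) (Filter.cocompact ℝ) (nhds 0) := by
  refine squeeze_zero_norm (a := fun t : ℝ => ‖t‖⁻¹) (fun t => ?_)
    (tendsto_inv_atTop_zero.comp tendsto_norm_cocompact_atTop)
  rcases eq_or_ne t 0 with rfl | ht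
  · simp
  · have h1 : 0 < |t| := abs_pos.mpr ht
    have h2 : 1 + t ^ 2 ≤ (1 + t ^ 2) ^ k := le_self_pow₀ (by nlinarith [sq_nonneg t]) (by omega)
    rw [norm_mul, Real.norm_eq_abs, Real.norm_of_nonneg (by positivity), ← div_eq_mul_inv,
      div_le_iff₀ (by positivity), inv_mul_eq_div, le_div_iff₀ h1, abs_mul_abs_self]
    nlinarith

/-- Integrating the derivative of `t (1+t²)^(-k)` over the line gives the recursion `2k I(k+1) =
(2k-1) I(k)`, matching that of the Gamma quotient. -/
lemma integral_inv_one_add_sq_pow {k : ℕ} (hk : 1 ≤ k) :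
    ∫ t : ℝ, ((1 + t ^ 2) ^ k)⁻¹ = √Real.pi * (Real.Gamma (k - 1 / 2) / Real.Gamma k) := by
  induction k, hk using Nat.le_induction with
  | base =>
    simp only [pow_one]
    rw [integral_univ_inv_one_add_sq]
    norm_num
    rw [Real.Gamma_one_half_eq, Real.mul_self_sqrt Real.pi_pos.le]
  | succ k hk ih =>
    have hk0 : (1 : ℝ) ≤ k := by exact_mod_cast hk
    have hi := integrable_inv_one_add_sq_pow hk
    have hi' := integrable_inv_one_add_sq_pow (by omega : 1 ≤ k + 1)
    have hd : ∀ t : ℝ, HasDerivAt (fun t : ℝ => t * ((1 + t ^ 2) ^ k)⁻¹)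
        ((1 - 2 * (k : ℝ)) * ((1 + t ^ 2) ^ k)⁻¹ + 2 * (k : ℝ) * ((1 + t ^ 2) ^ (k + 1))⁻¹) t := fun t => by
      have h0 : (1 + t ^ 2) ≠ 0 := by positivity
      have h1 : HasDerivAt (fun t : ℝ => (1 + t ^ 2) ^ k)
          (k * (1 + t ^ 2) ^ (k - 1) * (2 * t)) t := by
        have h2 : HasDerivAt (fun t : ℝ => 1 + t ^ 2) (2 * t) t := by
          simpa using (hasDerivAt_pow 2 t).const_add 1
        exact h2.pow k
      refine ((hasDerivAt_id t).mul (h1.inv (pow_ne_zero k h0))).congr_deriv ?_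
      obtain ⟨m, rfl⟩ : ∃ m, k = m + 1 := ⟨k - 1, by omega⟩
      simp only [id, Nat.add_sub_cancel, Pi.inv_apply]
      field_simp
      ring
    have hint : Integrable fun t : ℝ =>
        (1 - 2 * (k : ℝ)) * ((1 + t ^ 2) ^ k)⁻¹ + 2 * (k : ℝ) * ((1 + t ^ 2) ^ (k + 1))⁻¹ :=
      (hi.const_mul _).add (hi'.const_mul _)
    have ht := tendsto_mul_inv_one_add_sq_pow hk
    rw [cocompact_eq_atBot_atTop] at ht
    have h := integral_of_hasDerivAt_of_tendsto hd hint (ht.mono_left le_sup_left)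
      (ht.mono_left le_sup_right)
    rw [integral_add (hi.const_mul _) (hi'.const_mul _), integral_const_mul, integral_const_mul,
      ih] at h
    have hG : Real.Gamma ((k + 1 : ℕ) - 1 / 2) = (k - 1 / 2) * Real.Gamma (k - 1 / 2) := by
      rw [← Real.Gamma_add_one (by linarith)]
      congr 1
      push_cast
      ring
    have hG' : Real.Gamma ((k + 1 : ℕ)) = k * Real.Gamma k := by
      rw [← Real.Gamma_add_one (by linarith)]
      congr 1
      push_cast
      ring
    have hGp : 0 < Real.Gamma k := Real.Gamma_pos_of_pos (by linarith)
    rw [hG, hG']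
    have h3 : ∫ t : ℝ, ((1 + t ^ 2) ^ (k + 1))⁻¹ = (2 * k - 1) / (2 * k) *
        (√Real.pi * (Real.Gamma (k - 1 / 2) / Real.Gamma k)) := by
      field_simp
      field_simp at h
      linarith
    rw [h3]
    field_simp

/-- Comparison of a sum over the integers with an integral, for a function of the distance to a
given point. -/
lemma tsum_int_le {φ : ℝ → ENNReal} (hφ : ∀ s t, |s| ≤ |t| → φ t ≤ φ s) (b : ℝ) :
    ∑' n : ℤ, φ (b - n) ≤ φ (b - round b) + 2 * ∫⁻ t, φ (b - t) := by
  rw [ENNReal.tsum_eq_add_tsum_ite (round b)]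
  gcongr
  have hdisj := Set.pairwise_disjoint_Ioo_add_intCast (-(1 / 2) : ℝ)
  have hterm : ∀ n : ℤ, (if n = round b then 0 else φ (b - n)) ≤
      2 * ∫⁻ t in Set.Ioo (-(1 / 2) + (n : ℝ)) (-(1 / 2) + n + 1), φ (b - t) := fun n => by
    split_ifs with hn
    · exact zero_le
    have h1 : 1 / 2 ≤ |b - n| := by
      have h2 : (1 : ℝ) ≤ |(n : ℝ) - round b| := by
        exact_mod_cast Int.one_le_abs (sub_ne_zero.mpr hn)
      have h3 := abs_sub_round b
      have h4 := abs_sub_le (n : ℝ) b (round b)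
      rw [abs_sub_comm (n : ℝ) b] at h4
      linarith
    -- The half of the unit interval around `n` that faces `b`: there `φ (b - t)` dominates `φ (b -
    -- n)`, and its length `1/2` is the source of the factor `2`.
    obtain ⟨c, hc, hcb⟩ : ∃ c : ℝ, Set.Ioo c (c + 1 / 2) ⊆
        Set.Ioo (-(1 / 2) + (n : ℝ)) (-(1 / 2) + n + 1) ∧
        ∀ t ∈ Set.Ioo c (c + 1 / 2), |b - t| ≤ |b - n| := by
      rcases le_abs.mp h1 with h2 | h2
      · refine ⟨n, Set.Ioo_subset_Ioo (by linarith) (by linarith), fun t ht => ?_⟩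
        rw [abs_of_nonneg (by linarith [ht.2]), abs_of_nonneg (by linarith)]
        linarith [ht.1]
      · refine ⟨n - 1 / 2, Set.Ioo_subset_Ioo (by linarith) (by linarith), fun t ht => ?_⟩
        rw [abs_of_nonpos (by linarith [ht.1]), abs_of_nonpos (by linarith)]
        linarith [ht.2]
    calc φ (b - n) = 2 * ∫⁻ _ in Set.Ioo c (c + 1 / 2), φ (b - n) := by
          rw [setLIntegral_const, Real.volume_Ioo, add_sub_cancel_left, mul_left_comm,
            show (2 : ENNReal) = ENNReal.ofReal 2 by simp, ← ENNReal.ofReal_mul zero_le_two]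
          norm_num
      _ ≤ 2 * ∫⁻ t in Set.Ioo c (c + 1 / 2), φ (b - t) := by
          gcongr 2 * ?_
          exact setLIntegral_mono' measurableSet_Ioo fun t ht => hφ _ _ (hcb t ht)
      _ ≤ _ := by gcongr
  refine (ENNReal.tsum_le_tsum fun n => le_of_eq_of_le (by congr) (hterm n)).trans ?_
  rw [ENNReal.tsum_mul_left, ← lintegral_iUnion (fun n => measurableSet_Ioo) hdisj]
  gcongr
  exact Measure.restrict_le_self

lemma lintegral_cauchy_pow {k : ℕ} (hk : 1 ≤ k) {c Y : ℝ} (hc : 0 ≤ c) (hY : 0 < Y) (b : ℝ) :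
    ∫⁻ t : ℝ, ENNReal.ofReal (c ^ k * (((b - t) ^ 2 + Y ^ 2) ^ k)⁻¹) =
      ENNReal.ofReal ((c / Y ^ 2) ^ k * Y * (√Real.pi * (Real.Gamma (k - 1 / 2) / Real.Gamma k))) := by
  have h1 : ∀ t : ℝ, c ^ k * ((t ^ 2 + Y ^ 2) ^ k)⁻¹ =
      (c / Y ^ 2) ^ k * ((1 + (t / Y) ^ 2) ^ k)⁻¹ := fun t => by
    rw [← inv_pow, ← inv_pow, ← mul_pow, ← mul_pow]
    congr 1
    field_simp
    ring
  have hi : Integrable fun t : ℝ => c ^ k * ((t ^ 2 + Y ^ 2) ^ k)⁻¹ := by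
    simp_rw [h1]
    exact ((integrable_inv_one_add_sq_pow hk).comp_div hY.ne').const_mul _
  rw [← ofReal_integral_eq_lintegral_ofReal (f := fun t => c ^ k * (((b - t) ^ 2 + Y ^ 2) ^ k)⁻¹)
    (hi.comp_sub_left b) (Filter.Eventually.of_forall fun t => by positivity),
    integral_sub_left_eq_self (fun t => c ^ k * ((t ^ 2 + Y ^ 2) ^ k)⁻¹)]
  congr 1
  simp_rw [h1]
  rw [integral_const_mul, Measure.integral_comp_div (fun t => ((1 + t ^ 2) ^ k)⁻¹),
    integral_inv_one_add_sq_pow hk, abs_of_pos hY, smul_eq_mul]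
  ring

lemma inv_cosh_dist_vadd (k : ℕ) (z w : ℍ) (n : ℝ) :
    (Real.cosh (dist z (n +ᵥ w) / 2) ^ (2 * k))⁻¹ = (4 * (z.im * w.im)) ^ k *
      (((z.re - w.re - n) ^ 2 + (z.im + w.im) ^ 2) ^ k)⁻¹ := by
  rw [pow_mul, cosh_half_dist_sq, div_pow, inv_div, div_eq_mul_inv]
  congr 3
  · simp
  · rw [← Complex.normSq_eq_norm_sq, Complex.normSq_apply]
    simp
    ring

/-- The sum over the translates of a point by integers. -/
lemma tsum_translates_le {k : ℕ} (hk : 1 ≤ k) {z w : ℍ} {δ : ℝ} (hδ : 0 ≤ δ)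
    (h : ∀ n : ℤ, δ ≤ dist z ((n : ℝ) +ᵥ w)) :
    ∑' n : ℤ, ENNReal.ofReal (Real.cosh (dist z ((n : ℝ) +ᵥ w) / 2) ^ (2 * k))⁻¹ ≤
      ENNReal.ofReal ((Real.cosh (δ / 2) ^ (2 * k))⁻¹ +
        4 * √Real.pi * √(z.im * w.im) * (Real.Gamma (k - 1 / 2) / Real.Gamma k)) := by
  have hz := z.im_pos
  have hw := w.im_pos
  have hk' : (1 : ℝ) ≤ k := by exact_mod_cast hk
  have hG : 0 ≤ Real.Gamma (k - 1 / 2) / Real.Gamma k :=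
    div_nonneg (Real.Gamma_pos_of_pos (by linarith)).le (Real.Gamma_pos_of_pos (by linarith)).le
  have hmono := tsum_int_le (φ := fun t => ENNReal.ofReal ((4 * (z.im * w.im)) ^ k *
      ((t ^ 2 + (z.im + w.im) ^ 2) ^ k)⁻¹)) (fun s t hst => by
        have := sq_le_sq.mpr hst
        gcongr) (z.re - w.re)
  simp_rw [inv_cosh_dist_vadd]
  refine hmono.trans ?_
  rw [lintegral_cauchy_pow hk (by positivity) (by positivity), ENNReal.ofReal_add
    (by have := Real.cosh_pos (δ / 2); positivity) (by positivity)]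
  refine add_le_add ?_ ?_
  · rw [← inv_cosh_dist_vadd]
    exact ENNReal.ofReal_le_ofReal (inv_cosh_half_pow_anti _ hδ (h _))
  · rw [show (2 : ENNReal) = ENNReal.ofReal 2 by simp, ← ENNReal.ofReal_mul zero_le_two]
    refine ENNReal.ofReal_le_ofReal ?_
    set ρ := 4 * (z.im * w.im) / (z.im + w.im) ^ 2 with hρ
    have hρ0 : 0 ≤ ρ := by positivity
    have hρ1 : ρ ≤ 1 := by
      rw [hρ, div_le_one (by positivity)]
      nlinarith [sq_nonneg (z.im - w.im)]
    have h1 : √(z.im * w.im) = √ρ * ((z.im + w.im) / 2) := by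
      rw [Real.sqrt_eq_iff_mul_self_eq (by positivity) (by positivity)]
      have := Real.mul_self_sqrt hρ0
      symm
      calc _ = (√ρ * √ρ) * (z.im + w.im) ^ 2 / 4 := by ring
        _ = _ := by
          rw [this, hρ]
          field_simp
    have h2 : ρ ^ k ≤ √ρ := by
      refine (pow_le_of_le_one hρ0 hρ1 (by omega)).trans ?_
      exact Real.le_sqrt_of_sq_le (by nlinarith)
    have h3 : ρ ^ k * (z.im + w.im) ≤ √ρ * (z.im + w.im) := by gcongr
    rw [h1]
    calc _ = 2 * √Real.pi * (Real.Gamma (k - 1 / 2) / Real.Gamma k) * (ρ ^ k * (z.im + w.im)) := by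
          ring
      _ ≤ 2 * √Real.pi * (Real.Gamma (k - 1 / 2) / Real.Gamma k) * (√ρ * (z.im + w.im)) := by gcongr
      _ = _ := by ring

/-! ### Geometry of the cusp. -/

lemma cosh_half_dist_vadd_sq (z w : ℍ) (n : ℝ) : Real.cosh (dist z (n +ᵥ w) / 2) ^ 2 =
    ((z.re - w.re - n) ^ 2 + (z.im + w.im) ^ 2) / (4 * (z.im * w.im)) := by
  rw [cosh_half_dist_sq]
  congr 1
  · rw [← Complex.normSq_eq_norm_sq, Complex.normSq_apply]
    simp
    ring
  · simp

lemma sinh_half_dist_vadd_self (z : ℍ) (x : ℝ) :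
    Real.sinh (dist z (x +ᵥ z) / 2) = |x| / (2 * z.im) := by
  rw [UpperHalfPlane.sinh_half_dist]
  congr 1
  · rw [Complex.dist_eq]
    simp
  · simp [Real.sqrt_mul_self z.im_pos.le]

lemma smul_eq_vadd {A : SL(2, ℝ)} {x : ℝ}
    (h : (A : Matrix (Fin 2) (Fin 2) ℝ) = !![1, x; 0, 1] ∨
      (A : Matrix (Fin 2) (Fin 2) ℝ) = -!![1, x; 0, 1]) (z : ℍ) : A • z = x +ᵥ z := by
  have key : ∀ B : SL(2, ℝ), (B : Matrix (Fin 2) (Fin 2) ℝ) = !![1, x; 0, 1] →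
      B • z = x +ᵥ z := fun B hB => by
    ext
    rw [UpperHalfPlane.coe_specialLinearGroup_apply, hB]
    simp [add_comm]
  rcases h with h | h
  · exact key A h
  · rw [← neg_neg A, ← neg_one_mul, mul_smul, neg_one_smul_upperHalfPlane]
    refine key (-A) ?_
    rw [Matrix.SpecialLinearGroup.coe_neg, h, neg_neg]

lemma im_smul_eq (γ : SL(2, ℝ)) (z : ℍ) :
    (γ • z).im = z.im / ((γ 1 0 * z.re + γ 1 1) ^ 2 + (γ 1 0 * z.im) ^ 2) := by
  change (toGL γ • z).im = _
  rw [im_smul_eq_div_normSq, det_toGL, abs_one, one_mul, Complex.normSq_apply]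
  congr 1
  simp [denom]
  ring

lemma surfaceDist_symm_le (Γ : Subgroup SL(2, ℝ)) (z w : ℍ) :
    surfaceDist Γ z w ≤ surfaceDist Γ w z := by
  refine le_ciInf fun γ => (surfaceDist_le Γ z w ⟨γ⁻¹, rfl⟩).trans (le_of_eq ?_)
  change dist z ((γ : SL(2, ℝ))⁻¹ • w) = _
  rw [← dist_smul (γ : SL(2, ℝ)) z, smul_inv_smul, dist_comm]

/-- Together with `surfaceDist_symm_le`, this permits the assumption that `w` is not higher than
`z`. -/
lemma hypNorm_symm {Γ : Subgroup SL(2, ℝ)} {F : Set ℍ} {k : ℕ} {B : ℍ → ℍ → ℂ}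
    (hB : IsBergmanKernel Γ F k B) (z w : ℍ) : hypNorm k B z w = hypNorm k B w z := by
  obtain ⟨n, f, -, hf⟩ := hB
  have h : B z w = (starRingEnd ℂ) (B w z) := by
    rw [hf, hf, map_sum]
    refine Finset.sum_congr rfl fun i _ => ?_
    rw [map_mul, Complex.conj_conj, mul_comm]
  rw [hypNorm, hypNorm, h, RCLike.norm_conj, mul_comm (z.im ^ k)]

lemma le_dist_of_not_fix_infty {Γ : Subgroup SL(2, ℝ)} {F : Set ℍ} {z : ℍ} (hz : z ∈ F)
    {γ : SL(2, ℝ)} (hγ : γ ∈ Γ) (hc : γ 1 0 ≠ 0) :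
    injRadiusNoncompact Γ F ≤ dist z (γ • z) := by
  refine csInf_le ⟨0, ?_⟩ ⟨z, hz, γ, hγ, hc, rfl⟩
  rintro _ ⟨z, -, γ, -, -, rfl⟩
  exact dist_nonneg

namespace IsNormalizedOneCusp

variable {Γ : Subgroup SL(2, ℝ)}

lemma exists_translation (h : IsNormalizedOneCusp Γ) (n : ℤ) : ∃ γ ∈ Γ,
    (γ : Matrix (Fin 2) (Fin 2) ℝ) = !![1, (n : ℝ); 0, 1] ∨
      (γ : Matrix (Fin 2) (Fin 2) ℝ) = -!![1, (n : ℝ); 0, 1] := by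
  obtain ⟨-, hA | hA⟩ := (h.stabilizer ⟨!![1, (n : ℝ); 0, 1], by simp [Matrix.det_fin_two]⟩).mpr
    ⟨n, Or.inl rfl⟩
  · exact ⟨_, hA, Or.inl rfl⟩
  · exact ⟨_, hA, Or.inr rfl⟩

lemma smul_eq_int_vadd (h : IsNormalizedOneCusp Γ) {γ : SL(2, ℝ)} (hγ : γ ∈ Γ) (hc : γ 1 0 = 0) :
    ∃ n : ℤ, ∀ z : ℍ, γ • z = (n : ℝ) +ᵥ z := by
  obtain ⟨n, hn⟩ := (h.stabilizer γ).mp ⟨hc, Or.inl hγ⟩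
  exact ⟨n, smul_eq_vadd hn⟩

variable {F : Set ℍ}

/-- The part of `ℍ` above a certain height is covered by the integer translates of `F`. -/
lemma exists_eq_vadd (h : IsNormalizedOneCusp Γ) (hF : IsStrictFundamentalDomain Γ F) {p : ℍ}
    (hp : 1 < 2 * Real.sinh (injRadiusNoncompact Γ F / 2) * p.im) :
    ∃ n : ℤ, ∃ q ∈ F, (n : ℝ) +ᵥ p = q := by
  obtain ⟨q, ⟨hq, σ, hσ, rfl⟩, -⟩ := hF.existsUnique p
  obtain ⟨T, hT, hTm⟩ := h.exists_translation 1
  -- Otherwise `σ T σ⁻¹` does not fix `∞` and moves `σ p ∈ F` exactly as far as `T` moves `p`, a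
  -- distance less than the injectivity radius at this height.
  have hc : σ 1 0 = 0 := by
    by_contra hc
    have h1 : (σ * T * σ⁻¹) 1 0 ≠ 0 := by
      have h2 : (σ * T * σ⁻¹) 1 0 = -(σ 1 0) ^ 2 ∨ (σ * T * σ⁻¹) 1 0 = (σ 1 0) ^ 2 := by
        rcases hTm with hTm | hTm
        · left
          simp [Matrix.SpecialLinearGroup.coe_mul, Matrix.SpecialLinearGroup.coe_inv, hTm,
            Matrix.mul_apply, Fin.sum_univ_two, Matrix.adjugate_fin_two]
          ring
        · right
          simp [Matrix.SpecialLinearGroup.coe_mul, Matrix.SpecialLinearGroup.coe_inv, hTm,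
            Matrix.mul_apply, Fin.sum_univ_two, Matrix.adjugate_fin_two]
          ring
      have h3 : (σ 1 0) ^ 2 ≠ 0 := pow_ne_zero 2 hc
      rcases h2 with h2 | h2 <;> rw [h2]
      · exact neg_ne_zero.mpr h3
      · exact h3
    have h2 := le_dist_of_not_fix_infty hq (Γ.mul_mem (Γ.mul_mem hσ hT) (Γ.inv_mem hσ)) h1
    rw [← mul_smul, inv_mul_cancel_right, mul_smul, dist_smul, smul_eq_vadd hTm] at h2
    have h3 := Real.sinh_le_sinh.mpr (div_le_div_of_nonneg_right h2 zero_le_two)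
    rw [sinh_half_dist_vadd_self, le_div_iff₀ (by have := p.im_pos; positivity)] at h3
    norm_num at h3
    linarith
  obtain ⟨n, hn⟩ := h.smul_eq_int_vadd hσ hc
  exact ⟨n, _, hq, (hn p).symm⟩

/-- A lower bound for the lower left entries of the elements of `Γ` that do not fix `∞`. -/
lemma two_sinh_le_abs (h : IsNormalizedOneCusp Γ) (hF : IsStrictFundamentalDomain Γ F)
    (hr : 0 < injRadiusNoncompact Γ F) {γ : SL(2, ℝ)} (hγ : γ ∈ Γ) (hc : γ 1 0 ≠ 0) :
    2 * Real.sinh (injRadiusNoncompact Γ F / 2) ≤ |γ 1 0| := by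
  by_contra! hlt
  set S := 2 * Real.sinh (injRadiusNoncompact Γ F / 2)
  have hc0 : 0 < |γ 1 0| := abs_pos.mpr hc
  have hS : 0 < S := hc0.trans hlt
  have h1 : 1 / S < 1 / |γ 1 0| := one_div_lt_one_div_of_lt hc0 hlt
  -- Any height strictly between `1/S` and `1/|c|` works. Above the pole `-d/c` of `γ`, the image `γ
  -- p` has height `1/(c² t) > 1/|c| > t`. Both points are high enough to be translated into `F`,
  -- where being equivalent they coincide, contradicting their different heights.
  set t := (1 / S + 1 / |γ 1 0|) / 2 with ht
  have hS1 : 0 < 1 / S := by positivity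
  have ht0 : 1 / S < t := by linarith
  have ht1 : t < 1 / |γ 1 0| := by linarith
  have htp : 0 < t := hS1.trans ht0
  let p : ℍ := ⟨⟨-(γ 1 1) / γ 1 0, t⟩, htp⟩
  have him : (γ • p).im = 1 / (|γ 1 0| ^ 2 * t) := by
    have hre : p.re = -(γ 1 1) / γ 1 0 := rfl
    have hpi : p.im = t := rfl
    rw [im_smul_eq, hre, hpi, sq_abs]
    field_simp
    ring
  have h2 : 1 / |γ 1 0| < (γ • p).im := by
    rw [him]
    refine one_div_lt_one_div_of_lt (by positivity) ?_
    rw [lt_div_iff₀ hc0] at ht1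
    nlinarith
  obtain ⟨n₁, q₁, hq₁, e₁⟩ := h.exists_eq_vadd hF (p := p) (by
    change 1 < S * t
    rwa [div_lt_iff₀' hS] at ht0)
  obtain ⟨n₂, q₂, hq₂, e₂⟩ := h.exists_eq_vadd hF (p := γ • p) (by
    change 1 < S * (γ • p).im
    rw [← div_lt_iff₀' hS]
    linarith)
  obtain ⟨T₁, hT₁, m₁⟩ := h.exists_translation n₁
  obtain ⟨T₂, hT₂, m₂⟩ := h.exists_translation n₂
  have heq : q₁ = q₂ := (hF.existsUnique p).unique
    ⟨hq₁, T₁, hT₁, by rw [smul_eq_vadd m₁, e₁]⟩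
    ⟨hq₂, T₂ * γ, Γ.mul_mem hT₂ hγ, by rw [mul_smul, smul_eq_vadd m₂, e₂]⟩
  have h3 : p.im = (γ • p).im := by
    have := congrArg UpperHalfPlane.im (e₁.trans (heq.trans e₂.symm))
    simpa using this
  have h4 : p.im = t := rfl
  linarith

/-- The lower bound on `|c|` gives `Im (γ w) ≤ 1/(S² Im w)`, and the distance is at least the
difference of the logarithms of the heights. -/
lemma log_le_dist (h : IsNormalizedOneCusp Γ) (hF : IsStrictFundamentalDomain Γ F)
    (hr : 0 < injRadiusNoncompact Γ F) {γ : SL(2, ℝ)} (hγ : γ ∈ Γ) (hc : γ 1 0 ≠ 0) (z w : ℍ) :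
    Real.log ((z.im * (2 * Real.sinh (injRadiusNoncompact Γ F / 2))) *
      (w.im * (2 * Real.sinh (injRadiusNoncompact Γ F / 2)))) ≤ dist z (γ • w) := by
  set S := 2 * Real.sinh (injRadiusNoncompact Γ F / 2)
  have hS : 0 < S := by
    have := Real.sinh_pos_iff.mpr (by linarith : 0 < injRadiusNoncompact Γ F / 2)
    positivity
  have hz := z.im_pos
  have hw := w.im_pos
  have hSc : S ≤ |γ 1 0| := h.two_sinh_le_abs hF hr hγ hc
  have h1 : (γ • w).im ≤ 1 / (S ^ 2 * w.im) := by
    rw [im_smul_eq, div_le_div_iff₀ (by positivity) (by positivity)]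
    have h2 : S ^ 2 ≤ (γ 1 0) ^ 2 := by
      rw [← sq_abs (γ 1 0)]
      gcongr
    nlinarith [sq_nonneg (γ 1 0 * w.re + γ 1 1), mul_le_mul_of_nonneg_right h2 (sq_nonneg w.im)]
  have h2 := (γ • w).im_pos
  have h3 := dist_log_im_le z (γ • w)
  rw [Real.dist_eq, ← Real.log_div hz.ne' h2.ne'] at h3
  refine le_trans (Real.log_le_log (by positivity) ?_) ((le_abs_self _).trans h3)
  rw [le_div_iff₀ h2]
  rw [le_div_iff₀ (by positivity)] at h1
  nlinarith

end IsNormalizedOneCusp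

/-! ### The noncompact case. -/

namespace IsNormalizedOneCusp

variable {Γ : Subgroup SL(2, ℝ)} {F : Set ℍ}

/-- Two distinct points of the orbit of `w` are either at distance at least the injectivity radius,
or they are, up to an isometry, `w` and an integer translate of `w`. -/
lemma min_le_dist (h : IsNormalizedOneCusp Γ) {w : ℍ} (hw : w ∈ F) {s : ℝ}
    (hsr : s ≤ injRadiusNoncompact Γ F) (hs : Real.sinh (s / 2) ≤ 1 / (2 * w.im)) {p q : ℍ}
    (hp : p ∈ MulAction.orbit Γ w) (hq : q ∈ MulAction.orbit Γ w) (hpq : p ≠ q) :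
    s ≤ dist p q := by
  obtain ⟨γ, rfl⟩ := hp
  obtain ⟨γ', rfl⟩ := hq
  change (γ : SL(2, ℝ)) • w ≠ (γ' : SL(2, ℝ)) • w at hpq
  change s ≤ dist ((γ : SL(2, ℝ)) • w) ((γ' : SL(2, ℝ)) • w)
  rw [dist_smul_smul_eq]
  have hη := Γ.mul_mem (Γ.inv_mem γ.2) γ'.2
  by_cases hc : ((γ : SL(2, ℝ))⁻¹ * γ') 1 0 = 0
  · obtain ⟨n, hn⟩ := h.smul_eq_int_vadd hη hc
    have hn0 : n ≠ 0 := by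
      rintro rfl
      have h1 := hn w
      rw [mul_smul, inv_smul_eq_iff] at h1
      simp only [Int.cast_zero, zero_vadd] at h1
      exact hpq h1.symm
    have hn1 : (1 : ℝ) ≤ |(n : ℝ)| := by exact_mod_cast Int.one_le_abs hn0
    have h2 : Real.sinh (s / 2) ≤ Real.sinh (dist w ((n : ℝ) +ᵥ w) / 2) := by
      rw [sinh_half_dist_vadd_self]
      refine hs.trans ?_
      have := w.im_pos
      gcongr
    rw [Real.sinh_le_sinh] at h2
    rw [hn]
    linarith
  · exact hsr.trans (le_dist_of_not_fix_infty hw hη hc)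

lemma cosh_half_log_sq {P : ℝ} (hP : 0 < P) :
    4 * P * Real.cosh (Real.log P / 2) ^ 2 = (P + 1) ^ 2 := by
  have h1 := Real.cosh_two_mul (Real.log P / 2)
  rw [show 2 * (Real.log P / 2) = Real.log P by ring, Real.cosh_log hP, Real.sinh_sq] at h1
  have h2 : Real.cosh (Real.log P / 2) ^ 2 = ((P + P⁻¹) / 2 + 1) / 2 := by linarith
  rw [h2]
  field_simp
  ring

/-- The contribution of the elements of `Γ` that do not fix `∞`. -/
lemma tsum_not_fix_infty_le (h : IsNormalizedOneCusp Γ) (hΓ : IsSurfaceGroup Γ)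
    (hF : IsStrictFundamentalDomain Γ F) (hr : 0 < injRadiusNoncompact Γ F) {k : ℕ} (hk : 3 ≤ k)
    {δ : ℝ} (hδ : injRadiusNoncompact Γ F ≤ δ) {z w : ℍ} (hw : w ∈ F) (hwz : w.im ≤ z.im)
    (hzw : δ ≤ surfaceDist Γ z w) :
    ∑' p : {p : ℍ | ∃ γ ∈ Γ, γ 1 0 ≠ 0 ∧ γ • w = p},
      ENNReal.ofReal (Real.cosh (dist z (p : ℍ) / 2) ^ (2 * k))⁻¹ ≤
        ENNReal.ofReal (Real.sinh (δ + injRadiusNoncompact Γ F) /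
          (Real.sinh (injRadiusNoncompact Γ F) *
            Real.cosh ((δ - injRadiusNoncompact Γ F) / 2) ^ (2 * k)) +
          mainTerms k δ (injRadiusNoncompact Γ F)) := by
  set r := injRadiusNoncompact Γ F with hrdef
  set A : Set ℍ := {p : ℍ | ∃ γ ∈ Γ, γ 1 0 ≠ 0 ∧ γ • w = p} with hA
  have hsub : A ⊆ MulAction.orbit Γ w := by
    rintro p ⟨γ, hγ, -, rfl⟩
    exact ⟨⟨γ, hγ⟩, rfl⟩
  have := hΓ.countable_orbit w
  have hcount : Countable A := (Set.Countable.mono hsub (Set.to_countable _)).to_subtype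
  have hz0 := z.im_pos
  have hw0 := w.im_pos
  have hsr := Real.sinh_pos_iff.mpr (by linarith : 0 < r / 2)
  have hAδ : ∀ p ∈ A, δ ≤ dist z p := fun p hp => hzw.trans (surfaceDist_le Γ z w (hsub hp))
  -- Below height `1/(2 sinh(r/2))` even the unit translation moves `w` by at least `r`, so the
  -- compact argument applies. Above it, `s` is the displacement of `w` under the unit translation.
  rcases le_total (w.im * (2 * Real.sinh (r / 2))) 1 with hv | hv
  · have hsep : ∀ p ∈ A, ∀ q ∈ A, p ≠ q → r ≤ dist p q := fun p hp q hq hpq => by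
      refine h.min_le_dist hw le_rfl ?_ (hsub hp) (hsub hq) hpq
      rw [le_div_iff₀ (by positivity)]
      linarith
    refine (tsum_inv_cosh_pow_le (by omega : 2 ≤ k) hr (by linarith) hsep hAδ).trans
      (ENNReal.ofReal_le_ofReal ?_)
    linarith [packingBound_le_mainTerms hk hr hδ, first_term_nonneg (k := k) hr hδ]
  · set S := 2 * Real.sinh (r / 2) with hS
    obtain ⟨s, hs⟩ : ∃ s, s = 2 * Real.arsinh (1 / (2 * w.im)) := ⟨_, rfl⟩
    have hss : Real.sinh (s / 2) = 1 / (2 * w.im) := by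
      rw [hs, mul_div_cancel_left₀ _ two_ne_zero, Real.sinh_arsinh]
    have hs0 : 0 < s := by
      have : 0 < Real.sinh (s / 2) := by rw [hss]; positivity
      rw [Real.sinh_pos_iff] at this
      linarith
    have hsr' : s ≤ r := by
      have : Real.sinh (s / 2) ≤ Real.sinh (r / 2) := by
        rw [hss, div_le_iff₀ (by positivity)]
        linarith
      rw [Real.sinh_le_sinh] at this
      linarith
    set P := (z.im * S) * (w.im * S) with hP
    have hS0 : 0 < S := by positivity
    have hP0 : 0 < P := by positivity
    have hl : w.im * S ≤ z.im * S := by gcongr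
    have hP1 : 1 ≤ P := by nlinarith
    have hsep : ∀ p ∈ A, ∀ q ∈ A, p ≠ q → s ≤ dist p q := fun p hp q hq hpq =>
      h.min_le_dist hw hsr' hss.le (hsub hp) (hsub hq) hpq
    have hAδ' : ∀ p ∈ A, max δ (Real.log P) ≤ dist z p := fun p hp => by
      refine max_le (hAδ p hp) ?_
      obtain ⟨γ, hγ, hc, rfl⟩ := hp
      exact h.log_le_dist hF hr hγ hc z w
    have hδ' := le_max_left δ (Real.log P)
    refine (tsum_inv_cosh_pow_le (by omega : 2 ≤ k) hs0 (by linarith) hsep hAδ').trans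
      (ENNReal.ofReal_le_ofReal ?_)
    refine packingBound_le_of_cusp hk hr hδ hδ' hs0 hsr' hv hl ?_ ?_ ?_
    · rw [hss, hS]
      field_simp
    · obtain ⟨γ, hγ, hm⟩ := h.exists_translation (round (z.re - w.re))
      have h1 : δ ≤ dist z (((round (z.re - w.re) : ℤ) : ℝ) +ᵥ w) := by
        rw [← smul_eq_vadd hm]
        exact hzw.trans (surfaceDist_le Γ z w ⟨⟨γ, hγ⟩, rfl⟩)
      -- The nearest translate of `w` is horizontally within `1/2` of `z`, yet at distance at least
      -- `δ`. This bounds `δ` above; after scaling by `S²` the `1/4` becomes `sinh²(r/2)`.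
      have h2 : Real.cosh (δ / 2) ^ 2 ≤ (1 / 4 + (z.im + w.im) ^ 2) / (4 * (z.im * w.im)) := by
        calc Real.cosh (δ / 2) ^ 2
            ≤ Real.cosh (dist z (((round (z.re - w.re) : ℤ) : ℝ) +ᵥ w) / 2) ^ 2 := by
              have := Real.cosh_pos (δ / 2)
              gcongr
              rw [Real.cosh_le_cosh, abs_of_pos (by linarith), abs_of_nonneg (by positivity)]
              linarith
          _ ≤ _ := by
              rw [cosh_half_dist_vadd_sq]
              have h3 := abs_le.mp (abs_sub_round (z.re - w.re))
              gcongr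
              nlinarith
      rw [le_div_iff₀ (by positivity)] at h2
      have h3 : Real.sinh (r / 2) ^ 2 = S ^ 2 / 4 := by rw [hS]; ring
      rw [h3]
      have h4 : 4 * (z.im * S * (w.im * S)) * Real.cosh (δ / 2) ^ 2 =
          S ^ 2 * (Real.cosh (δ / 2) ^ 2 * (4 * (z.im * w.im))) := by ring
      rw [h4]
      calc _ ≤ S ^ 2 * (1 / 4 + (z.im + w.im) ^ 2) := by gcongr
        _ = _ := by ring
    · rw [← cosh_half_log_sq hP0]
      have h1 : Real.cosh (Real.log P / 2) ≤ Real.cosh (max δ (Real.log P) / 2) := by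
        have h2 := Real.log_nonneg hP1
        have h3 := le_max_right δ (Real.log P)
        rw [Real.cosh_le_cosh, abs_of_nonneg (by linarith), abs_of_nonneg (by linarith)]
        linarith
      have h2 := Real.cosh_pos (Real.log P / 2)
      gcongr

lemma hypNorm_le_of_im_le (h : IsNormalizedOneCusp Γ) (hΓ : IsSurfaceGroup Γ)
    (hF : IsStrictFundamentalDomain Γ F) (hvol : volume F < ⊤)
    (hr : 0 < injRadiusNoncompact Γ F) {k : ℕ} (hk : 3 ≤ k) {B : ℍ → ℍ → ℂ}
    (hB : IsBergmanKernel Γ F k B) {δ : ℝ} (hδ : injRadiusNoncompact Γ F ≤ δ) {z w : ℍ}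
    (hw : w ∈ F) (hwz : w.im ≤ z.im) (hzw : δ ≤ surfaceDist Γ z w) :
    hypNorm k B z w ≤ boundConst k δ (injRadiusNoncompact Γ F)
      + (2 * k - 1) / (4 * Real.pi * Real.cosh (δ / 2) ^ (2 * k))
      + (2 * k - 1) * √(z.im * w.im) / √Real.pi * (Real.Gamma (k - 1 / 2) / Real.Gamma k) := by
  have hk' : (3 : ℝ) ≤ k := by exact_mod_cast hk
  have hmain := h.tsum_not_fix_infty_le hΓ hF hr hk hδ hw hwz hzw
  have htrans := tsum_translates_le (k := k) (z := z) (w := w) (by omega) (by linarith : 0 ≤ δ)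
    fun n => by
      obtain ⟨γ, hγ, hm⟩ := h.exists_translation n
      rw [← smul_eq_vadd hm]
      exact hzw.trans (surfaceDist_le Γ z w ⟨⟨γ, hγ⟩, rfl⟩)
  have hM0 : 0 ≤ Real.sinh (δ + injRadiusNoncompact Γ F) /
      (Real.sinh (injRadiusNoncompact Γ F) *
        Real.cosh ((δ - injRadiusNoncompact Γ F) / 2) ^ (2 * k)) +
      mainTerms k δ (injRadiusNoncompact Γ F) :=
    add_nonneg (first_term_nonneg hr hδ)
      ((packingBound_nonneg hk (by linarith) hr).trans (packingBound_le_mainTerms hk hr hδ))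
  have hG : 0 ≤ Real.Gamma (k - 1 / 2) / Real.Gamma k :=
    div_nonneg (Real.Gamma_pos_of_pos (by linarith)).le (Real.Gamma_pos_of_pos (by linarith)).le
  have hT0 : 0 ≤ (Real.cosh (δ / 2) ^ (2 * k))⁻¹ +
      4 * √Real.pi * √(z.im * w.im) * (Real.Gamma (k - 1 / 2) / Real.Gamma k) := by
    have := Real.cosh_pos (δ / 2)
    positivity
  set f : ℍ → ENNReal := fun p => ENNReal.ofReal (Real.cosh (dist z p / 2) ^ (2 * k))⁻¹
  have hsub : MulAction.orbit Γ w ⊆ {p : ℍ | ∃ γ ∈ Γ, γ 1 0 ≠ 0 ∧ γ • w = p} ∪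
      Set.range fun n : ℤ => (n : ℝ) +ᵥ w := by
    rintro _ ⟨γ, rfl⟩
    by_cases hc : (γ : SL(2, ℝ)) 1 0 = 0
    · obtain ⟨n, hn⟩ := h.smul_eq_int_vadd γ.2 hc
      exact Or.inr ⟨n, (hn w).symm⟩
    · exact Or.inl ⟨γ, γ.2, hc, rfl⟩
  have hinj : Function.Injective fun n : ℤ => (n : ℝ) +ᵥ w :=
    (UpperHalfPlane.vadd_left_injective w).comp Int.cast_injective
  have hsum : ∑' p : MulAction.orbit Γ w, f p ≤ ENNReal.ofReal _ :=
    ((ENNReal.tsum_mono_subtype f hsub).trans (ENNReal.tsum_union_le f _ _)).trans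
      ((add_le_add hmain ((tsum_range f hinj).trans_le htrans)).trans_eq
        (ENNReal.ofReal_add hM0 hT0).symm)
  refine (hΓ.hypNorm_le hF hvol (by omega) hB z w (add_nonneg hM0 hT0) hsum).trans_eq ?_
  rw [mul_add, ← boundConst_eq hk, mul_add, ← add_assoc]
  congr 1
  · congr 1
    rw [← div_eq_mul_inv, div_div]
  · have h1 : √Real.pi ≠ 0 := (Real.sqrt_pos.mpr Real.pi_pos).ne'
    rw [show 4 * Real.pi = 4 * √Real.pi * √Real.pi by
      rw [mul_assoc, Real.mul_self_sqrt Real.pi_pos.le]]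
    field_simp

theorem hypNorm_le (h : IsNormalizedOneCusp Γ) (hΓ : IsSurfaceGroup Γ)
    (hF : IsStrictFundamentalDomain Γ F) (hvol : volume F < ⊤)
    (hr : 0 < injRadiusNoncompact Γ F) {k : ℕ} (hk : 3 ≤ k) {B : ℍ → ℍ → ℂ}
    (hB : IsBergmanKernel Γ F k B) {δ : ℝ} (hδ : injRadiusNoncompact Γ F ≤ δ) {z w : ℍ}
    (hz : z ∈ F) (hw : w ∈ F) (hzw : δ ≤ surfaceDist Γ z w) :
    hypNorm k B z w ≤ boundConst k δ (injRadiusNoncompact Γ F)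
      + (2 * k - 1) / (4 * Real.pi * Real.cosh (δ / 2) ^ (2 * k))
      + (2 * k - 1) * √(z.im * w.im) / √Real.pi * (Real.Gamma (k - 1 / 2) / Real.Gamma k) := by
  rcases le_total w.im z.im with hwz | hwz
  · exact h.hypNorm_le_of_im_le hΓ hF hvol hr hk hB hδ hw hwz hzw
  · rw [hypNorm_symm hB, mul_comm z.im]
    exact h.hypNorm_le_of_im_le hΓ hF hvol hr hk hB hδ hz hwz
      (hzw.trans (surfaceDist_symm_le Γ z w))

end IsNormalizedOneCusp

end BergmanOffDiagonal

theorem mainTheorem1 (Γ : Subgroup SL(2, ℝ)) (hΓ : BergmanOffDiagonal.IsSurfaceGroup Γ)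
    (F : Set ℍ) (hF : BergmanOffDiagonal.IsStrictFundamentalDomain Γ F)
    (hvol : volume F < ⊤) :
    -- the compact case
    (CompactSpace (BergmanOffDiagonal.Surface Γ) →
      ∀ (k : ℕ), 3 ≤ k → ∀ (B : ℍ → ℍ → ℂ), BergmanOffDiagonal.IsBergmanKernel Γ F k B →
      ∀ (δ : ℝ), BergmanOffDiagonal.injRadiusCompact Γ ≤ δ →
      ∀ (z w : ℍ), δ ≤ BergmanOffDiagonal.surfaceDist Γ z w →
        BergmanOffDiagonal.hypNorm k B z w
          ≤ BergmanOffDiagonal.boundConst k δ (BergmanOffDiagonal.injRadiusCompact Γ)) ∧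
    -- the noncompact case
    (NoncompactSpace (BergmanOffDiagonal.Surface Γ) →
      BergmanOffDiagonal.IsNormalizedOneCusp Γ →
      0 < BergmanOffDiagonal.injRadiusNoncompact Γ F →
      ∀ (k : ℕ), 3 ≤ k → ∀ (B : ℍ → ℍ → ℂ), BergmanOffDiagonal.IsBergmanKernel Γ F k B →
      ∀ (δ : ℝ), BergmanOffDiagonal.injRadiusNoncompact Γ F ≤ δ →
      ∀ z ∈ F, ∀ w ∈ F, δ ≤ BergmanOffDiagonal.surfaceDist Γ z w →
        BergmanOffDiagonal.hypNorm k B z w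
          ≤ BergmanOffDiagonal.boundConst k δ (BergmanOffDiagonal.injRadiusNoncompact Γ F)
            + (2 * k - 1) / (4 * Real.pi * Real.cosh (δ / 2) ^ (2 * k))
            + (2 * k - 1) * √(z.im * w.im) / √Real.pi
                * (Real.Gamma (k - 1 / 2) / Real.Gamma k)) ∧
    -- the decay of the constant
    (∀ r : ℝ, 0 < r → ∃ K : ℝ, 0 < K ∧ ∀ (k : ℕ), 3 ≤ k → ∀ (δ : ℝ), r ≤ δ →
      BergmanOffDiagonal.boundConst k δ r
        ≤ K * k / Real.cosh ((δ - r) / 2) ^ (2 * k - 4)) := by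
  refine ⟨fun hX k hk B hB δ hδ z w hzw =>
      BergmanOffDiagonal.IsSurfaceGroup.hypNorm_le_of_compact hΓ hF hvol hX hk hB hδ hzw,
    fun _ hcusp hr k hk B hB δ hδ z hz w hw hzw =>
      BergmanOffDiagonal.IsNormalizedOneCusp.hypNorm_le hcusp hΓ hF hvol hr hk hB hδ hz hw hzw,
    fun r hr => BergmanOffDiagonal.boundConst_le hr⟩
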